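/- Let $\mathfrak f$ be a finite field, $\psi:\mathfrak f\to\mathbb C^\times$ a nontrivial additive character, and $G_n=GL_n(\mathfrak f)$, $n\ge 1$. Let $U_n\subset G_n$ be the group of upper triangular matrices with ones on the diagonal, and put $\psi(u)=\psi(u_{12}+u_{23}+\cdots+u_{n-1,n})$ for $u\in U_n$. All representations are over $\mathbb C$. An irreducible representation of $G_n$ is called cuspidal if it has no nonzero vector fixed by the unipotent radical of a proper standard parabolic subgroup (so for $n=1$ every irreducible representation is cuspidal). For an irreducible cuspidal representation $\sigma$ of $G_n$, let $\mathcal W(\sigma,\psi)$ be its Whittaker model, i.e. the space of functions $g\mapsto \ell(\sigma(g)v)$ on $G_n$, with $v\in\sigma$ and $\ell$ a linear form on $\sigma$ satisfying $\ell(\sigma(u)v)=\psi(u)\ell(v)$ for all $u\in U_n$ and $v\in\sigma$ (such an $\ell\neq 0$ exists and is unique up to scalars). For $m<n$ and an irreducible cuspidal representation $\tau$ of $G_m$, the gamma factor $\gamma(\sigma\times\tau,\psi)$ is the unique complex number such that $$\gamma(\sigma\times\tau,\psi)\sum_{h\in U_m\backslash G_m}W\begin{pmatrix}h&\\&I_{n-m}\end{pmatrix}W'(h)=\sum_{h\in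 U_m\backslash G_m}\ \sum_{x\in M_{m,n-m-1}(\mathfrak f)}W\begin{pmatrix}0&1&0\\0&0&I_{n-m-1}\\h&0&x\end{pmatrix}W'(h)$$ for all $W\in\mathcal W(\sigma,\psi)$ and $W'\in\mathcal W(\tau,\psi^{-1})$. **Theorem 5.2.** Let $\sigma_1,\sigma_2$ be irreducible cuspidal representations of $G_n$ with the same central character. If $$\gamma(\sigma_1\times\tau,\psi)=\gamma(\sigma_2\times\tau,\psi)$$ for all irreducible cuspidal representations $\tau$ of $G_r$ with $1\le r\le\left[\frac n2\right]$, then $\sigma_1\cong\sigma_2$. -/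

import Mathlib

open scoped MatrixGroups

namespace FiniteGL

universe u v w

variable {F : Type u} [Field F]

section Groups

/-- A function `b` assigns to each index the label of a block; the associated group consists of the
matrices `g` with `g i i = 1` whose other nonzero entries satisfy `b i < b j`.
For monotone `b`, the labels cut `{0, …, n-1}` into consecutive blocks, and this is the unipotent
radical of the corresponding standard (block upper triangular) parabolic subgroup of `GL_n(F)`. -/
def unipotentRadical {n : ℕ} (b : Fin n → ℕ) : Subgroup (GL (Fin n) F) where
  carrier := {g | ∀ i j, ¬ b i < b j → g i j = if i = j then 1 else 0}
  one_mem' := by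
    intro i j _
    simp [Matrix.one_apply]
  mul_mem' := by
    intro g h hg hh i j hij
    rw [Matrix.GeneralLinearGroup.coe_mul, Matrix.mul_apply, Finset.sum_eq_single i]
    · rw [hg i i (lt_irrefl _), hh i j hij]
      simp
    · intro k _ hki
      by_cases hik : b i < b k
      · have hkj : ¬ b k < b j := fun h' => hij (hik.trans h')
        have hne : k ≠ j := by
          rintro rfl
          exact hij hik
        rw [hh k j hkj, if_neg hne, mul_zero]
      · rw [hg i k hik, if_neg (Ne.symm hki), zero_mul]
    · simp
  inv_mem' := by
    intro g hg
    have wf : WellFounded (fun k i : Fin n => b i < b k) := by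
      have : IsTrans (Fin n) (fun k i : Fin n => b i < b k) := ⟨fun _ _ _ h₁ h₂ => h₂.trans h₁⟩
      have : Std.Irrefl (fun k i : Fin n => b i < b k) := ⟨fun _ => lt_irrefl _⟩
      exact Finite.wellFounded_of_trans_of_irrefl _
    intro i
    induction i using wf.induction with
    | _ i ih =>
      intro j hij
      have key : (g * g⁻¹ : GL (Fin n) F) i j = if i = j then 1 else 0 := by
        simp [Matrix.one_apply]
      rw [Matrix.GeneralLinearGroup.coe_mul, Matrix.mul_apply, Finset.sum_eq_single i] at key
      · rwa [hg i i (lt_irrefl _), if_pos rfl, one_mul] at key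
      · intro k _ hki
        by_cases hik : b i < b k
        · have hkj : ¬ b k < b j := fun h' => hij (hik.trans h')
          have hne : k ≠ j := by
            rintro rfl
            exact hij hik
          rw [ih k hik j hkj, if_neg hne, mul_zero]
        · rw [hg i k hik, if_neg (Ne.symm hki), zero_mul]
      · simp

/-- The group `U_n(F)` of upper triangular matrices with ones on the diagonal. -/
def upperUnipotent (F : Type u) [Field F] (n : ℕ) : Subgroup (GL (Fin n) F) :=
  unipotentRadical (fun i : Fin n => (i : ℕ))

/-- The function `u ↦ ψ(u_{12} + u_{23} + ⋯ + u_{n-1,n})`; on `U_n(F)` it is a character. -/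
def unipotentChar {n : ℕ} (ψ : AddChar F ℂ) (u : GL (Fin n) F) : ℂ :=
  ψ (∑ i : Fin n, if h : (i : ℕ) + 1 < n then u i ⟨(i : ℕ) + 1, h⟩ else 0)

end Groups

section Representations

variable {n : ℕ} {V : Type v} [AddCommGroup V] [Module ℂ V]

/-- An irreducible complex representation of `GL_n(F)` is cuspidal if it has no nonzero vector fixed
by the unipotent radical of a proper standard parabolic subgroup. (Monotone block labellings give
the standard parabolics, and nonconstant ones give the proper ones.) -/
def IsIrreducibleCuspidal (σ : Representation ℂ (GL (Fin n) F) V) : Prop :=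
  σ.IsIrreducible ∧
    ∀ b : Fin n → ℕ, Monotone b → (∃ i j, b i < b j) →
      ∀ x : V, (∀ u ∈ unipotentRadical (F := F) b, σ u x = x) → x = 0

/-- The centre of `GL_n(F)` acts on `σ` through the character `ω`. -/
def HasCentralCharacter (σ : Representation ℂ (GL (Fin n) F) V)
    (ω : Subgroup.center (GL (Fin n) F) →* ℂˣ) : Prop :=
  ∀ (z : Subgroup.center (GL (Fin n) F)) (x : V),
    σ (z : GL (Fin n) F) x = (ω z : ℂ) • x

/-- A Whittaker functional: a linear form on which `U_n(F)` acts by the character `ψ`. -/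
def IsWhittakerFunctional (σ : Representation ℂ (GL (Fin n) F) V) (ψ : AddChar F ℂ)
    (l : V →ₗ[ℂ] ℂ) : Prop :=
  ∀ u ∈ upperUnipotent F n, ∀ x : V, l (σ u x) = unipotentChar ψ u * l x

/-- The Whittaker model `𝒲(σ, ψ)`: the functions `g ↦ l (σ(g) x)` on `GL_n(F)`, for Whittaker
functionals `l` and vectors `x`. (For irreducible cuspidal `σ` and nontrivial `ψ`
a nonzero `l` exists and is unique up to scalars, and this is then the image of `σ` in the
representation induced from `ψ`.) -/
def whittakerModel (σ : Representation ℂ (GL (Fin n) F) V) (ψ : AddChar F ℂ) :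
    Set (GL (Fin n) F → ℂ) :=
  {W | ∃ l : V →ₗ[ℂ] ℂ, IsWhittakerFunctional σ ψ l ∧ ∃ x : V, W = fun g => l (σ g x)}

end Representations

section Gamma

variable {n m : ℕ}

/-- The splitting of `n` indices into the first `m` and the last `(n - m - 1) + 1`. -/
def splitFirst (hmn : m < n) : Fin m ⊕ Fin (n - m - 1 + 1) ≃ Fin n :=
  finSumFinEquiv.trans (finCongr (by omega))

/-- The splitting of `n` indices into the first `(n - m - 1) + 1` and the last `m`. -/
def splitLast (hmn : m < n) : Fin (n - m - 1 + 1) ⊕ Fin m ≃ Fin n :=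
  finSumFinEquiv.trans (finCongr (by omega))

/-- The block diagonal matrix `[h, 0; 0, I_{n-m}]`. -/
def diagEmbed (hmn : m < n) (h : GL (Fin m) F) : GL (Fin n) F where
  val := Matrix.reindex (splitFirst hmn) (splitFirst hmn)
    (Matrix.fromBlocks (h : Matrix (Fin m) (Fin m) F) 0 0 1)
  inv := Matrix.reindex (splitFirst hmn) (splitFirst hmn)
    (Matrix.fromBlocks ((h⁻¹ : GL (Fin m) F) : Matrix (Fin m) (Fin m) F) 0 0 1)
  val_inv := by
    simp [Matrix.reindex_apply, Matrix.submatrix_mul_equiv, Matrix.fromBlocks_multiply,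
      -Matrix.coe_units_inv]
  inv_val := by
    simp [Matrix.reindex_apply, Matrix.submatrix_mul_equiv, Matrix.fromBlocks_multiply,
      -Matrix.coe_units_inv]

/-- The `m × (k + 1)` matrix `(0 | x)`: a zero column followed by `x`. -/
def padZero {k : ℕ} (x : Matrix (Fin m) (Fin k) F) : Matrix (Fin m) (Fin (k + 1)) F :=
  Matrix.of fun i => Fin.cons 0 (x i)

/-- The matrix `[0, 1, 0; 0, 0, I_{n-m-1}; h, 0, x]`, where `x` is `m × (n-m-1)`, in the form
`[0, I_{n-m}; h, (0 | x)]`. -/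
def antiEmbed (hmn : m < n) (h : GL (Fin m) F) (x : Matrix (Fin m) (Fin (n - m - 1)) F) :
    GL (Fin n) F where
  val := Matrix.reindex (splitLast hmn) (splitFirst hmn)
    (Matrix.fromBlocks 0 1 (h : Matrix (Fin m) (Fin m) F) (padZero x))
  inv := Matrix.reindex (splitFirst hmn) (splitLast hmn)
    (Matrix.fromBlocks (-(((h⁻¹ : GL (Fin m) F) : Matrix (Fin m) (Fin m) F) * padZero x))
      ((h⁻¹ : GL (Fin m) F) : Matrix (Fin m) (Fin m) F) 1 0)
  val_inv := by
    simp [Matrix.reindex_apply, Matrix.submatrix_mul_equiv, Matrix.fromBlocks_multiply,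
      ← Matrix.mul_assoc, -Matrix.coe_units_inv]
  inv_val := by
    simp [Matrix.reindex_apply, Matrix.submatrix_mul_equiv, Matrix.fromBlocks_multiply,
      -Matrix.coe_units_inv]

/-- The sum over `U_m(F) \ GL_m(F)` of a function that is invariant under left translation by
`U_m(F)`, computed through representatives of the cosets `U_m(F) h`. -/
noncomputable def cosetSum (f : GL (Fin m) F → ℂ) : ℂ :=
  ∑ᶠ q : Quotient (QuotientGroup.rightRel (upperUnipotent F m)), f q.out

variable {V : Type v} [AddCommGroup V] [Module ℂ V] {V' : Type w} [AddCommGroup V'] [Module ℂ V']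

/-- The functional equation that defines the gamma factor of `σ × σ'` for `GL_n(F) × GL_m(F)`,
`m < n`: it has to hold for all `W ∈ 𝒲(σ, ψ)` and `W' ∈ 𝒲(σ', ψ⁻¹)`. -/
def IsGammaFactor (ψ : AddChar F ℂ) (hmn : m < n)
    (σ : Representation ℂ (GL (Fin n) F) V) (σ' : Representation ℂ (GL (Fin m) F) V')
    (c : ℂ) : Prop :=
  ∀ W ∈ whittakerModel σ ψ, ∀ W' ∈ whittakerModel σ' ψ⁻¹,
    c * cosetSum (fun h => W (diagEmbed hmn h) * W' h) =
      cosetSum (fun h =>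
        ∑ᶠ x : Matrix (Fin m) (Fin (n - m - 1)) F, W (antiEmbed hmn h x) * W' h)

open Classical in
/-- The gamma factor `γ(σ × σ', ψ)`: the number that satisfies the functional equation. (For a
finite field, irreducible cuspidal `σ`, `σ'` and nontrivial `ψ` there is exactly one.) -/
noncomputable def gammaFactor (ψ : AddChar F ℂ) (hmn : m < n)
    (σ : Representation ℂ (GL (Fin n) F) V) (σ' : Representation ℂ (GL (Fin m) F) V') : ℂ :=
  if h : ∃! c : ℂ, IsGammaFactor ψ hmn σ σ' c then h.choose else 0

end Gamma

end FiniteGL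

/-!
A cuspidal representation `σ` of `GL_n(F)` has a Bessel function `J(g) = l(σ(g) w)`, where `l` is
its Whittaker functional and `w` the dual `ψ`-equivariant vector with `l(w) = 1`. It transforms
under `U_n` by `ψ` on both sides, and its right translates span the Whittaker model, so it
determines `σ` (`nonempty_equiv_of_bessel_eq`). The theorem is proved by showing that the Bessel
functions `J₁`, `J₂` of `σ₁`, `σ₂` coincide.

The basic facts are multiplicity one (`whittakerSum_mem_span`), because the anti-automorphism
`g ↦ w gᵗ w` fixes all bi-equivariant functions and so makes the Hecke algebra of `(U_n, ψ)`
commutative, and injectivity of the Kirillov model (`eq_zero_of_whittakerSum_mirabolic`): the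
restriction of Whittaker functions to the mirabolic subgroup `P` is injective by cuspidality. On
`P` the Bessel function is `ψ` on `U_n` and zero elsewhere. Hence it is a reproducing kernel, and
`J(g g') = |U_n|⁻¹ ∑_{p ∈ P} J(p g') J(g p⁻¹)` (`bessel_mul`); moreover `J(g⁻¹) = conj J(g)`.

Let `κ_r` be the rotation by `r`, and let `D = J₁ - J₂`. The gamma factor of `σ × τ`, with `τ` a
cuspidal representation of `GL_r(F)`, is the pairing of `h ↦ J(κ_r · diag(h, 1))` with the
Whittaker functions of `τ` (`gammaFactor_eq`). So equality of gamma factors says that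
`h ↦ D(κ_r · diag(h, 1))` is orthogonal to all cuspidal Whittaker functions. This function
vanishes if it is itself cuspidal (`eq_zero_of_cuspidal_of_orthogonal`), and then `D` vanishes at
all `g` whose row `n - 1 - r` is the last unit vector (`VanishesOnRow.of_diagEmbed`). Cuspidality
along the radical of type `(c, d)`, with `c + d = r`, follows from the convolution formula for
`J₁` and `J₂` and from the vanishing of `D` on the rows that belong to `c` and to `d`
(`sum_radical_bessel_sub`). By induction, `D` vanishes on the rows that belong to all `r ≤ n / 2`
(`vanishesOnRow_of_gammaFactor_eq`).

Finally, if row `i` of `g` is the unit vector `e_j`, where `i` and `j` both lie in the range just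
treated, then the convolution formula expresses `J₁(g)` and `J₂(g)` through values on which they
agree (`bessel_eq_of_row`). By the Bruhat decomposition it is enough to treat monomial matrices.
As the range contains more than half of the indices, a monomial matrix has a nonzero entry with
both indices in it, and the common central character allows that entry to be `1` (`bessel_eq`).
-/

namespace FiniteGL

/-! ### Transvections, permutation matrices and the unipotent subgroup -/

section MatrixBasics

variable {F : Type*} [Field F] {n : ℕ}

theorem glMul_row (g h : GL (Fin n) F) (i : Fin n) :
    (g * h) i = Matrix.vecMul (g i) (h : Matrix (Fin n) (Fin n) F) := by
  rw [Matrix.GeneralLinearGroup.coe_mul, Matrix.mul_apply_eq_vecMul]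

theorem single_vecMul (i : Fin n) (h : GL (Fin n) F) :
    Matrix.vecMul (Pi.single i 1) (h : Matrix (Fin n) (Fin n) F) = h i := by
  rw [Matrix.single_one_vecMul]; rfl

theorem glMul_row_of_single {g : GL (Fin n) F} {i j : Fin n} (hg : g i = Pi.single j 1)
    (h : GL (Fin n) F) : (g * h) i = h j := by
  rw [glMul_row, hg, single_vecMul]

theorem glOne_row (i : Fin n) : (1 : GL (Fin n) F) i = Pi.single i 1 := by
  rw [← single_vecMul]; simp

theorem glInv_row_of_single {g : GL (Fin n) F} {i j : Fin n} (hg : g i = Pi.single j 1) :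
    (g⁻¹ : GL (Fin n) F) j = Pi.single i 1 := by
  rw [← glMul_row_of_single hg, mul_inv_cancel, glOne_row]

theorem vecMul_glInv {g : GL (Fin n) F} {a b : Fin n → F}
    (h : Matrix.vecMul a (g : Matrix (Fin n) (Fin n) F) = b) :
    Matrix.vecMul b ((g⁻¹ : GL (Fin n) F) : Matrix (Fin n) (Fin n) F) = a := by
  rw [← h, Matrix.vecMul_vecMul, ← Matrix.GeneralLinearGroup.coe_mul]; simp

theorem glInv_mulVec {g : GL (Fin n) F} {a b : Fin n → F}
    (h : Matrix.mulVec (g : Matrix (Fin n) (Fin n) F) a = b) :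
    Matrix.mulVec ((g⁻¹ : GL (Fin n) F) : Matrix (Fin n) (Fin n) F) b = a := by
  rw [← h, Matrix.mulVec_mulVec, ← Matrix.GeneralLinearGroup.coe_mul]; simp

/-- The transvection-like matrix `1 + a ⊗ b` attached to a column `a` and a row `b` with
`b a = 0`. -/
def transv (a b : Fin n → F) (h : b ⬝ᵥ a = 0) : GL (Fin n) F where
  val := 1 + Matrix.vecMulVec a b
  inv := 1 - Matrix.vecMulVec a b
  val_inv := by
    rw [add_mul, mul_sub, mul_sub, Matrix.vecMulVec_mul_vecMulVec, h]; simp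
  inv_val := by
    rw [sub_mul, mul_add, mul_add, Matrix.vecMulVec_mul_vecMulVec, h]; simp

theorem coe_transv (a b : Fin n → F) (h : b ⬝ᵥ a = 0) :
    (transv a b h : Matrix (Fin n) (Fin n) F) = 1 + Matrix.vecMulVec a b := rfl

theorem transv_apply (a b : Fin n → F) (h : b ⬝ᵥ a = 0) (i j : Fin n) :
    transv a b h i j = (if i = j then 1 else 0) + a i * b j := by
  rw [coe_transv, Matrix.add_apply, Matrix.one_apply, Matrix.vecMulVec_apply]

theorem transv_mul_row (a b : Fin n → F) (h : b ⬝ᵥ a = 0) (g : GL (Fin n) F) (i : Fin n) :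
    (transv a b h * g) i = g i + a i • Matrix.vecMul b (g : Matrix (Fin n) (Fin n) F) := by
  ext j
  rw [Matrix.GeneralLinearGroup.coe_mul, coe_transv, add_mul, one_mul, Matrix.vecMulVec_mul]
  simp [Matrix.vecMulVec_apply]

theorem mul_transv_apply (a b : Fin n → F) (h : b ⬝ᵥ a = 0) (g : GL (Fin n) F) (i j : Fin n) :
    (g * transv a b h) i j =
      g i j + Matrix.mulVec (g : Matrix (Fin n) (Fin n) F) a i * b j := by
  rw [Matrix.GeneralLinearGroup.coe_mul, coe_transv, mul_add, mul_one, Matrix.mul_vecMulVec]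
  simp [Matrix.vecMulVec_apply]

theorem mul_transv_aux {a b a' b' : Fin n → F} (h : b ⬝ᵥ a = 0) {g : GL (Fin n) F}
    (ha : Matrix.mulVec (g : Matrix (Fin n) (Fin n) F) a = a')
    (hb : Matrix.vecMul b' (g : Matrix (Fin n) (Fin n) F) = b) : b' ⬝ᵥ a' = 0 := by
  rw [← ha, Matrix.dotProduct_mulVec, hb, h]

/-- Conjugation of `1 + a ⊗ b` by `g` is `1 + g a ⊗ b g⁻¹`. -/
theorem mul_transv {a b a' b' : Fin n → F} (h : b ⬝ᵥ a = 0) {g : GL (Fin n) F}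
    (ha : Matrix.mulVec (g : Matrix (Fin n) (Fin n) F) a = a')
    (hb : Matrix.vecMul b' (g : Matrix (Fin n) (Fin n) F) = b) :
    g * transv a b h = transv a' b' (mul_transv_aux h ha hb) * g := by
  ext i j
  rw [mul_transv_apply, ha, transv_mul_row, hb]; simp

theorem transv_mul_transv_left {a a' b : Fin n → F} (h : b ⬝ᵥ a = 0) (h' : b ⬝ᵥ a' = 0) :
    transv a b h * transv a' b h' = transv (a + a') b (by rw [dotProduct_add, h, h', add_zero]) :=
        by
  refine Units.ext ?_
  rw [Units.val_mul, coe_transv, coe_transv, coe_transv, add_mul, mul_add, mul_add,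
    Matrix.vecMulVec_mul_vecMulVec, h', Matrix.add_vecMulVec]
  simp [add_assoc, add_comm (Matrix.vecMulVec a b)]

theorem transv_mul_transv_right {a b b' : Fin n → F} (h : b ⬝ᵥ a = 0) (h' : b' ⬝ᵥ a = 0) :
    transv a b h * transv a b' h' = transv a (b + b') (by rw [add_dotProduct, h, h', add_zero]) :=
        by
  refine Units.ext ?_
  rw [Units.val_mul, coe_transv, coe_transv, coe_transv, add_mul, mul_add, mul_add,
    Matrix.vecMulVec_mul_vecMulVec, h, Matrix.vecMulVec_add]
  simp [add_assoc, add_comm (Matrix.vecMulVec a b)]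

theorem transv_neg_mul (a b : Fin n → F) (h : b ⬝ᵥ a = 0) :
    transv (-a) b (by rw [dotProduct_neg, h, neg_zero]) * transv a b h = 1 := by
  rw [transv_mul_transv_left]
  ext i j; simp [transv_apply, Matrix.one_apply]

/-- The matrix of the permutation `π`, whose row `i` is the basis vector `π i`. -/
def permGL (π : Equiv.Perm (Fin n)) : GL (Fin n) F where
  val := Matrix.of fun i => Pi.single (π i) 1
  inv := Matrix.of fun i => Pi.single (π.symm i) 1
  val_inv := by
    ext i j
    rw [Matrix.mul_apply, Finset.sum_eq_single (π i)]
    · simp [Pi.single_apply, Matrix.one_apply, eq_comm]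
    · intro k _ hk
      simp [hk]
    · simp
  inv_val := by
    ext i j
    rw [Matrix.mul_apply, Finset.sum_eq_single (π.symm i)]
    · simp [Pi.single_apply, Matrix.one_apply, eq_comm]
    · intro k _ hk
      simp [hk]
    · simp

theorem permGL_row (π : Equiv.Perm (Fin n)) (i : Fin n) :
    (permGL π : GL (Fin n) F) i = Pi.single (π i) 1 := rfl

theorem permGL_mul_row (π : Equiv.Perm (Fin n)) (g : GL (Fin n) F) (i : Fin n) :
    (permGL π * g : GL (Fin n) F) i = g (π i) := glMul_row_of_single (permGL_row π i) g

theorem permGL_mul (π ρ : Equiv.Perm (Fin n)) :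
    (permGL π * permGL ρ : GL (Fin n) F) = permGL (ρ * π) := by
  ext i j
  rw [permGL_mul_row]; rfl

theorem permGL_mulVec (π : Equiv.Perm (Fin n)) (a : Fin n → F) :
    Matrix.mulVec ((permGL π : GL (Fin n) F) : Matrix (Fin n) (Fin n) F) a = fun i => a (π i) := by
  ext i
  rw [Matrix.mulVec, permGL_row, single_one_dotProduct]

theorem vecMul_permGL (π : Equiv.Perm (Fin n)) (b : Fin n → F) :
    Matrix.vecMul (fun j => b (π j)) ((permGL π : GL (Fin n) F) : Matrix (Fin n) (Fin n) F) = b :=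
        by
  ext j
  rw [Matrix.vecMul, dotProduct, Finset.sum_eq_single (π.symm j)]
  · rw [permGL_row]; simp
  · intro i _ hi
    rw [permGL_row, Pi.single_apply, if_neg, mul_zero]
    rintro rfl; simp at hi
  · simp

/-- `π(1 + a ⊗ b) = (1 + a' ⊗ b')π` with the coordinates of `a` and `b` permuted. -/
theorem permGL_mul_transv (π : Equiv.Perm (Fin n)) (a b : Fin n → F) (h : b ⬝ᵥ a = 0) :
    permGL π * transv a b h =
      transv (fun i => a (π i)) (fun i => b (π i))
        (mul_transv_aux h (permGL_mulVec π a) (vecMul_permGL π b)) * permGL π :=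
  mul_transv h (permGL_mulVec π a) (vecMul_permGL π b)

/-- The group of matrices that differ from the identity only in entries `(i, j)` with `R i j`, for a
transitive irreflexive relation `R`. -/
def patternGroup (R : Fin n → Fin n → Prop) (ht : ∀ i j k, R i j → R j k → R i k)
    (hi : ∀ i, ¬ R i i) : Subgroup (GL (Fin n) F) where
  carrier := {g | ∀ i j, ¬ R i j → g i j = if i = j then 1 else 0}
  one_mem' := by
    intro i j _
    simp [Matrix.one_apply]
  mul_mem' := by
    intro g h hg hh i j hij
    rw [Matrix.GeneralLinearGroup.coe_mul, Matrix.mul_apply, Finset.sum_eq_single i]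
    · rw [hg i i (hi i), hh i j hij]
      simp
    · intro k _ hki
      by_cases hik : R i k
      · have hkj : ¬ R k j := fun h' => hij (ht _ _ _ hik h')
        have hne : k ≠ j := by
          rintro rfl
          exact hij hik
        rw [hh k j hkj, if_neg hne, mul_zero]
      · rw [hg i k hik, if_neg (Ne.symm hki), zero_mul]
    · simp
  inv_mem' := by
    intro g hg
    have wf : WellFounded (fun k i : Fin n => R i k) := by
      have : IsTrans (Fin n) (fun k i : Fin n => R i k) := ⟨fun _ _ _ h₁ h₂ => ht _ _ _ h₂ h₁⟩
      have : Std.Irrefl (fun k i : Fin n => R i k) := ⟨fun i => hi i⟩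
      exact Finite.wellFounded_of_trans_of_irrefl _
    intro i
    induction i using wf.induction with
    | _ i ih =>
      intro j hij
      have key : (g * g⁻¹ : GL (Fin n) F) i j = if i = j then 1 else 0 := by
        simp [Matrix.one_apply]
      rw [Matrix.GeneralLinearGroup.coe_mul, Matrix.mul_apply, Finset.sum_eq_single i] at key
      · rwa [hg i i (hi i), if_pos rfl, one_mul] at key
      · intro k _ hki
        by_cases hik : R i k
        · have hkj : ¬ R k j := fun h' => hij (ht _ _ _ hik h')
          have hne : k ≠ j := by
            rintro rfl
            exact hij hik
          rw [ih k hik j hkj, if_neg hne, mul_zero]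
        · rw [hg i k hik, if_neg (Ne.symm hki), zero_mul]
      · simp

theorem transv_mem_patternGroup {R : Fin n → Fin n → Prop} {ht : ∀ i j k, R i j → R j k → R i k}
    {hi : ∀ i, ¬ R i i} {a b : Fin n → F} {h : b ⬝ᵥ a = 0}
    (hab : ∀ i j, ¬ R i j → a i = 0 ∨ b j = 0) : transv a b h ∈ patternGroup R ht hi := by
  intro i j hij
  rw [transv_apply]
  rcases hab i j hij with h | h <;> simp [h]

theorem transv_mem_upperUnipotent {a b : Fin n → F} {h : b ⬝ᵥ a = 0}
    (hab : ∀ i j : Fin n, ¬ (i : ℕ) < j → a i = 0 ∨ b j = 0) :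
    transv a b h ∈ upperUnipotent F n := by
  intro i j hij
  rw [transv_apply]
  rcases hab i j hij with h | h <;> simp [h]

/-- The subgroup of matrices `diag(g, 1)` with `g` of size `k`. -/
def blockGroup (k : ℕ) : Subgroup (GL (Fin n) F) where
  carrier := {g | (∀ i : Fin n, k ≤ (i : ℕ) → g i = Pi.single i 1) ∧
    ∀ j : Fin n, k ≤ (j : ℕ) → Matrix.mulVec (g : Matrix (Fin n) (Fin n) F) (Pi.single j 1) =
      Pi.single j 1}
  one_mem' := ⟨fun i _ => glOne_row i, fun j _ => by rw [Units.val_one, Matrix.one_mulVec]⟩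
  mul_mem' := by
    rintro g h ⟨hg, hg'⟩ ⟨hh, hh'⟩
    refine ⟨fun i hi => ?_, fun j hj => ?_⟩
    · rw [glMul_row_of_single (hg i hi), hh i hi]
    · rw [Matrix.GeneralLinearGroup.coe_mul, ← Matrix.mulVec_mulVec, hh' j hj, hg' j hj]
  inv_mem' := by
    rintro g ⟨hg, hg'⟩
    exact ⟨fun i hi => glInv_row_of_single (hg i hi), fun j hj => glInv_mulVec (hg' j hj)⟩

/-- The mirabolic subgroup: matrices whose last row is `(0, …, 0, 1)`. -/
def mirabolic (F : Type*) [Field F] (n : ℕ) : Subgroup (GL (Fin n) F) where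
  carrier := {g | ∀ i : Fin n, (i : ℕ) + 1 = n → g i = Pi.single i 1}
  one_mem' := fun i _ => glOne_row i
  mul_mem' := by
    intro g h hg hh i hi
    rw [glMul_row_of_single (hg i hi), hh i hi]
  inv_mem' := fun hg i hi => glInv_row_of_single (hg i hi)

theorem row_eq_single_of {g : GL (Fin n) F} {i : Fin n}
    (h : ∀ j, g i j = if i = j then 1 else 0) : g i = Pi.single i 1 := by
  ext j; rw [h j, Pi.single_apply]; simp [eq_comm]

theorem upperUnipotent_le_mirabolic : upperUnipotent F n ≤ mirabolic F n := by
  intro u hu i hi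
  exact row_eq_single_of fun j => hu i j (by have := j.2; simp only; omega)

theorem blockGroup_le_mirabolic {k : ℕ} (hk : k < n) : blockGroup k ≤ mirabolic F n :=
  fun _ hg i hi => hg.1 i (by omega)

theorem blockGroup_apply {k : ℕ} {g : GL (Fin n) F} (hg : g ∈ blockGroup k) {i j : Fin n}
    (h : k ≤ (i : ℕ) ∨ k ≤ (j : ℕ)) : g i j = if i = j then 1 else 0 := by
  rcases h with h | h
  · rw [hg.1 i h, Pi.single_apply]; simp [eq_comm]
  · have := congrFun (hg.2 j h) i
    rw [Matrix.mulVec_single_one] at this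
    rw [show g i j = Matrix.col (g : Matrix (Fin n) (Fin n) F) j i from rfl, this, Pi.single_apply]

theorem mem_blockGroup {k : ℕ} {g : GL (Fin n) F} :
    g ∈ blockGroup k ↔ ∀ i j : Fin n, (k ≤ (i : ℕ) ∨ k ≤ (j : ℕ)) → g i j = if i =
        j then 1 else 0 := by
  refine ⟨fun hg i j h => blockGroup_apply hg h, fun h => ⟨fun i hi => ?_, fun j hj => ?_⟩⟩
  · exact row_eq_single_of fun j => h i j (Or.inl hi)
  · rw [Matrix.mulVec_single_one]
    ext i
    rw [Matrix.col, Matrix.transpose_apply, h i j (Or.inr hj), Pi.single_apply]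

/-- A column supported in the first `k` coordinates stays so under `diag(g, 1)`. -/
theorem blockGroup_mulVec {k : ℕ} {g : GL (Fin n) F} (hg : g ∈ blockGroup k) (a : Fin n → F)
    {i : Fin n} (hi : k ≤ (i : ℕ)) : Matrix.mulVec (g : Matrix (Fin n) (Fin n) F) a i = a i := by
  rw [Matrix.mulVec, show (g : Matrix (Fin n) (Fin n) F) i = Pi.single i 1 from hg.1 i hi,
    single_one_dotProduct]

/-- Rows supported beyond the first `k` coordinates are fixed by `diag(g, 1)`. -/
theorem vecMul_blockGroup {k : ℕ} {g : GL (Fin n) F} (hg : g ∈ blockGroup k) {b : Fin n → F}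
    (hb : ∀ i : Fin n, (i : ℕ) < k → b i = 0) :
    Matrix.vecMul b (g : Matrix (Fin n) (Fin n) F) = b := by
  ext j
  rw [Matrix.vecMul, dotProduct, Finset.sum_eq_single j]
  · by_cases hj : k ≤ (j : ℕ)
    · rw [blockGroup_apply hg (Or.inl hj), if_pos rfl, mul_one]
    · rw [hb j (by omega), zero_mul]
  · intro i _ hij
    by_cases hi : k ≤ (i : ℕ)
    · rw [blockGroup_apply hg (Or.inl hi), if_neg hij, mul_zero]
    · rw [hb i (by omega), zero_mul]
  · simp

end MatrixBasics

section Character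

variable {F : Type*} [Field F] {n : ℕ} {ψ : AddChar F ℂ}

/-- The sum of the entries just above the diagonal. -/
def superdiagSum (u : GL (Fin n) F) : F :=
  ∑ i : Fin n, if h : (i : ℕ) + 1 < n then u i ⟨(i : ℕ) + 1, h⟩ else 0

theorem unipotentChar_eq (u : GL (Fin n) F) : unipotentChar ψ u = ψ (superdiagSum u) := rfl

theorem superdiagSum_mul {u v : GL (Fin n) F} (hu : u ∈ upperUnipotent F n)
    (hv : v ∈ upperUnipotent F n) : superdiagSum (u * v) = superdiagSum u + superdiagSum v := by
  rw [superdiagSum, superdiagSum, superdiagSum, ← Finset.sum_add_distrib]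
  refine Finset.sum_congr rfl fun i _ => ?_
  split_ifs with h
  · have hne : i ≠ ⟨(i : ℕ) + 1, h⟩ := fun h' => by have := congrArg Fin.val h'; simp at this
    rw [Matrix.GeneralLinearGroup.coe_mul, Matrix.mul_apply, ← Finset.sum_subset
      (Finset.subset_univ {i, ⟨(i : ℕ) + 1, h⟩}), Finset.sum_pair hne, hu i i (lt_irrefl _),
      hv _ _ (lt_irrefl _), if_pos rfl, if_pos rfl]
    · ring
    · intro k _ hk
      simp only [Finset.mem_insert, Finset.mem_singleton, not_or] at hk
      by_cases hik : (i : ℕ) < k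
      · rw [hv k ⟨(i : ℕ) + 1, h⟩ (by simp only; omega), if_neg hk.2, mul_zero]
      · rw [hu i k hik, if_neg (Ne.symm hk.1), zero_mul]
  · simp

theorem unipotentChar_mul {u v : GL (Fin n) F} (hu : u ∈ upperUnipotent F n)
    (hv : v ∈ upperUnipotent F n) :
    unipotentChar ψ (u * v) = unipotentChar ψ u * unipotentChar ψ v := by
  rw [unipotentChar_eq, superdiagSum_mul hu hv, AddChar.map_add_eq_mul]; rfl

theorem unipotentChar_one : unipotentChar ψ (1 : GL (Fin n) F) = 1 := by
  rw [unipotentChar_eq, superdiagSum, Finset.sum_eq_zero, AddChar.map_zero_eq_one]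
  intro i _
  split_ifs with h
  · have hne : i ≠ ⟨(i : ℕ) + 1, h⟩ := fun h' => by have := congrArg Fin.val h'; simp at this
    simp [hne]
  · rfl

theorem unipotentChar_inv_mul {u : GL (Fin n) F} (hu : u ∈ upperUnipotent F n) :
    unipotentChar ψ u⁻¹ * unipotentChar ψ u = 1 := by
  rw [← unipotentChar_mul (inv_mem hu) hu, inv_mul_cancel, unipotentChar_one]

theorem unipotentChar_ne_zero {u : GL (Fin n) F} (hu : u ∈ upperUnipotent F n) :
    unipotentChar ψ u ≠ 0 := right_ne_zero_of_mul_eq_one (unipotentChar_inv_mul hu)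

theorem unipotentChar_inv {u : GL (Fin n) F} (hu : u ∈ upperUnipotent F n) :
    unipotentChar ψ u⁻¹ = (unipotentChar ψ u)⁻¹ :=
  eq_inv_of_mul_eq_one_left (unipotentChar_inv_mul hu)

theorem unipotentChar_inv_char (u : GL (Fin n) F) :
    unipotentChar ψ⁻¹ u = (unipotentChar ψ u)⁻¹ := by
  rw [unipotentChar_eq, AddChar.inv_apply', unipotentChar_eq]

/-- Complex conjugation inverts `ψ`, whose values are roots of unity. -/
theorem unipotentChar_inv_conj [Finite F] (u : GL (Fin n) F) :
    (starRingEnd ℂ) (unipotentChar ψ u) = (unipotentChar ψ u)⁻¹ := by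
  rw [unipotentChar_eq, ← AddChar.map_neg_eq_conj, AddChar.map_neg_eq_inv]

/-- Sum of the entries of `1 + a ⊗ b` just above the diagonal. -/
theorem superdiagSum_transv (a b : Fin n → F) (h : b ⬝ᵥ a = 0) :
    superdiagSum (transv a b h) =
      ∑ i : Fin n, if h : (i : ℕ) + 1 < n then a i * b ⟨(i : ℕ) + 1, h⟩ else 0 := by
  refine Finset.sum_congr rfl fun i _ => ?_
  split_ifs with h
  · have hne : i ≠ ⟨(i : ℕ) + 1, h⟩ := fun h' => by have := congrArg Fin.val h'; simp at this
    rw [transv_apply, if_neg hne, zero_add]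
  · rfl

theorem unipotentChar_transv_eq_one {a b : Fin n → F} {h : b ⬝ᵥ a = 0}
    (hab : ∀ i j : Fin n, (i : ℕ) + 1 = j → a i = 0 ∨ b j = 0) :
    unipotentChar ψ (transv a b h) = 1 := by
  rw [unipotentChar_eq, superdiagSum_transv, Finset.sum_eq_zero, AddChar.map_zero_eq_one]
  intro i _
  split_ifs with hi
  · rcases hab i ⟨i + 1, hi⟩ rfl with h | h <;> simp [h]
  · rfl

theorem unipotentChar_transv {a b : Fin n → F} {h : b ⬝ᵥ a = 0} (k l : Fin n)
    (hkl : (k : ℕ) + 1 = l)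
    (hab : ∀ i j : Fin n, (i : ℕ) + 1 = j → i ≠ k → a i = 0 ∨ b j = 0) :
    unipotentChar ψ (transv a b h) = ψ (a k * b l) := by
  rw [unipotentChar_eq, superdiagSum_transv, Finset.sum_eq_single k]
  · have hk : (k : ℕ) + 1 < n := hkl ▸ l.2
    have hl : (⟨(k : ℕ) + 1, hk⟩ : Fin n) = l := Fin.ext hkl
    rw [dif_pos hk, hl]
  · intro i _ hik
    split_ifs with hi
    · rcases hab i ⟨i + 1, hi⟩ rfl hik with h | h <;> simp [h]
    · rfl
  · simp

theorem unipotentChar_eq_one_of {u : GL (Fin n) F}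
    (h : ∀ i j : Fin n, (i : ℕ) + 1 = j → u i j = 0) : unipotentChar ψ u = 1 := by
  rw [unipotentChar_eq, superdiagSum, Finset.sum_eq_zero, AddChar.map_zero_eq_one]
  intro i _
  split_ifs with hi
  · exact h i _ rfl
  · rfl

theorem eq_of_addChar_mul_eq (hψ : ψ ≠ 1) {a b : F} (h : ∀ t, ψ (t * a) = ψ (t * b)) : a = b := by
  by_contra hab
  apply hψ
  ext t
  have := h (t / (a - b))
  have hsub : a - b ≠ 0 := sub_ne_zero.2 hab
  have h2 : t = t / (a - b) * a - t / (a - b) * b := by field_simp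
  rw [AddChar.one_apply, h2, AddChar.map_sub_eq_div, this, div_self]
  exact fun h0 => by simpa [h0] using (AddChar.map_add_eq_mul ψ (t / (a - b) * b)
      (-(t / (a - b) * b))).symm

theorem eq_zero_of_addChar_mul_eq (hψ : ψ ≠ 1) {a : F} (h : ∀ t, ψ (t * a) = 1) : a = 0 :=
  eq_of_addChar_mul_eq hψ fun t => by rw [h, mul_zero, AddChar.map_zero_eq_one]

end Character

/-! ### Bruhat decomposition and the anti-automorphism of the Hecke algebra -/

section Bruhat

variable {F : Type*} [Field F] {n : ℕ}

theorem gl_row_ne_zero (g : GL (Fin n) F) (i : Fin n) : g i ≠ 0 := by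
  intro h
  have h1 : (g * g⁻¹ : GL (Fin n) F) i = 0 := by rw [glMul_row, h, Matrix.zero_vecMul]
  rw [mul_inv_cancel, glOne_row] at h1
  simpa using congrFun h1 i

/-- Gaussian elimination from the bottom row upwards, using row and column operations from the upper
triangular unipotent group only. -/
theorem bruhat_partial (g : GL (Fin n) F) (k : ℕ) (hk : k ≤ n) :
    ∃ u ∈ upperUnipotent F n, ∃ v ∈ upperUnipotent F n, ∃ c : Fin n → Fin n,
      ∀ i : Fin n, n - k ≤ (i : ℕ) → (∀ l, l ≠ c i → (u * g * v) i l = 0) ∧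
        ∀ i', i' ≠ i → (u * g * v) i' (c i) = 0 := by
  induction k with
  | zero =>
    exact ⟨1, one_mem _, 1, one_mem _, id, fun i hi => absurd i.2 (by omega)⟩
  | succ k ih =>
    obtain ⟨u, hu, v, hv, c, hc⟩ := ih (by omega)
    set g' := u * g * v with hg'
    let i₀ : Fin n := ⟨n - (k + 1), by omega⟩
    obtain ⟨j, hj, hmin⟩ : ∃ j, g' i₀ j ≠ 0 ∧ ∀ l, l < j → g' i₀ l = 0 := by
      classical
      have hne : (Finset.univ.filter fun j => g' i₀ j ≠ 0).Nonempty := by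
        obtain ⟨j, hj⟩ := Function.ne_iff.1 (gl_row_ne_zero g' i₀)
        exact ⟨j, by simpa using hj⟩
      obtain ⟨j, hj, hmin⟩ := Finset.exists_min_image _ id hne
      refine ⟨j, by simpa using hj, fun l hl => ?_⟩
      by_contra h
      exact absurd (hmin l (by simpa using h)) (not_le.2 hl)
    have hjc : ∀ i : Fin n, n - k ≤ (i : ℕ) → c i ≠ j := by
      rintro i hi rfl
      exact hj ((hc i hi).2 i₀ (fun h => by have := congrArg Fin.val h; simp only [i₀] at this; omega))
    -- column operations that clear row `i₀` to the right of the pivot `(i₀, j)`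
    let β : Fin n → F := fun l => if j < l then -(g' i₀ l) / g' i₀ j else 0
    have hβ : β ⬝ᵥ Pi.single j 1 = 0 := by rw [dotProduct_single_one]; simp [β]
    set g₁ := g' * transv (Pi.single j 1) β hβ with hg₁
    have hg₁_apply : ∀ i l, g₁ i l = g' i l + g' i j * β l := by
      intro i l
      rw [hg₁, mul_transv_apply, Matrix.mulVec_single_one]; rfl
    have hcol : ∀ i, g₁ i j = g' i j := fun i => by rw [hg₁_apply]; simp [β]
    have hrow : ∀ l, l ≠ j → g₁ i₀ l = 0 := by
      intro l hl
      rw [hg₁_apply]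
      rcases lt_or_gt_of_ne hl with h | h
      · simp [β, hmin l h, not_lt.2 h.le]
      · simp only [β, if_pos h]; field_simp; ring
    -- row operations that clear column `j` above the pivot
    let α : Fin n → F := fun i => if i < i₀ then -(g' i j) / g' i₀ j else 0
    have hα : Pi.single i₀ 1 ⬝ᵥ α = 0 := by rw [single_one_dotProduct]; simp [α]
    set g₂ := transv α (Pi.single i₀ 1) hα * g₁ with hg₂
    have hg₂_apply : ∀ i l, g₂ i l = g₁ i l + α i * g₁ i₀ l := by
      intro i l
      rw [hg₂, transv_mul_row, single_vecMul]; rfl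
    refine ⟨transv α (Pi.single i₀ 1) hα * u, mul_mem (transv_mem_upperUnipotent ?_) hu,
      v * transv (Pi.single j 1) β hβ, mul_mem hv (transv_mem_upperUnipotent ?_),
      Function.update c i₀ j, ?_⟩
    · intro i l hil
      rcases eq_or_ne l i₀ with rfl | hl
      · left; simp only [α]; rw [if_neg]; rwa [Fin.lt_def]
      · right; simp [hl]
    · intro i l hil
      rcases eq_or_ne i j with rfl | hl
      · right; simp only [β]; rw [if_neg]; rwa [Fin.lt_def]
      · left; simp [hl]
    have he : transv α (Pi.single i₀ 1) hα * u * g * (v * transv (Pi.single j 1) β hβ) = g₂ := by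
      rw [hg₂, hg₁, hg']; simp only [mul_assoc]
    rw [he]
    intro i hi
    rcases eq_or_ne i i₀ with rfl | hii
    · rw [Function.update_self]
      refine ⟨fun l hl => by rw [hg₂_apply, hrow l hl]; simp, fun i' hi' => ?_⟩
      rw [hg₂_apply, hcol, hcol]
      simp only [α]
      split_ifs with h
      · field_simp; ring
      · have hi2 : n - k ≤ (i' : ℕ) := by
          have : (i' : ℕ) ≠ i₀ := fun h => hi' (Fin.ext h)
          rw [Fin.lt_def] at h
          simp only [i₀] at h this
          omega
        rw [(hc i' hi2).1 j (hjc i' hi2).symm]; simp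
    · have hi2 : n - k ≤ (i : ℕ) := by
        have : (i : ℕ) ≠ i₀ := fun h => hii (Fin.ext h)
        simp only [i₀] at this
        omega
      have hαi : α i = 0 := by
        simp only [α]; rw [if_neg]; rw [Fin.lt_def]; simp only [i₀]; omega
      rw [Function.update_of_ne hii]
      have hz : g' i j = 0 := (hc i hi2).1 j (hjc i hi2).symm
      refine ⟨fun l hl => by rw [hg₂_apply, hg₁_apply, hz, hαi, (hc i hi2).1 l hl]; simp,
        fun i' hi' => ?_⟩
      have h1 : ∀ i', i' ≠ i → g₁ i' (c i) = g' i' j * β (c i) := by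
        intro i' h; rw [hg₁_apply, (hc i hi2).2 i' h, zero_add]
      have h2 : g₁ i₀ (c i) = 0 := hrow _ (hjc i hi2)
      have hβ0 : β (c i) = 0 := by
        have := h1 i₀ (Ne.symm hii)
        rw [h2] at this
        exact (mul_eq_zero.1 this.symm).resolve_left hj
      rw [hg₂_apply, h1 i' hi', h2, hβ0]; simp

/-- The monomial matrix condition: row `i` has the single nonzero entry `a i`, in column `π i`. -/
def IsMonomial (m : GL (Fin n) F) (π : Equiv.Perm (Fin n)) (a : Fin n → F) : Prop :=
  ∀ i, m i = Pi.single (π i) (a i)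

theorem IsMonomial.ne_zero {m : GL (Fin n) F} {π : Equiv.Perm (Fin n)} {a : Fin n → F}
    (hm : IsMonomial m π a) (i : Fin n) : a i ≠ 0 := by
  intro h
  apply gl_row_ne_zero m i
  rw [hm i, h, Pi.single_zero]

/-- Bruhat decomposition of `GL_n(F)`, in the form `G = U (monomial matrices) U`. -/
theorem bruhat (g : GL (Fin n) F) :
    ∃ u ∈ upperUnipotent F n, ∃ v ∈ upperUnipotent F n, ∃ m π a, IsMonomial m π a ∧
      g = u * m * v := by
  obtain ⟨u, hu, v, hv, c, hc⟩ := bruhat_partial g n le_rfl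
  simp only [Nat.sub_self, Nat.zero_le, forall_true_left] at hc
  set m := u * g * v with hm
  have hinj : Function.Injective c := by
    intro i i' hii
    by_contra hne
    apply gl_row_ne_zero m i'
    ext l
    by_cases hl : l = c i'
    · rw [hl, ← hii]; exact (hc i).2 i' (Ne.symm hne)
    · exact (hc i').1 l hl
  refine ⟨u⁻¹, inv_mem hu, v⁻¹, inv_mem hv, m,
      Equiv.ofBijective c (Finite.injective_iff_bijective.1 hinj),
    fun i => m i (c i), fun i => ?_, by rw [hm]; group⟩
  ext l
  by_cases hl : l = c i
  · subst hl; simp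
  · rw [(hc i).1 l hl]; simp [hl]

theorem IsMonomial.mulVec {m : GL (Fin n) F} {π : Equiv.Perm (Fin n)} {a : Fin n → F}
    (hm : IsMonomial m π a) (x : Fin n → F) :
    Matrix.mulVec (m : Matrix (Fin n) (Fin n) F) x = fun i => a i * x (π i) := by
  ext i
  rw [Matrix.mulVec, hm i, single_dotProduct]

theorem IsMonomial.vecMul {m : GL (Fin n) F} {π : Equiv.Perm (Fin n)} {a : Fin n → F}
    (hm : IsMonomial m π a) (i : Fin n) (t : F) :
    Matrix.vecMul (Pi.single i t) (m : Matrix (Fin n) (Fin n) F) = Pi.single (π i) (t * a i) := by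
  rw [show (Pi.single i t : Fin n → F) = t • Pi.single i 1 by rw [← Pi.single_smul]; simp,
    Matrix.smul_vecMul, single_vecMul, hm i, ← Pi.single_smul, smul_eq_mul]

end Bruhat

section AntiInvolution

variable {F : Type*} [Field F] {n : ℕ}

/-- The anti-automorphism `g ↦ w gᵗ w` of `GL_n(F)`, with `w` the antidiagonal permutation
matrix. -/
def antiTranspose (g : GL (Fin n) F) : GL (Fin n) F where
  val := Matrix.of fun i j => g j.rev i.rev
  inv := Matrix.of fun i j => (g⁻¹ : GL (Fin n) F) j.rev i.rev
  val_inv := by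
    ext i j
    rw [Matrix.mul_apply, ← Equiv.sum_comp Fin.revPerm]
    have h : (g⁻¹ * g : GL (Fin n) F) j.rev i.rev = (1 : GL (Fin n) F) j.rev i.rev := by
      rw [inv_mul_cancel]
    rw [Matrix.GeneralLinearGroup.coe_mul, Matrix.mul_apply, Units.val_one, Matrix.one_apply] at h
    rw [Matrix.one_apply]
    simp only [Fin.rev_inj, eq_comm (a := j)] at h
    rw [← h]
    exact Finset.sum_congr rfl fun k _ => by simp [mul_comm]
  inv_val := by
    ext i j
    rw [Matrix.mul_apply, ← Equiv.sum_comp Fin.revPerm]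
    have h : (g * g⁻¹ : GL (Fin n) F) j.rev i.rev = (1 : GL (Fin n) F) j.rev i.rev := by
      rw [mul_inv_cancel]
    rw [Matrix.GeneralLinearGroup.coe_mul, Matrix.mul_apply, Units.val_one, Matrix.one_apply] at h
    rw [Matrix.one_apply]
    simp only [Fin.rev_inj, eq_comm (a := j)] at h
    rw [← h]
    exact Finset.sum_congr rfl fun k _ => by simp [mul_comm]

theorem antiTranspose_apply (g : GL (Fin n) F) (i j : Fin n) :
    antiTranspose g i j = g j.rev i.rev := rfl

theorem antiTranspose_mul (g h : GL (Fin n) F) :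
    antiTranspose (g * h) = antiTranspose h * antiTranspose g := by
  ext i j
  rw [antiTranspose_apply, Matrix.GeneralLinearGroup.coe_mul, Matrix.GeneralLinearGroup.coe_mul,
    Matrix.mul_apply, Matrix.mul_apply, ← Equiv.sum_comp Fin.revPerm]
  exact Finset.sum_congr rfl fun k _ => by simp [antiTranspose_apply, mul_comm]

theorem antiTranspose_antiTranspose (g : GL (Fin n) F) : antiTranspose (antiTranspose g) = g := by
  ext i j
  simp [antiTranspose_apply]

theorem antiTranspose_mem {u : GL (Fin n) F} (hu : u ∈ upperUnipotent F n) :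
    antiTranspose u ∈ upperUnipotent F n := by
  intro i j hij
  rw [antiTranspose_apply, hu j.rev i.rev]
  · simp [eq_comm]
  · have hij' : ¬ (i : ℕ) < j := hij
    change ¬ ((j.rev : ℕ) < (i.rev : ℕ))
    simp only [Fin.val_rev]; omega

/-- The anti-automorphism permutes the superdiagonal entries, so it preserves the character
of `U`. -/
theorem unipotentChar_antiTranspose (ψ : AddChar F ℂ) (u : GL (Fin n) F) :
    unipotentChar ψ (antiTranspose u) = unipotentChar ψ u := by
  rw [unipotentChar_eq, unipotentChar_eq]
  congr 1
  rw [superdiagSum, superdiagSum]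
  refine Finset.sum_bij_ne_zero (fun i _ h => Fin.rev ⟨(i : ℕ) + 1, by
    by_contra h'; rw [dif_neg h'] at h; exact h rfl⟩) (fun _ _ _ => Finset.mem_univ _) ?_ ?_ ?_
  · intro i _ hi j _ hj h
    have hi' : (i : ℕ) + 1 < n := by
      by_contra h'; rw [dif_neg h'] at hi; exact hi rfl
    have hj' : (j : ℕ) + 1 < n := by
      by_contra h'; rw [dif_neg h'] at hj; exact hj rfl
    have h1 := congrArg Fin.val h
    simp only [Fin.val_rev] at h1
    ext; omega
  · intro j _ hj
    have h' : (j : ℕ) + 1 < n := by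
      by_contra h'; rw [dif_neg h'] at hj; exact hj rfl
    have h2 : ((⟨(j : ℕ) + 1, h'⟩ : Fin n).rev : ℕ) + 1 < n := by simp only [Fin.val_rev]; omega
    have e1 : (⟨((⟨(j : ℕ) + 1, h'⟩ : Fin n).rev : ℕ) + 1, h2⟩ : Fin n).rev = j := by
      ext; simp only [Fin.val_rev]; omega
    refine ⟨Fin.rev ⟨(j : ℕ) + 1, h'⟩, Finset.mem_univ _, ?_, ?_⟩
    · rw [dif_pos h'] at hj
      rw [dif_pos h2, antiTranspose_apply, e1, Fin.rev_rev]; exact hj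
    · exact e1
  · intro i _ h
    have h' : (i : ℕ) + 1 < n := by
      by_contra h'; rw [dif_neg h'] at h; exact h rfl
    have h2 : ((⟨(i : ℕ) + 1, h'⟩ : Fin n).rev : ℕ) + 1 < n := by simp only [Fin.val_rev]; omega
    refine (dif_pos h').trans (Eq.trans ?_ (dif_pos h2).symm)
    rw [antiTranspose_apply]
    exact congrArg (u _) (Fin.ext (by simp only [Fin.val_rev]; omega))

end AntiInvolution

section Relevant

/-- A permutation all of whose descents have size one reverses consecutive blocks of indices. -/
theorem exists_reversed_block {n : ℕ} (τ : Equiv.Perm (Fin n))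
    (h : ∀ i j : Fin n, (i : ℕ) + 1 = j → τ j < τ i → (τ j : ℕ) + 1 = τ i) (i : Fin n) :
    ∃ c d : ℕ, c ≤ i ∧ (i : ℕ) ≤ d ∧ d < n ∧
      ∀ x : Fin n, c ≤ x → (x : ℕ) ≤ d → (τ x : ℕ) = c + d - x := by
  suffices H : ∀ r k : ℕ, k + r = n → (∀ x : Fin n, (x : ℕ) < k → (τ x : ℕ) < k) →
      ∀ i : Fin n, k ≤ i → ∃ c d : ℕ, c ≤ i ∧ (i : ℕ) ≤ d ∧ d < n ∧
        ∀ x : Fin n, c ≤ x → (x : ℕ) ≤ d → (τ x : ℕ) = c + d - x from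
    H n 0 (by omega) (fun x hx => absurd hx (by omega)) i (by omega)
  clear i
  intro r
  induction r using Nat.strong_induction_on with
  | _ r ih =>
    intro k hkr hst i hi
    have hk : k < n := lt_of_le_of_lt hi i.2
    -- the preimage of `[0, k)` is `[0, k)` itself
    have hst' : ∀ x : Fin n, k ≤ (x : ℕ) → k ≤ (τ x : ℕ) := by
      intro x hx
      by_contra hlt
      let f : Fin k → Fin k := fun y => ⟨τ ⟨y, y.2.trans hk⟩, hst _ y.2⟩
      have hf : Function.Injective f := by
        intro y z hyz
        have h1 : (⟨y, y.2.trans hk⟩ : Fin n) = ⟨z, z.2.trans hk⟩ :=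
          τ.injective (Fin.ext (by simpa [f] using hyz))
        exact Fin.ext (Fin.mk.inj h1)
      obtain ⟨y, hy⟩ := Finite.surjective_of_injective hf ⟨τ x, by omega⟩
      have h1 : (⟨y, y.2.trans hk⟩ : Fin n) = x := τ.injective (Fin.ext (by simpa [f] using hy))
      have h2 := congrArg Fin.val h1
      have := y.2
      simp only at h2
      omega
    obtain ⟨l, hl⟩ : ∃ l, (τ ⟨k, hk⟩ : ℕ) = k + l :=
      ⟨_, (Nat.add_sub_cancel' (hst' ⟨k, hk⟩ le_rfl)).symm⟩
    have hln : k + l < n := hl ▸ (τ ⟨k, hk⟩).2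
    -- after `k`, the value goes down by one at each step until it reaches `k`: an ascent on the way
    -- would leave the value below it without a preimage
    have hblock : ∀ j, j ≤ l → ∀ e, (he : k + e < n) → e ≤ j → (τ ⟨k + e, he⟩ : ℕ) = k + l - e := by
      intro j
      induction j with
      | zero =>
        intro _ e he he0
        obtain rfl : e = 0 := by omega
        simpa using hl
      | succ j ihj =>
        intro hj e he hej
        have ihj := ihj (by omega)
        have hj' := ihj j (by omega) le_rfl
        rcases Nat.lt_or_ge e (j + 1) with hlt | hge
        · exact ihj e he (by omega)
        obtain rfl : e = j + 1 := by omega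
        set x₀ : Fin n := ⟨k + j, by omega⟩
        set x₁ : Fin n := ⟨k + (j + 1), by omega⟩
        have hne : ∀ y : Fin n, (k + j : ℕ) < y → (τ y : ℕ) ≠ k + l - j := by
          intro y hy hyj
          have h1 := τ.injective (Fin.ext (hyj.trans hj'.symm))
          rw [h1] at hy
          simp [x₀] at hy
        rcases lt_or_ge (τ x₁) (τ x₀) with hlt | hge
        · have := h x₀ x₁ (by simp [x₀, x₁]; omega) hlt
          omega
        · exfalso
          have hbig : ∀ d (hd : k + j + 1 + d < n), k + l - j < (τ ⟨k + j + 1 + d, hd⟩ : ℕ) := by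
            intro d
            induction d with
            | zero =>
              intro hd
              have h1 := hne ⟨k + j + 1 + 0, hd⟩ (by simp)
              have h2 : (τ x₀ : ℕ) ≤ τ x₁ := hge
              have h3 : (⟨k + j + 1 + 0, hd⟩ : Fin n) = x₁ := by simp [x₁]; omega
              rw [h3] at h1 ⊢
              omega
            | succ d ihd =>
              intro hd
              have h0 := ihd (by omega)
              have h1 := hne ⟨k + j + 1 + (d + 1), hd⟩ (by simp; omega)
              rcases lt_or_ge (τ ⟨k + j + 1 + (d + 1), hd⟩) (τ ⟨k + j + 1 + d, by omega⟩)
                with hlt | hge'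
              · have h2 := h ⟨k + j + 1 + d, by omega⟩ ⟨k + j + 1 + (d + 1), hd⟩
                  (by simp only; omega) hlt
                omega
              · have h2 : (τ ⟨k + j + 1 + d, by omega⟩ : ℕ) ≤ τ ⟨k + j + 1 + (d + 1), hd⟩ := hge'
                omega
          obtain ⟨x, hx⟩ := τ.surjective ⟨k + l - j - 1, by omega⟩
          have hx' : (τ x : ℕ) = k + l - j - 1 := congrArg Fin.val hx
          have hkx : k ≤ (x : ℕ) := by
            by_contra hlt
            have := hst x (by omega)
            omega
          rcases lt_or_ge (k + j) (x : ℕ) with hx1 | hx1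
          · have h1 := hbig (x - (k + j + 1)) (by have := x.2; omega)
            have h2 : (⟨k + j + 1 + (x - (k + j + 1)), by have := x.2; omega⟩ : Fin n) = x := by
              ext; simp only; omega
            rw [h2] at h1
            omega
          · have h1 := ihj (x - k) (by have := x.2; omega) (by omega)
            have h2 : (⟨k + (x - k), by have := x.2; omega⟩ : Fin n) = x := by
              ext; simp only; omega
            rw [h2] at h1
            omega
    by_cases hil : (i : ℕ) ≤ k + l
    · refine ⟨k, k + l, hi, hil, hln, fun x hx hxl => ?_⟩
      have h1 := hblock l le_rfl (x - k) (by have := x.2; omega) (by omega)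
      have h2 : (⟨k + (x - k), by have := x.2; omega⟩ : Fin n) = x := by
        ext; simp only; omega
      rw [h2] at h1
      omega
    · refine ih (r - (l + 1)) (by omega) (k + l + 1) (by omega) (fun x hx => ?_) i (by omega)
      rcases Nat.lt_or_ge (x : ℕ) k with hxk | hxk
      · have := hst x hxk
        omega
      · have h1 := hblock l le_rfl (x - k) (by have := x.2; omega) (by omega)
        have h2 : (⟨k + (x - k), by have := x.2; omega⟩ : Fin n) = x := by
          ext; simp only; omega
        rw [h2] at h1
        omega

variable {F : Type*} [Field F] {n : ℕ} {M : Type*} [AddCommGroup M] [Module ℂ M]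

/-- Functions on `GL_n(F)` on which `U_n(F)` acts through `ψ` from both sides. -/
structure IsBiWhittaker (ψ : AddChar F ℂ) (f : GL (Fin n) F → M) : Prop where
  left : ∀ u ∈ upperUnipotent F n, ∀ g, f (u * g) = unipotentChar ψ u • f g
  right : ∀ u ∈ upperUnipotent F n, ∀ g, f (g * u) = unipotentChar ψ u • f g

variable {ψ : AddChar F ℂ}

theorem smul_eq_of_ne_zero {c d : ℂ} {x : M} (hx : x ≠ 0) (h : c • x = d • x) : c = d := by
  by_contra hcd
  rw [← sub_eq_zero, ← sub_smul, smul_eq_zero, sub_eq_zero] at h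
  exact h.elim hcd hx

/-- At a monomial matrix on which a bi-equivariant function does not vanish, an ascent of the
permutation has size one and equal coefficients; so the matrix is block antidiagonal with scalar
blocks. -/
theorem IsBiWhittaker.relevant (hψ : ψ ≠ 1) {f : GL (Fin n) F → M} (hf : IsBiWhittaker ψ f)
    {m : GL (Fin n) F} {π : Equiv.Perm (Fin n)} {a : Fin n → F} (hm : IsMonomial m π a)
    (hfm : f m ≠ 0) {i j : Fin n} (hij : (i : ℕ) + 1 = j) (hπ : π i < π j) :
    (π i : ℕ) + 1 = π j ∧ a i = a j := by
  have hne : i ≠ j := by rintro rfl; omega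
  have hai := hm.ne_zero i
  -- a root subgroup of `U` that conjugation by `m` carries to the simple root subgroup of `(i, j)`
  have key : ∀ t : F, ∃ h, unipotentChar ψ (transv (Pi.single (π i) (t / a i))
      (Pi.single (π j) (a j)) h) = ψ t := by
    intro t
    have hb : (Pi.single (π j) (a j) : Fin n → F) ⬝ᵥ Pi.single (π i) (t / a i) = 0 := by
      rw [dotProduct_single, Pi.single_apply, if_neg hπ.ne, zero_mul]
    refine ⟨hb, ?_⟩
    have hmx : Matrix.mulVec (m : Matrix (Fin n) (Fin n) F) (Pi.single (π i) (t / a i)) =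
        Pi.single i t := by
      rw [hm.mulVec]
      ext k
      rcases eq_or_ne k i with rfl | hk
      · simp; field_simp
      · simp [hk]
    have hbm := hm.vecMul j 1
    rw [one_mul] at hbm
    have hmul := mul_transv hb hmx hbm
    have h1 := hf.right (transv (Pi.single (π i) (t / a i)) (Pi.single (π j) (a j)) hb)
      (transv_mem_upperUnipotent fun x y hxy => by
        by_cases hx : x = π i
        · right
          have : y ≠ π j := by rintro rfl; exact hxy (hx ▸ hπ)
          simp [this]
        · left; simp [hx]) m
    rw [hmul, hf.left _ (transv_mem_upperUnipotent fun x y hxy => by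
        by_cases hx : x = i
        · right
          have : y ≠ j := by rintro rfl; subst hx; omega
          simp [this]
        · left; simp [hx])] at h1
    rw [← smul_eq_of_ne_zero hfm h1, unipotentChar_transv i j hij]
    · simp
    · intro x y _ hx
      left; simp [hx]
  have hsucc : (π i : ℕ) + 1 = π j := by
    by_contra hns
    apply hψ
    ext t
    obtain ⟨h, ht⟩ := key t
    rw [← ht, unipotentChar_transv_eq_one, AddChar.one_apply]
    intro x y hxy
    by_cases hx : x = π i
    · right
      have : y ≠ π j := by rintro rfl; subst hx; exact hns hxy
      simp [this]
    · left; simp [hx]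
  refine ⟨hsucc, ?_⟩
  have : a j / a i = 1 := by
    refine eq_of_addChar_mul_eq hψ fun t => ?_
    obtain ⟨h, ht⟩ := key t
    rw [mul_one, ← ht, unipotentChar_transv (π i) (π j) hsucc]
    · congr 1; simp; field_simp
    · intro x y _ hx
      left; simp [hx]
  field_simp at this
  exact this.symm

/-- The monomial matrices that support bi-equivariant functions are fixed by the anti-automorphism:
the permutation reverses consecutive blocks, up to a global reversal, and the coefficients are
constant on each block. -/
theorem IsBiWhittaker.antiTranspose_monomial (hψ : ψ ≠ 1) {f : GL (Fin n) F → M}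
    (hf : IsBiWhittaker ψ f) {m : GL (Fin n) F} {π : Equiv.Perm (Fin n)} {a : Fin n → F}
    (hm : IsMonomial m π a) (hfm : f m ≠ 0) : antiTranspose m = m := by
  have hrel := fun i j hij hπ => hf.relevant hψ hm hfm (i := i) (j := j) hij hπ
  have hτ : ∀ i, ((π.trans Fin.revPerm) i : ℕ) = n - (π i + 1) := fun i => by simp [Fin.val_rev]
  have hblock := exists_reversed_block (π.trans Fin.revPerm) (fun i j hij hlt => by
    have h1 : π i < π j := by
      rw [Fin.lt_def, hτ, hτ] at hlt
      rw [Fin.lt_def]; omega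
    have h2 := (hrel i j hij h1).1
    rw [hτ, hτ]
    have := (π j).2
    omega)
  -- the symmetry of `m` under the anti-automorphism, in terms of `π` and `a`
  have hconst : ∀ i, π (π i).rev = i.rev ∧ a (π i).rev = a i := by
    intro i
    obtain ⟨c, d, hci, hid, hdn, hcd⟩ := hblock i
    have hi := hcd i hci hid
    have h1 : ((π i).rev : ℕ) = c + d - i := by rw [← hi]; rfl
    constructor
    · have h2 := hcd (π i).rev (by omega) (by omega)
      rw [hτ] at h2
      ext
      rw [Fin.val_rev]
      have := (π (π i).rev).2
      omega
    · -- the coefficients are constant on each block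
      have hc : ∀ e, (he : c + e < n) → c + e ≤ d → a ⟨c + e, he⟩ = a ⟨c, by omega⟩ := by
        intro e
        induction e with
        | zero => intro _ _; rfl
        | succ e ihe =>
          intro he hed
          rw [← ihe (by omega) (by omega)]
          refine (hrel ⟨c + e, by omega⟩ ⟨c + (e + 1), he⟩ (by simp only; omega) ?_).2.symm
          have h2 := hcd ⟨c + e, by omega⟩ (by simp) (by simp only; omega)
          have h3 := hcd ⟨c + (e + 1), he⟩ (by simp) (by simp only; omega)
          rw [hτ] at h2 h3
          simp only at h2 h3
          rw [Fin.lt_def]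
          omega
      have e1 : i = ⟨c + (i - c), by omega⟩ := by ext; simp only; omega
      have e2 : (π i).rev = ⟨c + ((π i).rev - c), by omega⟩ := by ext; simp only; omega
      rw [e1, hc _ _ (by omega), ← e1, e2, hc _ _ (by omega)]
  ext i j
  rw [antiTranspose_apply, hm j.rev, hm i, Pi.single_apply, Pi.single_apply]
  by_cases h : j = π i
  · subst h
    have h1 := hconst i
    rw [h1.1, h1.2]
    simp
  · rw [if_neg h, if_neg]
    intro h'
    apply h
    have h1 := (hconst j.rev).1
    rw [← h', Fin.rev_rev, Fin.rev_rev] at h1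
    exact h1.symm

/-- Bi-equivariant functions are invariant under the anti-automorphism `g ↦ w gᵗ w`. -/
theorem IsBiWhittaker.antiTranspose (hψ : ψ ≠ 1) {f : GL (Fin n) F → M}
    (hf : IsBiWhittaker ψ f) (g : GL (Fin n) F) : f (antiTranspose g) = f g := by
  obtain ⟨u, hu, v, hv, m, π, a, hm, rfl⟩ := bruhat g
  have hf' : IsBiWhittaker ψ (fun g => f (FiniteGL.antiTranspose g)) := by
    constructor <;> intro u hu g
    · rw [antiTranspose_mul, hf.right _ (antiTranspose_mem hu), unipotentChar_antiTranspose]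
    · rw [antiTranspose_mul, hf.left _ (antiTranspose_mem hu), unipotentChar_antiTranspose]
  have hm' : f (FiniteGL.antiTranspose m) = f m := by
    by_cases h0 : f m = 0
    · by_contra h
      rw [h0] at h
      have h1 := hf'.antiTranspose_monomial hψ hm h
      rw [h1] at h
      exact h h0
    · rw [hf.antiTranspose_monomial hψ hm h0]
  have h1 := hf'.right v hv (u * m)
  have h2 := hf'.left u hu m
  rw [h1, h2, hf.right v hv, hf.left u hu, hm']

end Relevant

/-! ### Sums over subgroups and column transvections -/

section Averages

variable {F : Type*} [Field F] [Finite F] {n : ℕ}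

noncomputable instance instFintypeGL : Fintype (GL (Fin n) F) := Fintype.ofFinite _

noncomputable instance instFintypeSubgroup (H : Subgroup (GL (Fin n) F)) : Fintype H :=
  Fintype.ofFinite _

theorem sum_subgroup_mul_left {M : Type*} [AddCommMonoid M] (H : Subgroup (GL (Fin n) F))
    (f : GL (Fin n) F → M) {h : GL (Fin n) F} (hh : h ∈ H) :
    ∑ x : H, f (h * x) = ∑ x : H, f x :=
  Equiv.sum_comp (Equiv.mulLeft (⟨h, hh⟩ : H)) fun x : H => f x

theorem sum_subgroup_mul_right {M : Type*} [AddCommMonoid M] (H : Subgroup (GL (Fin n) F))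
    (f : GL (Fin n) F → M) {h : GL (Fin n) F} (hh : h ∈ H) :
    ∑ x : H, f (x * h) = ∑ x : H, f x :=
  Equiv.sum_comp (Equiv.mulRight (⟨h, hh⟩ : H)) fun x : H => f x

theorem card_subgroup_ne_zero (H : Subgroup (GL (Fin n) F)) : (Fintype.card H : ℂ) ≠ 0 :=
  Nat.cast_ne_zero.2 Fintype.card_ne_zero

end Averages

section WhittakerSum

variable {F : Type*} [Field F] [Finite F] {n : ℕ} {V : Type*} [AddCommGroup V] [Module ℂ V]

/-- `|U|` times the projection of `σ` onto the vectors on which `U` acts through `ψ`. -/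
noncomputable def whittakerSum (σ : Representation ℂ (GL (Fin n) F) V) (ψ : AddChar F ℂ) :
    V →ₗ[ℂ] V :=
  ∑ u : upperUnipotent F n, (unipotentChar ψ (u : GL (Fin n) F))⁻¹ • σ u

variable (σ : Representation ℂ (GL (Fin n) F) V) (ψ : AddChar F ℂ)

theorem whittakerSum_apply (v : V) : whittakerSum σ ψ v =
    ∑ u : upperUnipotent F n, (unipotentChar ψ (u : GL (Fin n) F))⁻¹ • σ u v := by
  simp [whittakerSum, LinearMap.sum_apply]

variable {σ ψ}

theorem whittakerSum_apply_mul {u : GL (Fin n) F} (hu : u ∈ upperUnipotent F n) (v : V) :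
    whittakerSum σ ψ (σ u v) = unipotentChar ψ u • whittakerSum σ ψ v := by
  rw [whittakerSum_apply, whittakerSum_apply, Finset.smul_sum,
    ← sum_subgroup_mul_right _ (fun x => unipotentChar ψ u • (unipotentChar ψ x)⁻¹ • σ x v) hu]
  refine Finset.sum_congr rfl fun x _ => ?_
  rw [unipotentChar_mul x.2 hu, map_mul, smul_smul, mul_inv_rev,
    mul_inv_cancel_left₀ (unipotentChar_ne_zero hu)]
  rfl

theorem apply_whittakerSum {u : GL (Fin n) F} (hu : u ∈ upperUnipotent F n) (v : V) :
    σ u (whittakerSum σ ψ v) = unipotentChar ψ u • whittakerSum σ ψ v := by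
  rw [whittakerSum_apply, map_sum, Finset.smul_sum,
    ← sum_subgroup_mul_left _ (fun x => unipotentChar ψ u • (unipotentChar ψ x)⁻¹ • σ x v) hu]
  refine Finset.sum_congr rfl fun x _ => ?_
  rw [unipotentChar_mul hu x.2, map_mul, smul_smul, mul_inv, map_smul,
    mul_inv_cancel_left₀ (unipotentChar_ne_zero hu)]
  rfl

theorem whittakerSum_of_equivariant {v : V}
    (hv : ∀ u ∈ upperUnipotent F n, σ u v = unipotentChar ψ u • v) :
    whittakerSum σ ψ v = (Fintype.card (upperUnipotent F n) : ℂ) • v := by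
  rw [whittakerSum_apply]
  rw [Finset.sum_congr rfl (g := fun _ => v)]
  · simp [Nat.cast_smul_eq_nsmul]
  · intro u _
    rw [hv u u.2, smul_smul, inv_mul_cancel₀ (unipotentChar_ne_zero u.2), one_smul]

/-- `whittakerSum` is a projection up to the factor `|U|`. -/
theorem whittakerSum_whittakerSum (v : V) : whittakerSum σ ψ (whittakerSum σ ψ v) =
    (Fintype.card (upperUnipotent F n) : ℂ) • whittakerSum σ ψ v :=
  whittakerSum_of_equivariant fun _ hu => apply_whittakerSum hu v

end WhittakerSum

section KirillovInjectivity

variable {F : Type*} [Field F] {n : ℕ}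

/-- A nonzero row supported in the first `k` coordinates is the `k`-th row of some `diag(g, 1)` with
`g` of size `k`. -/
theorem exists_blockGroup_row {k : ℕ} (i : Fin n) (hi : (i : ℕ) + 1 = k) (b : Fin n → F)
    (hb : ∀ j : Fin n, k ≤ (j : ℕ) → b j = 0) (hb0 : b ≠ 0) :
    ∃ g ∈ blockGroup k, (g : GL (Fin n) F) i = b := by
  obtain ⟨j, hj⟩ := Function.ne_iff.1 hb0
  rw [Pi.zero_apply] at hj
  have hjk : (j : ℕ) < k := by
    by_contra h; exact hj (hb j (by omega))
  let c : Fin n → F := b - Pi.single j 1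
  have hc : c ⬝ᵥ Pi.single j 1 = b j - 1 := by rw [dotProduct_single_one]; simp [c]
  -- the identity matrix with row `j` replaced by `b`
  let h : GL (Fin n) F :=
    { val := 1 + Matrix.vecMulVec (Pi.single j 1) c
      inv := 1 - (b j)⁻¹ • Matrix.vecMulVec (Pi.single j 1) c
      val_inv := by
        rw [add_mul, mul_sub, mul_sub, Matrix.mul_smul, Matrix.mul_smul,
          Matrix.vecMulVec_mul_vecMulVec, hc, Matrix.vecMulVec_smul, smul_smul, mul_sub,
          inv_mul_cancel₀ hj, sub_smul]
        simp
      inv_val := by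
        rw [sub_mul, mul_add, mul_add, Matrix.smul_mul, Matrix.smul_mul,
          Matrix.vecMulVec_mul_vecMulVec, hc, Matrix.vecMulVec_smul, smul_smul, mul_sub,
          inv_mul_cancel₀ hj, sub_smul]
        simp }
  have hh : ∀ x y, h x y = (if x = y then 1 else 0) + (Pi.single j 1 : Fin n → F) x * c y :=
    fun x y => by
      change (1 + Matrix.vecMulVec (Pi.single j 1) c) x y = _
      rw [Matrix.add_apply, Matrix.one_apply, Matrix.vecMulVec_apply]
  refine ⟨permGL (Equiv.swap i j) * h, mul_mem ?_ ?_, ?_⟩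
  · rw [mem_blockGroup]
    intro x y hxy
    rw [permGL_row, Pi.single_apply]
    have : (Equiv.swap i j x = y) ↔ x = y := by
      rcases hxy with hx | hy
      · rw [Equiv.swap_apply_of_ne_of_ne] <;> rintro rfl <;> omega
      · rw [Equiv.swap_apply_eq_iff, Equiv.swap_apply_of_ne_of_ne] <;> rintro rfl <;> omega
    simp only [eq_comm (a := y), this]
  · rw [mem_blockGroup]
    intro x y hxy
    rw [hh]
    rcases hxy with hx | hy
    · have : x ≠ j := by rintro rfl; omega
      simp [this]
    · have : y ≠ j := by rintro rfl; omega
      simp [c, hb y hy, this]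
  · rw [permGL_mul_row, Equiv.swap_apply_left]
    ext y
    rw [hh]
    by_cases h : j = y
    · subst h; simp [c]
    · simp [c, h, Ne.symm h]

/-- Elements of `U` whose first `k` columns are those of the identity matrix. -/
def FixesColumns (k : ℕ) (u : GL (Fin n) F) : Prop :=
  ∀ j : Fin n, (j : ℕ) < k → Matrix.mulVec (u : Matrix (Fin n) (Fin n) F) (Pi.single j 1) =
    Pi.single j 1

/-- `g` fixes `e_j` if and only if its column `j` is that of the identity. -/
theorem mulVec_single_eq_iff {g : GL (Fin n) F} {j : Fin n} :
    Matrix.mulVec (g : Matrix (Fin n) (Fin n) F) (Pi.single j 1) = Pi.single j 1 ↔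
      ∀ i, g i j = if i = j then 1 else 0 := by
  rw [Matrix.mulVec_single_one, funext_iff]
  refine forall_congr' fun i => ?_
  rw [Matrix.col, Matrix.transpose_apply, Pi.single_apply]

/-- Such elements fix every column supported in the first `k` coordinates. -/
theorem FixesColumns.mulVec {k : ℕ} {u : GL (Fin n) F} (hu : FixesColumns k u) {y : Fin n → F}
    (hy : ∀ i : Fin n, k ≤ (i : ℕ) → y i = 0) :
    Matrix.mulVec (u : Matrix (Fin n) (Fin n) F) y = y := by
  ext i
  rw [Matrix.mulVec, dotProduct, Finset.sum_eq_single i]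
  · by_cases hi : (i : ℕ) < k
    · rw [mulVec_single_eq_iff.1 (hu i hi), if_pos rfl, one_mul]
    · rw [hy i (by omega), mul_zero]
  · intro j _ hj
    by_cases hjk : (j : ℕ) < k
    · rw [mulVec_single_eq_iff.1 (hu j hjk), if_neg (Ne.symm hj), zero_mul]
    · rw [hy j (by omega), mul_zero]
  · simp

theorem mulVec_mul (g h : GL (Fin n) F) (y : Fin n → F) :
    Matrix.mulVec ((g * h : GL (Fin n) F) : Matrix (Fin n) (Fin n) F) y =
      Matrix.mulVec (g : Matrix (Fin n) (Fin n) F)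
        (Matrix.mulVec (h : Matrix (Fin n) (Fin n) F) y) := by
  rw [Matrix.GeneralLinearGroup.coe_mul, ← Matrix.mulVec_mulVec]

theorem mulVec_transv (a b : Fin n → F) (h : b ⬝ᵥ a = 0) (y : Fin n → F) :
    Matrix.mulVec (transv a b h : Matrix (Fin n) (Fin n) F) y = y + (b ⬝ᵥ y) • a := by
  rw [coe_transv, Matrix.add_mulVec, Matrix.one_mulVec]
  ext i
  simp [Matrix.vecMulVec_mulVec, mul_comm]

/-- The element `1 + y ⊗ e_k`, whose `k`-th column is `y + e_k`, where `y k = 0`. -/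
def colTransv (y : Fin n → F) (k : Fin n) (hy : y k = 0) : GL (Fin n) F :=
  transv y (Pi.single k 1) (by rw [single_one_dotProduct, hy])

theorem colTransv_mem {y : Fin n → F} {k : Fin n} {hy : y k = 0}
    (hyk : ∀ i, k ≤ i → y i = 0) : colTransv y k hy ∈ upperUnipotent F n :=
  transv_mem_upperUnipotent fun i j hij => by
    by_cases hj : j = k
    · left; exact hyk i (by subst hj; exact not_lt.1 hij)
    · right; simp [hj]

theorem unipotentChar_colTransv {ψ : AddChar F ℂ} {y : Fin n → F} {k l : Fin n} {hy : y k = 0}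
    (hl : (l : ℕ) + 1 = k) : unipotentChar ψ (colTransv y k hy) = ψ (y l) := by
  rw [colTransv, unipotentChar_transv l k hl]
  · simp
  · intro i j hij hil
    right
    have : j ≠ k := by rintro rfl; apply hil; ext; omega
    simp [this]

theorem mulVec_colTransv (y : Fin n → F) (k : Fin n) (hy : y k = 0) (x : Fin n → F) :
    Matrix.mulVec (colTransv y k hy : Matrix (Fin n) (Fin n) F) x = x + x k • y := by
  rw [colTransv, mulVec_transv, single_one_dotProduct]

theorem colTransv_mul (y z : Fin n → F) (k : Fin n) (hy : y k = 0) (hz : z k = 0) :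
    colTransv y k hy * colTransv z k hz = colTransv (y + z) k (by simp [hy, hz]) :=
  transv_mul_transv_left _ _

theorem colTransv_neg_mul (y : Fin n → F) (k : Fin n) (hy : y k = 0) :
    colTransv (-y) k (by simp [hy]) * colTransv y k hy = 1 := transv_neg_mul _ _ _

theorem colTransv_inv (y : Fin n → F) (k : Fin n) (hy : y k = 0) :
    (colTransv y k hy)⁻¹ = colTransv (-y) k (by simp [hy]) :=
  inv_eq_of_mul_eq_one_left (colTransv_neg_mul y k hy)

/-- Conjugating a column transvection by an element that fixes the row `e_k`. -/
theorem mul_colTransv {g : GL (Fin n) F} {k : Fin n} (hg : g k = Pi.single k 1) (y : Fin n → F)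
    (hy : y k = 0) :
    g * colTransv y k hy = colTransv (Matrix.mulVec (g : Matrix (Fin n) (Fin n) F) y) k
      (by rw [Matrix.mulVec, hg, single_one_dotProduct, hy]) * g :=
  mul_transv _ rfl (by rw [single_vecMul, hg])

end KirillovInjectivity

/-! ### Injectivity of the Kirillov model -/

section KirillovInjectivity

variable {F : Type*} [Field F] {n : ℕ}

/-- A unipotent element that fixes the first `k` columns splits off its column `k` as a
transvection. -/
theorem FixesColumns.exists_colTransv {k : Fin n} {u : GL (Fin n) F} (hu : u ∈ upperUnipotent F n)
    (hk : FixesColumns (k : ℕ) u) :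
    ∃ (y : Fin n → F) (hy : ∀ i, k ≤ i → y i = 0) (u' : GL (Fin n) F),
      u' ∈ upperUnipotent F n ∧ FixesColumns ((k : ℕ) + 1) u' ∧
        u = colTransv y k (hy k le_rfl) * u' := by
  let y : Fin n → F := Matrix.mulVec (u : Matrix (Fin n) (Fin n) F) (Pi.single k 1) - Pi.single k 1
  have hyi : ∀ i, k ≤ i → y i = 0 := by
    intro i hi
    have h := hu i k (not_lt.2 hi)
    simp only [y, Pi.sub_apply, Matrix.mulVec_single_one, Matrix.col, Matrix.transpose_apply]
    rw [h, Pi.single_apply, sub_self]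
  have hyi' : ∀ i, k ≤ i → (-y) i = 0 := fun i hi => by rw [Pi.neg_apply, hyi i hi, neg_zero]
  refine ⟨y, hyi, (colTransv y k (hyi k le_rfl))⁻¹ * u,
    mul_mem (inv_mem (colTransv_mem hyi)) hu, fun j hj => ?_, by group⟩
  rw [colTransv_inv, mulVec_mul, mulVec_colTransv]
  rcases Nat.lt_or_ge (j : ℕ) k with hjk | hjk
  · have hne : k ≠ j := by rintro rfl; omega
    rw [hk j hjk]
    simp [hne]
  · obtain rfl : j = k := Fin.ext (by omega)
    have : Matrix.mulVec (u : Matrix (Fin n) (Fin n) F) (Pi.single j 1) = y + Pi.single j 1 := by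
      simp [y]
    rw [this, Pi.add_apply, hyi j le_rfl]
    simp

/-- The group of unipotent elements that fix the first `k + 1` columns, together with its character,
is normalized by `diag(GL_k, 1)`. -/
theorem FixesColumns.conj_blockGroup {k : ℕ} {u g : GL (Fin n) F} (hu : u ∈ upperUnipotent F n)
    (hk : FixesColumns (k + 1) u) (hg : g ∈ blockGroup k) :
    g⁻¹ * (u * g) ∈ upperUnipotent F n ∧ FixesColumns (k + 1) (g⁻¹ * (u * g)) ∧
      ∀ ψ : AddChar F ℂ, unipotentChar ψ (g⁻¹ * (u * g)) = unipotentChar ψ u := by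
  have hcol : FixesColumns (k + 1) (g⁻¹ * (u * g)) := by
    intro j hj
    rw [mulVec_mul, mulVec_mul, hk.mulVec]
    · exact glInv_mulVec rfl
    · intro i hi
      rw [blockGroup_mulVec hg _ (by omega), Pi.single_apply, if_neg]
      rintro rfl; omega
  have hrow : ∀ i : Fin n, k ≤ (i : ℕ) → (g⁻¹ * (u * g)) i = u i := by
    intro i hi
    rw [glMul_row_of_single ((inv_mem hg).1 i hi), glMul_row, vecMul_blockGroup hg]
    intro l hl
    rw [hu i l (not_lt.2 (by simp only; omega)), if_neg]
    rintro rfl; omega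
  refine ⟨fun i j hij => ?_, hcol, fun ψ => ?_⟩
  · have hij' : ¬ (i : ℕ) < j := hij
    rcases Nat.lt_or_ge (j : ℕ) (k + 1) with hj | hj
    · exact mulVec_single_eq_iff.1 (hcol j hj) i
    · rw [hrow i (by omega)]; exact hu i j hij
  · rw [unipotentChar_eq, unipotentChar_eq]
    congr 1
    refine Finset.sum_congr rfl fun i _ => ?_
    split_ifs with h
    · rcases Nat.lt_or_ge ((i : ℕ) + 1) (k + 1) with hj | hj
      · rw [mulVec_single_eq_iff.1 (hcol ⟨i + 1, h⟩ hj), mulVec_single_eq_iff.1 (hk ⟨i + 1, h⟩ hj)]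
      · rw [hrow i (by omega)]
    · rfl

theorem FixesColumns.conj_colTransv {k : Fin n} {u : GL (Fin n) F}
    (hk : FixesColumns ((k : ℕ) + 1) u)
    {y : Fin n → F} (hy : ∀ i, k ≤ i → y i = 0) :
    FixesColumns ((k : ℕ) + 1) ((colTransv y k (hy k le_rfl))⁻¹ * (u * colTransv y k (hy k le_rfl))) := by
  intro j hj
  rw [mulVec_mul, mulVec_mul, hk.mulVec]
  · exact glInv_mulVec rfl
  · intro i hi
    have hne : j ≠ i := by rintro rfl; omega
    rw [mulVec_colTransv, Pi.add_apply, Pi.smul_apply, hy i (Fin.le_def.2 (by omega))]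
    simp [hne]

/-- Orthogonality of the characters of `F ^ n`. -/
theorem sum_addChar_dotProduct [Fintype F] [DecidableEq F] {ψ : AddChar F ℂ} (hψ : ψ ≠ 1)
    (y : Fin n → F) : ∑ c : Fin n → F, ψ (-(c ⬝ᵥ y)) = if y =
        0 then (Fintype.card (Fin n → F) : ℂ) else 0 := by
  let f : (Fin n → F) →+ F :=
    { toFun := fun c => -(c ⬝ᵥ y)
      map_zero' := by simp
      map_add' := fun a b => by rw [add_dotProduct]; ring }
  have h := AddChar.sum_eq_ite (ψ.compAddMonoidHom f)
  classical
  have h2 : ψ.compAddMonoidHom f = 0 ↔ y = 0 := by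
    constructor
    · intro h0
      ext i
      refine eq_zero_of_addChar_mul_eq hψ fun t => ?_
      have := DFunLike.congr_fun h0 (-Pi.single i t)
      simpa [f] using this
    · rintro rfl
      ext c
      simp [f]
  simp only [h2] at h
  exact h

/-- `σ (a b) = σ a ∘ σ b`, evaluated at a vector. -/
theorem rep_mul_apply {V : Type*} [AddCommGroup V] [Module ℂ V]
    (σ : Representation ℂ (GL (Fin n) F) V) (a b : GL (Fin n) F) (v : V) :
    σ a (σ b v) = σ (a * b) v := by
  rw [map_mul, Module.End.mul_apply]

variable [Finite F] {V : Type*} [AddCommGroup V] [Module ℂ V]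
  {σ : Representation ℂ (GL (Fin n) F) V} {ψ : AddChar F ℂ}

/-- Injectivity of the Kirillov model: a vector of a cuspidal representation is determined by the
values of Whittaker functionals on its translates by the mirabolic subgroup. -/
theorem eq_zero_of_whittakerSum_mirabolic (hψ : ψ ≠ 1) (hσ : IsIrreducibleCuspidal σ) (v : V)
    (hv : ∀ p ∈ mirabolic F n, whittakerSum σ ψ (σ p v) = 0) : v = 0 := by
  -- induction on `k`, for vectors equivariant under the elements of `U` that fix `k` columns:
  -- `k = n` is the claim, and for `k = 0` the vector is a multiple of its `whittakerSum`
  suffices H : ∀ k ≤ n, ∀ v : V, (∀ u ∈ upperUnipotent F n, FixesColumns k u →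
      σ u v = unipotentChar ψ u • v) →
      (∀ p ∈ mirabolic F n, whittakerSum σ ψ (σ p v) = 0) → v = 0 by
    refine H n le_rfl v (fun u _ hu => ?_) hv
    have h1 : u = 1 := by
      ext i j
      rw [mulVec_single_eq_iff.1 (hu j j.2), Units.val_one, Matrix.one_apply]
    rw [h1, unipotentChar_one, one_smul, map_one]; rfl
  intro k
  induction k with
  | zero =>
    intro _ v hv hp
    have h1 := hp 1 (one_mem _)
    rw [map_one, Module.End.one_apply, whittakerSum_of_equivariant
      fun u hu => hv u hu fun j hj => absurd hj (by omega)] at h1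
    exact (smul_eq_zero.1 h1).resolve_left (card_subgroup_ne_zero _)
  | succ k ih =>
    intro hk v hv hp
    rcases Nat.eq_zero_or_pos k with rfl | hk0
    -- every element of `U` fixes column `0`
    · refine ih (by omega) v (fun u hu _ => hv u hu fun j hj => ?_) hp
      rw [mulVec_single_eq_iff]
      exact fun i => hu i j (by simp only; omega)
    let K : Fin n := ⟨k, by omega⟩
    let I : Fin n := ⟨k - 1, by omega⟩
    -- spectral decomposition of `v` under the group of column transvections in column `k`
    let trunc : (Fin n → F) → Fin n → F := fun y i => if i < K then y i else 0
    have htrunc : ∀ y i, K ≤ i → trunc y i = 0 := fun y i hi => if_neg (not_lt.2 hi)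
    let nK : (Fin n → F) → GL (Fin n) F := fun y => colTransv (trunc y) K (htrunc y K le_rfl)
    have nK_add : ∀ y z, nK (y + z) = nK y * nK z := by
      intro y z
      simp only [nK]
      rw [colTransv_mul]
      congr 1
      ext i
      by_cases h : i < K <;> simp [trunc, h]
    have nK_mem : ∀ y, nK y ∈ upperUnipotent F n := fun y => colTransv_mem (htrunc y)
    have := Fintype.ofFinite F
    classical
    let vc : (Fin n → F) → V := fun c => ∑ y : Fin n → F, ψ (-(c ⬝ᵥ y)) • σ (nK y) v
    have hsum : ∑ c, vc c = (Fintype.card (Fin n → F) : ℂ) • v := by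
      simp only [vc]
      rw [Finset.sum_comm, Finset.sum_congr rfl fun y _ => (Finset.sum_smul (R := ℂ)).symm,
        Finset.sum_eq_single 0]
      · rw [sum_addChar_dotProduct hψ, if_pos rfl]
        have : nK 0 = 1 := by
          have h := nK_add 0 0
          rw [add_zero] at h
          exact (mul_eq_left.1 h.symm)
        rw [this, map_one, Module.End.one_apply]
      · intro y _ hy
        rw [sum_addChar_dotProduct hψ, if_neg hy, zero_smul]
      · simp
    have hchar : ∀ c y, σ (nK y) (vc c) = ψ (c ⬝ᵥ y) • vc c := by
      intro c y
      simp only [vc]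
      rw [map_sum, Finset.smul_sum]
      refine Eq.trans ?_ (Equiv.sum_comp (Equiv.addLeft y) _)
      refine Finset.sum_congr rfl fun z _ => ?_
      simp only [Equiv.coe_addLeft]
      rw [nK_add, map_mul, map_smul, smul_smul, ← AddChar.map_add_eq_mul,
        dotProduct_add]
      rw [show c ⬝ᵥ y + -(c ⬝ᵥ y + c ⬝ᵥ z) = -(c ⬝ᵥ z) by ring]
      rfl
    have hequi : ∀ c, ∀ u ∈ upperUnipotent F n, FixesColumns (k + 1) u →
        σ u (vc c) = unipotentChar ψ u • vc c := by
      intro c u hu huk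
      simp only [vc]
      rw [map_sum, Finset.smul_sum]
      refine Finset.sum_congr rfl fun y _ => ?_
      have h1 : u * nK y = nK y * ((nK y)⁻¹ * (u * nK y)) := by group
      have h2 : (nK y)⁻¹ * (u * nK y) ∈ upperUnipotent F n :=
        mul_mem (inv_mem (nK_mem y)) (mul_mem hu (nK_mem y))
      rw [map_smul, ← Module.End.mul_apply, ← map_mul, h1, map_mul, Module.End.mul_apply,
        hv _ h2 (FixesColumns.conj_colTransv (k := K) huk (htrunc y)), map_smul,
        unipotentChar_mul (inv_mem (nK_mem y)) (mul_mem hu (nK_mem y)),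
        unipotentChar_mul hu (nK_mem y), unipotentChar_inv (nK_mem y), smul_comm]
      congr 1
      field_simp [unipotentChar_ne_zero (ψ := ψ) (nK_mem y)]
    have hP : ∀ c, ∀ p ∈ mirabolic F n, whittakerSum σ ψ (σ p (vc c)) = 0 := by
      intro c p hpP
      simp only [vc]
      rw [map_sum, map_sum]
      refine Finset.sum_eq_zero fun y _ => ?_
      rw [map_smul, map_smul, rep_mul_apply,
        hp _ (mul_mem hpP (upperUnipotent_le_mirabolic (nK_mem y))), smul_zero]
    have hzero : ∀ c, vc c = 0 := by
      intro c
      by_cases hc : trunc c = 0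
      · -- the trivial character does not occur, by cuspidality
        refine hσ.2 (fun i => if (i : ℕ) < k then 0 else 1) ?_ ⟨⟨0, by omega⟩, K, ?_⟩ _ ?_
        · intro i j hij
          have hij' : (i : ℕ) ≤ j := hij
          dsimp only
          split_ifs <;> omega
        · simp [K, hk0]
        · intro u hu
          have hu1 : ∀ i j : Fin n, ¬ ((i : ℕ) < k ∧ k ≤ (j : ℕ)) → u i j = if i =
              j then 1 else 0 := by
            intro i j hij
            refine hu i j ?_
            dsimp only
            split_ifs <;> omega
          have huU : u ∈ upperUnipotent F n := fun i j hij => hu1 i j (by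
            have : ¬ (i : ℕ) < j := hij
            omega)
          have hcol : FixesColumns (K : ℕ) u := by
            intro j hj
            rw [mulVec_single_eq_iff]
            exact fun i => hu1 i j (by simp only [K] at hj; omega)
          obtain ⟨y, hy, u', hu', hu'k, rfl⟩ := hcol.exists_colTransv huU
          have hyt : colTransv y K (hy K le_rfl) = nK y := by
            simp only [nK]
            congr 1
            ext i
            by_cases h : i < K
            · simp [trunc, h]
            · simp [trunc, h, hy i (not_lt.1 h)]
          rw [hyt] at hu1 huU ⊢
          rw [map_mul, Module.End.mul_apply, hequi c u' hu' hu'k, map_smul, hchar]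
          have e1 : unipotentChar ψ u' = 1 := by
            refine unipotentChar_eq_one_of fun i j hij => ?_
            rcases Nat.lt_or_ge (j : ℕ) (k + 1) with hj | hj
            · rw [mulVec_single_eq_iff.1 (hu'k j hj), if_neg]
              rintro rfl; omega
            · have h1 : (nK y * u') i j = u' i j := by
                rw [glMul_row_of_single]
                refine row_eq_single_of fun l => ?_
                simp only [nK, colTransv, transv_apply, trunc]
                rw [if_neg (show ¬ i < K by rw [Fin.lt_def]; simp only [K]; omega)]
                simp
              rw [← h1, hu1 i j (by omega), if_neg]
              rintro rfl; omega
          have e2 : c ⬝ᵥ y = 0 := by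
            rw [dotProduct, Finset.sum_eq_zero]
            intro i _
            by_cases h : i < K
            · have := congrFun hc i
              simp only [trunc, if_pos h, Pi.zero_apply] at this
              rw [this, zero_mul]
            · rw [hy i (not_lt.1 h), mul_zero]
          rw [e1, e2, AddChar.map_zero_eq_one, one_smul, one_smul]
      · -- all nontrivial characters are conjugate
        obtain ⟨g, hg, hgrow⟩ := exists_blockGroup_row (k := k) I (by simp only [I]; omega) (trunc c)
          (fun j hj => htrunc c j (Fin.le_def.2 hj)) hc
        have hz : σ g (vc c) = 0 := by
          refine ih (by omega) _ (fun u hu huk => ?_) (fun p hp' => ?_)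
          · obtain ⟨y, hy, u', hu', hu'k, rfl⟩ := FixesColumns.exists_colTransv (k := K) hu huk
            obtain ⟨h1, h2, h3⟩ := hu'k.conj_blockGroup hu' hg
            have e1 : u' * g = g * (g⁻¹ * (u' * g)) := by group
            have hginv := inv_mem hg
            set y' := Matrix.mulVec ((g⁻¹ : GL (Fin n) F) : Matrix (Fin n) (Fin n) F) y with hy'
            have hy'0 : ∀ i, K ≤ i → y' i = 0 := fun i hi => by
              rw [hy', blockGroup_mulVec hginv _ (Fin.le_def.1 hi), hy i hi]
            have hgy' : Matrix.mulVec (g : Matrix (Fin n) (Fin n) F) y' = y := by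
              simpa using glInv_mulVec (g := g⁻¹) hy'.symm
            have e2 : colTransv y K (hy K le_rfl) * g = g * nK y' := by
              have e3 : nK y' = colTransv y' K (hy'0 K le_rfl) := by
                simp only [nK]
                congr 1
                ext i
                by_cases h : i < K
                · simp [trunc, h]
                · simp [trunc, h, hy'0 i (not_lt.1 h)]
              rw [e3, mul_colTransv (hg.1 K le_rfl)]
              simp only [hgy']
            rw [← Module.End.mul_apply, ← map_mul, mul_assoc, e1, ← mul_assoc, e2, mul_assoc,
                map_mul,
              map_mul, Module.End.mul_apply, Module.End.mul_apply, hequi c _ h1 h2, h3, map_smul,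
              map_smul, hchar, map_smul, unipotentChar_mul (colTransv_mem hy) hu', mul_comm,
                  mul_smul]
            congr 2
            rw [unipotentChar_colTransv (l := I) (by simp only [I, K]; omega), ← hgy', Matrix.mulVec, hgrow]
            congr 1
            refine Finset.sum_congr rfl fun i _ => ?_
            by_cases h : i < K
            · simp [trunc, h]
            · simp [hy'0 i (not_lt.1 h)]
          · rw [rep_mul_apply]
            exact hP c _ (mul_mem hp' (blockGroup_le_mirabolic (by omega) hg))
        have h1 : σ g⁻¹ (σ g (vc c)) = vc c := by
          rw [← Module.End.mul_apply, ← map_mul, inv_mul_cancel, map_one, Module.End.one_apply]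
        rw [← h1, hz, map_zero]
    have h0 : (Fintype.card (Fin n → F) : ℂ) • v = 0 := by
      rw [← hsum]; exact Finset.sum_eq_zero fun c _ => hzero c
    exact (smul_eq_zero.1 h0).resolve_left (Nat.cast_ne_zero.2 Fintype.card_ne_zero)

end KirillovInjectivity

/-! ### Irreducible representations and multiplicity one -/

section Irreducible

variable {F : Type*} [Field F] {n : ℕ} {V : Type*} [AddCommGroup V] [Module ℂ V]
  {σ : Representation ℂ (GL (Fin n) F) V}

/-- In an irreducible representation, the orbit of a nonzero vector is contained in no proper
subspace. -/
theorem mem_of_forall_mem_orbit (hσ : σ.IsIrreducible) {x : V} (hx : x ≠ 0)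
    {M : Type*} [AddCommGroup M] [Module ℂ M] (A : V →ₗ[ℂ] M) (S : Submodule ℂ M)
    (h : ∀ g, A (σ g x) ∈ S) (v : V) : A v ∈ S := by
  let W : Subrepresentation σ :=
    { toSubmodule := Submodule.span ℂ (Set.range fun g => σ g x)
      apply_mem_toSubmodule := by
        intro g w hw
        induction hw using Submodule.span_induction with
        | mem w hw =>
          obtain ⟨g', rfl⟩ := hw
          exact Submodule.subset_span ⟨g * g', by simp only [rep_mul_apply]⟩
        | zero => simp
        | add a b _ _ ha hb => rw [map_add]; exact add_mem ha hb
        | smul c a _ ha => rw [map_smul]; exact Submodule.smul_mem _ c ha }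
  have hxW : x ∈ W.toSubmodule := Submodule.subset_span ⟨1, by simp⟩
  rcases hσ.eq_bot_or_eq_top W with hW | hW
  · rw [hW] at hxW
    exact absurd ((Submodule.mem_bot ℂ).1 hxW) hx
  · have hv : v ∈ W.toSubmodule := by rw [hW]; exact Submodule.mem_top
    induction hv using Submodule.span_induction with
    | mem w hw =>
      obtain ⟨g, rfl⟩ := hw
      exact h g
    | zero => simp
    | add a b _ _ ha hb => rw [map_add]; exact add_mem ha hb
    | smul c a _ ha => rw [map_smul]; exact Submodule.smul_mem _ c ha

theorem exists_ne_zero_of_irreducible (hσ : σ.IsIrreducible) : ∃ x : V, x ≠ 0 := by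
  by_contra h
  push Not at h
  obtain ⟨a, b, hab⟩ := hσ.exists_pair_ne
  apply hab
  ext v
  rw [h v]
  exact ⟨fun _ => b.toSubmodule.zero_mem, fun _ => a.toSubmodule.zero_mem⟩

/-- The orbit of a nonzero vector is finite and spans. -/
theorem finiteDimensional_of_irreducible [Finite F] (hσ : σ.IsIrreducible) :
    FiniteDimensional ℂ V := by
  obtain ⟨x, hx⟩ := exists_ne_zero_of_irreducible hσ
  have h : (⊤ : Submodule ℂ V) = Submodule.span ℂ (Set.range fun g => σ g x) := by
    rw [eq_comm, eq_top_iff]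
    intro v _
    exact mem_of_forall_mem_orbit hσ hx LinearMap.id
      (Submodule.span ℂ (Set.range fun g => σ g x)) (fun g => Submodule.subset_span ⟨g, rfl⟩) v
  refine Module.finite_def.2 ?_
  rw [h]
  exact Submodule.fg_span (Set.finite_range _)

end Irreducible

section MultiplicityOne

variable {F : Type*} [Field F] [Finite F] {n : ℕ} {V : Type*} [AddCommGroup V] [Module ℂ V]
  {σ : Representation ℂ (GL (Fin n) F) V} {ψ : AddChar F ℂ}

/-- The compression `e σ(g) e` of `σ(g)` to the `ψ`-equivariant vectors. -/
noncomputable def besselOp (σ : Representation ℂ (GL (Fin n) F) V) (ψ : AddChar F ℂ)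
    (g : GL (Fin n) F) : V →ₗ[ℂ] V :=
  whittakerSum σ ψ ∘ₗ σ g ∘ₗ whittakerSum σ ψ

theorem besselOp_apply (g : GL (Fin n) F) (v : V) :
    besselOp σ ψ g v = whittakerSum σ ψ (σ g (whittakerSum σ ψ v)) := rfl

theorem isBiWhittaker_besselOp : IsBiWhittaker ψ (besselOp σ ψ) := by
  constructor <;> intro u hu g <;> ext v
  · rw [besselOp_apply, ← rep_mul_apply, whittakerSum_apply_mul hu]; rfl
  · rw [besselOp_apply, ← rep_mul_apply, apply_whittakerSum hu, map_smul, map_smul]; rfl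

theorem besselOp_besselOp (g h : GL (Fin n) F) (v : V) :
    besselOp σ ψ g (besselOp σ ψ h v) = (Fintype.card (upperUnipotent F n) : ℂ) •
      ∑ u : upperUnipotent F n, (unipotentChar ψ (u :
          GL (Fin n) F))⁻¹ • besselOp σ ψ (g * u * h) v := by
  rw [besselOp_apply, besselOp_apply, whittakerSum_whittakerSum, map_smul, map_smul]
  congr 1
  rw [whittakerSum_apply σ ψ (σ h (whittakerSum σ ψ v)), map_sum, map_sum]
  refine Finset.sum_congr rfl fun u _ => ?_
  rw [map_smul, map_smul, rep_mul_apply, rep_mul_apply, besselOp_apply, mul_assoc]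

/-- The operators `e σ(g) e` commute with each other: the anti-involution `g ↦ w gᵗ w` acts
trivially on the Hecke algebra of `(U, ψ)`. -/
theorem besselOp_comm (hψ : ψ ≠ 1) (g h : GL (Fin n) F) (v : V) :
    besselOp σ ψ g (besselOp σ ψ h v) = besselOp σ ψ h (besselOp σ ψ g v) := by
  have hι := (isBiWhittaker_besselOp (σ := σ) (ψ := ψ)).antiTranspose hψ
  rw [← hι h, ← hι g, besselOp_besselOp, hι, hι, besselOp_besselOp]
  congr 1
  let e : upperUnipotent F n ≃ upperUnipotent F n :=
    { toFun := fun u => ⟨antiTranspose u, antiTranspose_mem u.2⟩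
      invFun := fun u => ⟨antiTranspose u, antiTranspose_mem u.2⟩
      left_inv := fun u => Subtype.ext (antiTranspose_antiTranspose _)
      right_inv := fun u => Subtype.ext (antiTranspose_antiTranspose _) }
  refine Fintype.sum_equiv e _ _ fun u => ?_
  change _ = (unipotentChar ψ (antiTranspose (u : GL (Fin n) F)))⁻¹ •
    besselOp σ ψ (h * antiTranspose (u : GL (Fin n) F) * g) v
  rw [unipotentChar_antiTranspose, ← hι (h * antiTranspose (u : GL (Fin n) F) * g),
    antiTranspose_mul, antiTranspose_mul, antiTranspose_antiTranspose, mul_assoc]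

/-- The `ψ`-equivariant vectors of an irreducible representation form a space of dimension at most
one. -/
theorem whittakerSum_mem_span (hψ : ψ ≠ 1) (hσ : σ.IsIrreducible) {x : V}
    (hx : whittakerSum σ ψ x ≠ 0) (v : V) : ∃ c : ℂ, whittakerSum σ ψ v = c • whittakerSum σ ψ x :=
        by
  have := finiteDimensional_of_irreducible hσ
  set E := whittakerSum σ ψ with hE
  have hcard := card_subgroup_ne_zero (upperUnipotent F n)
  have hmem : ∀ g, ∀ y ∈ LinearMap.range E, besselOp σ ψ g y ∈ LinearMap.range E :=
    fun g y _ => ⟨_, rfl⟩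
  have hEE : ∀ y ∈ LinearMap.range E, E y = (Fintype.card (upperUnipotent F n) : ℂ) • y := by
    rintro _ ⟨y, rfl⟩
    exact whittakerSum_whittakerSum y
  have : Nontrivial (LinearMap.range E) := ⟨⟨E x, x, rfl⟩, 0, fun h => hx (congrArg Subtype.val h)⟩
  -- orbits under the operators `e σ(g) e` span
  have hspan : ∀ y ∈ LinearMap.range E, y ≠ 0 → ∀ S : Submodule ℂ V,
      (∀ h, besselOp σ ψ h y ∈ S) → ∀ v, E v ∈ S := by
    intro y hy hy0 S hS
    refine mem_of_forall_mem_orbit hσ hy0 E S fun g => ?_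
    have h1 := hS g
    rw [besselOp_apply, ← hE, hEE y hy, map_smul, map_smul] at h1
    exact (Submodule.smul_mem_iff S hcard).1 h1
  -- each `e σ(g) e` acts on the range of `e` as a scalar
  have hscalar : ∀ g, ∃ c : ℂ, ∀ v, besselOp σ ψ g (E v) = c • E v := by
    intro g
    obtain ⟨c, hc⟩ := Module.End.exists_eigenvalue ((besselOp σ ψ g).restrict (hmem g))
    obtain ⟨y, hy⟩ := hc.exists_hasEigenvector
    have hyc : besselOp σ ψ g y = c • (y : V) := congrArg Subtype.val hy.apply_eq_smul
    have hy0 : (y : V) ≠ 0 := fun h => hy.2 (Subtype.ext h)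
    refine ⟨c, fun v => ?_⟩
    have h1 := hspan y y.2 hy0 (LinearMap.ker (besselOp σ ψ g - c • LinearMap.id)) (fun h => by
      rw [LinearMap.mem_ker, LinearMap.sub_apply, besselOp_comm hψ, hyc, map_smul]
      simp) v
    rw [LinearMap.mem_ker, LinearMap.sub_apply] at h1
    exact sub_eq_zero.1 h1
  have h1 := hspan (E x) ⟨x, rfl⟩ hx (Submodule.span ℂ {E x}) (fun h => by
    obtain ⟨c, hc⟩ := hscalar h
    rw [hc]
    exact Submodule.smul_mem _ c (Submodule.mem_span_singleton_self _)) v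
  obtain ⟨c, hc⟩ := Submodule.mem_span_singleton.1 h1
  exact ⟨c, hc.symm⟩

/-- Existence and uniqueness of the Whittaker functional of a cuspidal representation, together with
a dual vector `w`, and injectivity of the Kirillov model. -/
theorem exists_whittaker (hψ : ψ ≠ 1) (hσ : IsIrreducibleCuspidal σ) :
    ∃ (l : V →ₗ[ℂ] ℂ) (w : V), IsWhittakerFunctional σ ψ l ∧
      (∀ u ∈ upperUnipotent F n, σ u w = unipotentChar ψ u • w) ∧ l w = 1 ∧
      (∀ l' : V →ₗ[ℂ] ℂ, IsWhittakerFunctional σ ψ l' → ∀ v, l' v = l' w * l v) ∧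
      ∀ v, (∀ p ∈ mirabolic F n, l (σ p v) = 0) → v = 0 := by
  obtain ⟨v₀, hv₀⟩ := exists_ne_zero_of_irreducible hσ.1
  obtain ⟨x, hx⟩ : ∃ x, whittakerSum σ ψ x ≠ 0 := by
    by_contra h
    push Not at h
    exact hv₀ (eq_zero_of_whittakerSum_mirabolic hψ hσ v₀ fun p _ => h _)
  have hcard := card_subgroup_ne_zero (upperUnipotent F n)
  obtain ⟨f, hf⟩ : ∃ f : V →ₗ[ℂ] ℂ, f (whittakerSum σ ψ x) ≠ 0 := by
    by_contra h
    push Not at h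
    exact hx ((Module.forall_dual_apply_eq_zero_iff ℂ _).1 h)
  set N : ℂ := (Fintype.card (upperUnipotent F n) : ℂ)
  let w := (f (whittakerSum σ ψ x))⁻¹ • whittakerSum σ ψ x
  have hw : ∀ u ∈ upperUnipotent F n, σ u w = unipotentChar ψ u • w := by
    intro u hu
    simp only [w]
    rw [map_smul, apply_whittakerSum hu, smul_comm]
  have hfw : f w = 1 := by simp only [w]; rw [map_smul, smul_eq_mul, inv_mul_cancel₀ hf]
  let l : V →ₗ[ℂ] ℂ := N⁻¹ • (f ∘ₗ whittakerSum σ ψ)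
  have hl : ∀ v, whittakerSum σ ψ v = (N * l v) • w := by
    intro v
    obtain ⟨c, hc⟩ := whittakerSum_mem_span hψ hσ.1 hx v
    have h1 : whittakerSum σ ψ v = (c * f (whittakerSum σ ψ x)) • w := by
      simp only [w]
      rw [hc, smul_smul, mul_assoc, mul_inv_cancel₀ hf, mul_one]
    have h2 : N * l v = f (whittakerSum σ ψ v) := by
      simp only [l, LinearMap.smul_apply, LinearMap.comp_apply, smul_eq_mul]
      rw [mul_inv_cancel_left₀ hcard]
    rw [h2, h1, map_smul, hfw, smul_eq_mul, mul_one]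
  have hlw : l w = 1 := by
    simp only [l, LinearMap.smul_apply, LinearMap.comp_apply, smul_eq_mul]
    rw [whittakerSum_of_equivariant hw, map_smul, hfw, smul_eq_mul, mul_one, inv_mul_cancel₀ hcard]
  refine ⟨l, w, fun u hu v => ?_, hw, hlw, fun l' hl' v => ?_, fun v hv => ?_⟩
  · simp only [l, LinearMap.smul_apply, LinearMap.comp_apply, smul_eq_mul]
    rw [whittakerSum_apply_mul hu, map_smul, smul_eq_mul, mul_left_comm]
  · have h1 : l' (whittakerSum σ ψ v) = N * l' v := by
      rw [whittakerSum_apply, map_sum, Finset.sum_congr rfl (g := fun _ => l' v)]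
      · simp [N]
      · intro u _
        rw [map_smul, hl' u u.2, smul_eq_mul, inv_mul_cancel_left₀ (unipotentChar_ne_zero u.2)]
    rw [hl, map_smul, smul_eq_mul, mul_assoc] at h1
    rw [← mul_left_cancel₀ hcard h1, mul_comm]
  · refine eq_zero_of_whittakerSum_mirabolic hψ hσ v fun p hp => ?_
    rw [hl, hv p hp, mul_zero, zero_smul]

end MultiplicityOne

/-! ### Supports of equivariant functions on the mirabolic subgroup -/

section Support

variable {F : Type*} [Field F] {n : ℕ}

/-- An element of `diag(GL_{k+1}, 1)` with row `k` equal to `e_k` lies in `U · diag(GL_k, 1)`. -/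
theorem exists_eq_mul_of_row {k : Fin n} {g : GL (Fin n) F} (hg : g ∈ blockGroup ((k : ℕ) + 1))
    (hk : g k = Pi.single k 1) :
    ∃ u ∈ upperUnipotent F n, ∃ g' ∈ blockGroup (k : ℕ), g = u * g' := by
  let y : Fin n → F := fun i => if i < k then g i k else 0
  have hy : ∀ i, k ≤ i → y i = 0 := fun i hi => if_neg (not_lt.2 hi)
  refine ⟨colTransv y k (hy k le_rfl), colTransv_mem hy,
    (colTransv y k (hy k le_rfl))⁻¹ * g, ?_, by group⟩
  have hrow : ∀ i j, ((colTransv y k (hy k le_rfl))⁻¹ * g) i j =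
      g i j - y i * (Pi.single k 1 : Fin n → F) j := by
    intro i j
    rw [colTransv_inv, colTransv, transv_mul_row, single_vecMul, hk]
    simp [sub_eq_add_neg]
  rw [mem_blockGroup]
  intro i j hij
  rw [hrow]
  by_cases hj : j = k
  · subst hj
    rw [Pi.single_eq_same, mul_one]
    rcases lt_trichotomy i j with h | h | h
    · simp [y, h, h.ne]
    · subst h; rw [hk, hy i le_rfl]; simp
    · rw [hy i h.le, blockGroup_apply hg (Or.inl (by rw [Fin.lt_def] at h; omega)), sub_zero]
  · rw [Pi.single_eq_of_ne hj, mul_zero, sub_zero]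
    by_cases hi : i = k
    · subst hi; rw [hk, Pi.single_apply]; simp [eq_comm]
    · rw [blockGroup_apply hg]
      have h1 : (i : ℕ) ≠ k := fun h => hi (Fin.ext h)
      have h2 : (j : ℕ) ≠ k := fun h => hj (Fin.ext h)
      omega

/-- The same as `exists_eq_mul_of_row`, with the unipotent factor on the right. -/
theorem exists_eq_mul_of_row' {k : Fin n} {g : GL (Fin n) F} (hg : g ∈ blockGroup ((k : ℕ) + 1))
    (hk : g k = Pi.single k 1) :
    ∃ g' ∈ blockGroup (k : ℕ), ∃ u ∈ upperUnipotent F n, g = g' * u := by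
  obtain ⟨u, hu, g', hg', h⟩ := exists_eq_mul_of_row (inv_mem hg) (glInv_row_of_single hk)
  exact ⟨g'⁻¹, inv_mem hg', u⁻¹, inv_mem hu, by rw [← mul_inv_rev, ← h, inv_inv]⟩

variable {ψ : AddChar F ℂ}

/-- A left `ψ`-equivariant function on the mirabolic subgroup that is right `ψ`-equivariant under
the columns of `U` after the `r`-th is supported on `U · diag(GL_r, 1)`. -/
theorem exists_eq_mul_blockGroup (hψ : ψ ≠ 1) {r : ℕ} (hrn : r < n) {b : GL (Fin n) F → ℂ}
    (hl : ∀ u ∈ upperUnipotent F n, ∀ g, b (u * g) = unipotentChar ψ u * b g)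
    (hr : ∀ (K I : Fin n), (I : ℕ) + 1 = K → r < (K : ℕ) → ∀ (y : Fin n → F)
      (hy : ∀ i, K ≤ i → y i = 0), ∀ p ∈ mirabolic F n,
        b (p * colTransv y K (hy K le_rfl)) = ψ (y I) * b p)
    {p : GL (Fin n) F} (hp : p ∈ mirabolic F n) (hbp : b p ≠ 0) :
    ∃ u ∈ upperUnipotent F n, ∃ g ∈ blockGroup r, p = u * g := by
  -- peel off the columns from the last one; nontriviality of `ψ` forces row `k` to be `e_k`
  suffices H : ∀ d k : ℕ, k + d + 1 = n → r ≤ k →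
      ∃ u ∈ upperUnipotent F n, ∃ g ∈ blockGroup k, p = u * g from
    H (n - 1 - r) r (by omega) le_rfl
  intro d
  induction d with
  | zero =>
    intro k hk _
    exact exists_eq_mul_of_row (k := ⟨k, by omega⟩) (mem_blockGroup.2 fun i j h => by
      have := i.2; have := j.2; simp only at h; omega) (hp _ (by simp only; omega))
  | succ d ih =>
    intro k hk hrk
    obtain ⟨u, hu, g, hg, rfl⟩ := ih (k + 1) (by omega) (by omega)
    have hbg : b g ≠ 0 := fun h => hbp (by rw [hl u hu, h, mul_zero])
    let I : Fin n := ⟨k, by omega⟩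
    let K : Fin n := ⟨k + 1, by omega⟩
    have hrow : g I = Pi.single I 1 := by
      refine row_eq_single_of fun j => ?_
      rcases Nat.lt_or_ge k (j : ℕ) with hj | hj
      · exact blockGroup_apply hg (Or.inr hj)
      · suffices h : g I j = (Pi.single I 1 : Fin n → F) j by
          rw [h, Pi.single_apply]; simp [eq_comm]
        refine eq_of_addChar_mul_eq hψ fun t => ?_
        have hy : ∀ i, K ≤ i → (Pi.single j t : Fin n → F) i = 0 := by
          intro i hi
          refine Pi.single_eq_of_ne ?_ _
          rintro rfl
          have : k + 1 ≤ (i : ℕ) := hi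
          omega
        have h1 := hr K I rfl (by simp only [K]; omega) _ hy g
          (blockGroup_le_mirabolic (by omega) hg)
        rw [mul_colTransv (hg.1 K le_rfl), hl _ (colTransv_mem fun i hi => by
          rw [blockGroup_mulVec hg _ hi, hy i hi]), unipotentChar_colTransv (l := I) rfl] at h1
        have h2 := mul_right_cancel₀ hbg h1
        rw [Matrix.mulVec, dotProduct_single, mul_comm] at h2
        rw [show (g : Matrix (Fin n) (Fin n) F) I j = g I j from rfl] at h2
        rw [h2]
        congr 1
        by_cases hjI : j = I
        · subst hjI; simp
        · simp [hjI, Ne.symm hjI]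
    obtain ⟨u', hu', g', hg', rfl⟩ := exists_eq_mul_of_row (k := I) hg hrow
    exact ⟨u * u', mul_mem hu hu', g', hg', by rw [mul_assoc]⟩

/-- A right `ψ`-equivariant function that is left equivariant under the unipotent radical of the
parabolic of type `(r, 1, …, 1)`, up to the opposite of its first block, vanishes on the mirabolic
subgroup as soon as it vanishes on `diag(GL_r, 1)`. -/
theorem eq_zero_of_blockGroup (hψ : ψ ≠ 1) {r : ℕ} (hrn : r < n) {b : GL (Fin n) F → ℂ}
    (hr : ∀ u ∈ upperUnipotent F n, ∀ g, b (g * u) = unipotentChar ψ u * b g)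
    (hl : ∀ (K I : Fin n), (I : ℕ) + 1 = K → r < (K : ℕ) → ∀ (y : Fin n → F)
      (hy : ∀ i, K ≤ i → y i = 0), (∀ i : Fin n, (i : ℕ) < r → y i = 0) → ∀ g,
        b (colTransv y K (hy K le_rfl) * g) = ψ (y I) * b g)
    (hl' : ∀ (k : Fin n), r ≤ (k : ℕ) → (k : ℕ) + 1 < n → ∀ (ρ : Fin n → F)
      (h : ρ ⬝ᵥ Pi.single k 1 = 0), (∀ i : Fin n, r ≤ (i : ℕ) → ρ i = 0) → ∀ g,
        b (transv (Pi.single k 1) ρ h * g) = b g)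
    (hb : ∀ g ∈ blockGroup r, b g = 0) {p : GL (Fin n) F} (hp : p ∈ mirabolic F n) : b p = 0 := by
  have H : ∀ k : ℕ, r ≤ k → k < n → ∀ g ∈ blockGroup k, b g = 0 := by
    intro k hrk
    induction k, hrk using Nat.le_induction with
    | base => exact fun _ => hb
    | succ k hrk ih =>
      intro hkn g hg
      by_contra hbg
      let I : Fin n := ⟨k, by omega⟩
      let K : Fin n := ⟨k + 1, by omega⟩
      have hrow : ∀ j : Fin n, r ≤ (j : ℕ) →
          (g⁻¹ : GL (Fin n) F) I j = (Pi.single I 1 : Fin n → F) j := by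
        intro j hrj
        rcases Nat.lt_or_ge k (j : ℕ) with hj | hj
        · rw [blockGroup_apply (inv_mem hg) (Or.inr hj), Pi.single_apply]; simp [eq_comm]
        · refine eq_of_addChar_mul_eq hψ fun t => ?_
          have hz : ∀ i, K ≤ i → (Pi.single j t : Fin n → F) i = 0 := by
            intro i hi
            refine Pi.single_eq_of_ne ?_ _
            rintro rfl
            have : k + 1 ≤ (i : ℕ) := hi
            omega
          have hz' : ∀ i : Fin n, (i : ℕ) < r → (Pi.single j t : Fin n → F) i = 0 := by
            intro i hi
            refine Pi.single_eq_of_ne ?_ _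
            rintro rfl
            omega
          -- `z = e_j t` is the image under `g` of `g⁻¹ z`
          have h1 := hl K I rfl (by simp only [K]; omega) _ hz hz' g
          have h2 : g⁻¹ * colTransv (Pi.single j t) K (hz K le_rfl) = _ :=
            mul_colTransv ((inv_mem hg).1 K le_rfl) _ (hz K le_rfl)
          have h3 : colTransv (Pi.single j t) K (hz K le_rfl) * g =
              g * colTransv (Matrix.mulVec ((g⁻¹ : GL (Fin n) F) : Matrix (Fin n) (Fin n) F)
                (Pi.single j t)) K (by rw [blockGroup_mulVec (inv_mem hg) _ le_rfl, hz K le_rfl]) :=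
                    by
            rw [← inv_mul_eq_iff_eq_mul, ← mul_assoc, h2]; group
          rw [h3, hr _ (colTransv_mem fun i hi => by
            rw [blockGroup_mulVec (inv_mem hg) _ hi, hz i hi]),
            unipotentChar_colTransv (l := I) rfl] at h1
          have h2 := mul_right_cancel₀ hbg h1
          rw [Matrix.mulVec, dotProduct_single, mul_comm] at h2
          refine h2.trans ?_
          congr 1
          by_cases hjI : j = I
          · subst hjI; simp
          · simp [hjI, Ne.symm hjI]
      -- a left transvection, which does not change `b`, removes the remaining entries of row `k`
      let ρ : Fin n → F := (g⁻¹ : GL (Fin n) F) I - Pi.single I 1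
      have hρ : ∀ i : Fin n, r ≤ (i : ℕ) → ρ i = 0 := fun i hi => by
        simp only [ρ, Pi.sub_apply]; rw [hrow i hi, sub_self]
      have hρI : ρ ⬝ᵥ Pi.single I 1 = 0 := by rw [dotProduct_single_one, hρ I hrk]
      have h1 : b (transv (Pi.single I 1) ρ hρI * g) = b g := hl' I hrk hkn ρ hρI hρ g
      have h2 : (transv (Pi.single I 1) ρ hρI * g) I = Pi.single I 1 := by
        rw [transv_mul_row, Pi.single_eq_same, one_smul]
        simp only [ρ]
        rw [Matrix.sub_vecMul, ← glMul_row, single_vecMul, inv_mul_cancel, glOne_row]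
        abel
      have h3 : transv (Pi.single I 1) ρ hρI ∈ blockGroup (k + 1) := by
        rw [mem_blockGroup]
        intro i j hij
        rw [transv_apply, add_eq_left]
        rcases hij with hi | hj
        · rw [Pi.single_eq_of_ne, zero_mul]
          rintro rfl; simp only [I] at hi; omega
        · rw [hρ j (by omega), mul_zero]
      obtain ⟨g', hg', u, hu, h⟩ := exists_eq_mul_of_row' (k := I) (mul_mem h3 hg) h2
      rw [h, hr u hu, ih (by omega) g' hg', mul_zero] at h1
      exact hbg h1.symm
  obtain ⟨g, hg, u, hu, rfl⟩ := exists_eq_mul_of_row' (k := ⟨n - 1, by omega⟩) (g := p)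
    (mem_blockGroup.2 fun i j h => by have := i.2; have := j.2; simp only at h; omega)
    (hp _ (by simp only; omega))
  rw [hr u hu, H (n - 1) (by omega) (by omega) g hg, mul_zero]

end Support

/-! ### Bessel functions -/

section Bessel

variable {F : Type*} [Field F] {n : ℕ}

theorem sum_subgroup_eq_sum_ite [Finite F] (H : Subgroup (GL (Fin n) F)) (f : GL (Fin n) F → ℂ) :
    ∑ x : H, f x = ∑ g, open Classical in if g ∈ H then f g else 0 := by
  classical
  rw [← Finset.sum_filter]
  exact (Finset.sum_subtype _ (fun x => by simp) f).symm

theorem sum_subgroup_eq_of_le [Finite F] {H K : Subgroup (GL (Fin n) F)} (hHK : H ≤ K)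
    {f : GL (Fin n) F → ℂ} (hf : ∀ x ∈ K, x ∉ H → f x = 0) : ∑ x : K, f x = ∑ x : H, f x := by
  classical
  rw [sum_subgroup_eq_sum_ite, sum_subgroup_eq_sum_ite]
  refine Finset.sum_congr rfl fun x _ => ?_
  by_cases hx : x ∈ H
  · simp [hx, hHK hx]
  · by_cases hx' : x ∈ K <;> simp [hx, hx', hf x]

theorem eq_one_of_mem_blockGroup_zero {g : GL (Fin n) F} (hg : g ∈ blockGroup 0) : g = 1 := by
  ext i j
  rw [mem_blockGroup.1 hg i j (Or.inl (Nat.zero_le _)), Units.val_one, Matrix.one_apply]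

variable {V : Type*} [AddCommGroup V] [Module ℂ V]

/-- A Whittaker functional `l` and a `ψ`-equivariant vector `w` with `l w = 1`, such that `l` spans
the space of Whittaker functionals and the Kirillov model `v ↦ (p ↦ l (σ(p) v))` is injective. -/
structure IsWhittakerPair (σ : Representation ℂ (GL (Fin n) F) V) (ψ : AddChar F ℂ)
    (l : V →ₗ[ℂ] ℂ) (w : V) : Prop where
  functional : IsWhittakerFunctional σ ψ l
  vector : ∀ u ∈ upperUnipotent F n, σ u w = unipotentChar ψ u • w
  apply_eq_one : l w = 1
  unique : ∀ l' : V →ₗ[ℂ] ℂ, IsWhittakerFunctional σ ψ l' → ∀ v, l' v = l' w * l v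
  kirillov : ∀ v, (∀ p ∈ mirabolic F n, l (σ p v) = 0) → v = 0

/-- The Bessel function `g ↦ l (σ(g) w)`. -/
def bessel (σ : Representation ℂ (GL (Fin n) F) V) (l : V →ₗ[ℂ] ℂ) (w : V) (g : GL (Fin n) F) : ℂ :=
  l (σ g w)

variable {σ : Representation ℂ (GL (Fin n) F) V} {ψ : AddChar F ℂ} {l : V →ₗ[ℂ] ℂ} {w : V}

theorem exists_isWhittakerPair [Finite F] (hψ : ψ ≠ 1) (hσ : IsIrreducibleCuspidal σ) :
    ∃ l w, IsWhittakerPair σ ψ l w := by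
  obtain ⟨l, w, h1, h2, h3, h4, h5⟩ := exists_whittaker hψ hσ
  exact ⟨l, w, h1, h2, h3, h4, h5⟩

namespace IsWhittakerPair

theorem bessel_mul_left (h : IsWhittakerPair σ ψ l w) {u : GL (Fin n) F}
    (hu : u ∈ upperUnipotent F n) (g : GL (Fin n) F) :
    bessel σ l w (u * g) = unipotentChar ψ u * bessel σ l w g := by
  rw [bessel, ← rep_mul_apply, h.functional u hu]; rfl

theorem bessel_mul_right (h : IsWhittakerPair σ ψ l w) {u : GL (Fin n) F}
    (hu : u ∈ upperUnipotent F n) (g : GL (Fin n) F) :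
    bessel σ l w (g * u) = unipotentChar ψ u * bessel σ l w g := by
  rw [bessel, ← rep_mul_apply, h.vector u hu, map_smul, map_smul]; rfl

theorem bessel_one (h : IsWhittakerPair σ ψ l w) : bessel σ l w 1 = 1 := by
  rw [bessel, map_one, Module.End.one_apply, h.apply_eq_one]

theorem bessel_of_mem (h : IsWhittakerPair σ ψ l w) {u : GL (Fin n) F}
    (hu : u ∈ upperUnipotent F n) : bessel σ l w u = unipotentChar ψ u := by
  rw [← mul_one u, h.bessel_mul_left hu, h.bessel_one, mul_one, mul_one]

/-- On the mirabolic subgroup the Bessel function is supported on `U`. -/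
theorem bessel_mirabolic (hψ : ψ ≠ 1) (hn : 0 < n) (h : IsWhittakerPair σ ψ l w)
    {p : GL (Fin n) F} (hp : p ∈ mirabolic F n) (hpU : p ∉ upperUnipotent F n) :
    bessel σ l w p = 0 := by
  by_contra hJ
  obtain ⟨u, hu, g, hg, rfl⟩ := exists_eq_mul_blockGroup hψ hn (b := bessel σ l w)
    (fun u hu g => h.bessel_mul_left hu g)
    (fun K I hIK _ y hy p _ => by
      rw [h.bessel_mul_right (colTransv_mem hy), unipotentChar_colTransv hIK]) hp hJ
  rw [eq_one_of_mem_blockGroup_zero hg, mul_one] at hpU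
  exact hpU hu

theorem bessel_center {ω : Subgroup.center (GL (Fin n) F) →* ℂˣ} (hω : HasCentralCharacter σ ω)
    (z : Subgroup.center (GL (Fin n) F)) (g : GL (Fin n) F) :
    bessel σ l w (z * g) = ω z * bessel σ l w g := by
  rw [bessel, ← rep_mul_apply, hω, map_smul, smul_eq_mul]; rfl

variable [Finite F]

/-- The Bessel function is a reproducing kernel for the Whittaker model. -/
theorem apply_eq_sum (hψ : ψ ≠ 1) (hn : 0 < n) (h : IsWhittakerPair σ ψ l w) (g : GL (Fin n) F)
    (v : V) : l (σ g v) = (Fintype.card (upperUnipotent F n) : ℂ)⁻¹ *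
      ∑ p : mirabolic F n, l (σ p v) * bessel σ l w (g * (p : GL (Fin n) F)⁻¹) := by
  have hcard := card_subgroup_ne_zero (upperUnipotent F n)
  set N : ℂ := (Fintype.card (upperUnipotent F n) : ℂ)
  let v' : V := N⁻¹ • ∑ p : mirabolic F n, l (σ p v) • σ (p : GL (Fin n) F)⁻¹ w
  have hv' : ∀ g, l (σ g v') = N⁻¹ * ∑ p : mirabolic F n, l (σ p v) *
      bessel σ l w (g * (p : GL (Fin n) F)⁻¹) := by
    intro g
    simp only [v']
    rw [map_smul, map_smul, map_sum, map_sum, smul_eq_mul]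
    congr 1
    refine Finset.sum_congr rfl fun p _ => ?_
    rw [map_smul, map_smul, rep_mul_apply]; rfl
  suffices hv : v - v' = 0 by rw [← hv' g, ← sub_eq_zero, ← map_sub, ← map_sub, hv, map_zero,
      map_zero]
  -- both sides agree on the mirabolic subgroup, where `J` is supported on `U`
  refine h.kirillov _ fun q hq => ?_
  rw [map_sub, map_sub, hv', sub_eq_zero,
    ← sum_subgroup_mul_right _ (fun p => l (σ p v) * bessel σ l w (q * p⁻¹)) hq,
    sum_subgroup_eq_of_le upperUnipotent_le_mirabolic
      (f := fun p => l (σ (p * q) v) * bessel σ l w (q * (p * q)⁻¹)),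
    Finset.sum_congr rfl (g := fun _ => l (σ q v))]
  · simp only [Finset.sum_const, Finset.card_univ, nsmul_eq_mul]
    rw [inv_mul_cancel_left₀ hcard]
  · intro u _
    rw [mul_inv_rev, mul_inv_cancel_left, h.bessel_of_mem (inv_mem u.2), unipotentChar_inv u.2,
      ← rep_mul_apply, h.functional _ u.2, mul_right_comm,
          mul_inv_cancel₀ (unipotentChar_ne_zero u.2),
      one_mul]
  · intro p hp hpU
    rw [mul_inv_rev, mul_inv_cancel_left, h.bessel_mirabolic hψ hn (inv_mem hp) fun hp' =>
      hpU (by simpa using inv_mem hp'), mul_zero]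

/-- The Bessel function of a product as a convolution over the mirabolic subgroup. Only values
of the form `J(p g')` and `J(g p⁻¹)` with `p` mirabolic enter, which is what makes two vanishing
rows combine. -/
theorem bessel_mul (hψ : ψ ≠ 1) (hn : 0 < n) (h : IsWhittakerPair σ ψ l w) (g g' : GL (Fin n) F) :
    bessel σ l w (g * g') = (Fintype.card (upperUnipotent F n) : ℂ)⁻¹ *
      ∑ p : mirabolic F n, bessel σ l w (p * g') * bessel σ l w (g * (p : GL (Fin n) F)⁻¹) := by
  rw [bessel, ← rep_mul_apply, h.apply_eq_sum hψ hn]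
  refine congrArg _ (Finset.sum_congr rfl fun p _ => ?_)
  rw [rep_mul_apply]; rfl

/-- The functional `∑ x, conj J(x) • l ∘ σ(x)` is again a Whittaker functional, hence a multiple
of `l`; so `c J(g) = ∑ x, conj J(x) J(x g)` with a constant `c > 0`, and the right side is
conjugated when `g` is replaced by its inverse. -/
theorem bessel_inv (h : IsWhittakerPair σ ψ l w) (g : GL (Fin n) F) :
    bessel σ l w g⁻¹ = starRingEnd ℂ (bessel σ l w g) := by
  let l' : V →ₗ[ℂ] ℂ := ∑ x : GL (Fin n) F, starRingEnd ℂ (bessel σ l w x) • l ∘ₗ σ x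
  have hl' : ∀ v, l' v = ∑ x : GL (Fin n) F, starRingEnd ℂ (bessel σ l w x) * l (σ x v) := by
    intro v
    simp [l', LinearMap.sum_apply]
  have hW : IsWhittakerFunctional σ ψ l' := by
    intro u hu v
    rw [hl', hl', Finset.mul_sum, ← Equiv.sum_comp (Equiv.mulRight u)
      (fun x => unipotentChar ψ u * _)]
    refine Finset.sum_congr rfl fun x _ => ?_
    rw [Equiv.coe_mulRight, h.bessel_mul_right hu, map_mul, unipotentChar_inv_conj, rep_mul_apply,
      mul_assoc, mul_inv_cancel_left₀ (unipotentChar_ne_zero hu)]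
  let c : ℝ := ∑ x : GL (Fin n) F, Complex.normSq (bessel σ l w x)
  have hc : l' w = c := by
    rw [hl']
    simp only [c, Complex.ofReal_sum]
    refine Finset.sum_congr rfl fun x _ => ?_
    rw [Complex.normSq_eq_conj_mul_self]; rfl
  have hc0 : (c : ℂ) ≠ 0 := by
    rw [Complex.ofReal_ne_zero]
    refine (lt_of_lt_of_le one_pos ?_).ne'
    refine le_trans (le_of_eq ?_) (Finset.single_le_sum (f :=
        fun x => Complex.normSq (bessel σ l w x))
      (fun x _ => Complex.normSq_nonneg _) (Finset.mem_univ 1))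
    rw [h.bessel_one, map_one]
  have key : ∀ g, c * bessel σ l w g =
      ∑ x : GL (Fin n) F, starRingEnd ℂ (bessel σ l w x) * bessel σ l w (x * g) := by
    intro g
    rw [bessel, ← hc, ← h.unique l' hW, hl']
    refine Finset.sum_congr rfl fun x _ => ?_
    rw [rep_mul_apply]; rfl
  refine mul_left_cancel₀ hc0 ?_
  rw [key]
  have h1 := congrArg (starRingEnd ℂ) (key g)
  rw [map_mul, Complex.conj_ofReal, map_sum] at h1
  rw [h1, ← Equiv.sum_comp (Equiv.mulRight g)]
  refine Finset.sum_congr rfl fun x _ => ?_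
  rw [Equiv.coe_mulRight, mul_inv_cancel_right, map_mul, Complex.conj_conj, mul_comm]

end IsWhittakerPair

end Bessel

/-! ### Rotations and block embeddings -/

section Rotation

variable {F : Type*} [Field F] {n : ℕ}

/-- The rotation `i ↦ i + r` modulo `n`, for `r ≤ n`. -/
def rotation (n r : ℕ) (hr : r ≤ n) : Equiv.Perm (Fin n) where
  toFun i := ⟨if (i : ℕ) + r < n then i + r else i + r - n, by have := i.2; split_ifs <;> omega⟩
  invFun i := ⟨if r ≤ (i : ℕ) then i - r else i + n - r, by have := i.2; split_ifs <;> omega⟩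
  left_inv i := by
    have := i.2
    ext
    dsimp only
    split_ifs <;> omega
  right_inv i := by
    have := i.2
    ext
    dsimp only
    split_ifs <;> omega

theorem rotation_apply {r : ℕ} (hr : r ≤ n) (i : Fin n) :
    (rotation n r hr i : ℕ) = if (i : ℕ) + r < n then (i : ℕ) + r else i + r - n := rfl

theorem permGL_conj_apply (π : Equiv.Perm (Fin n)) (g : GL (Fin n) F) (i j : Fin n) :
    (permGL π * g * (permGL π)⁻¹ : GL (Fin n) F) i j = g (π i) (π j) := by
  rw [mul_assoc, permGL_mul_row, glMul_row]
  have h : (permGL π : GL (Fin n) F)⁻¹ = permGL π.symm := by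
    rw [inv_eq_iff_mul_eq_one, permGL_mul]
    ext i j
    rw [permGL_row, Pi.single_apply, Units.val_one, Matrix.one_apply]
    simp [eq_comm]
  rw [h]
  have h2 := congrFun (vecMul_permGL (F := F) π.symm fun j => g (π i) (π j)) j
  simpa using h2

/-- Conjugation by a rotation exchanges the two blocks of a block diagonal element of `U`. -/
theorem rotation_conj_mem {r : ℕ} (hr : r ≤ n) {v : GL (Fin n) F} (hv : v ∈ upperUnipotent F n)
    (hvr : ∀ i j : Fin n, (i : ℕ) < r → r ≤ (j : ℕ) → v i j = 0) :
    permGL (rotation n r hr) * v * (permGL (rotation n r hr))⁻¹ ∈ upperUnipotent F n ∧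
      ∀ ψ : AddChar F ℂ, unipotentChar ψ (permGL (rotation n r hr) * v *
        (permGL (rotation n r hr))⁻¹) = unipotentChar ψ v := by
  refine ⟨fun i j hij => ?_, fun ψ => ?_⟩
  · have hij' : ¬ (i : ℕ) < j := hij
    rw [permGL_conj_apply]
    have := i.2
    have := j.2
    by_cases h : (rotation n r hr i : ℕ) < rotation n r hr j
    · rw [hvr, if_neg]
      · rintro rfl; omega
      · rw [rotation_apply] at h ⊢
        rw [rotation_apply] at h
        split_ifs at h ⊢ <;> omega
      · rw [rotation_apply, rotation_apply] at h
        rw [rotation_apply]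
        split_ifs at h ⊢ <;> omega
    · rw [hv _ _ h]
      simp
  · rw [unipotentChar_eq, unipotentChar_eq, superdiagSum, superdiagSum]
    congr 1
    refine Eq.trans ?_ (Equiv.sum_comp (rotation n r hr) _)
    refine Finset.sum_congr rfl fun i _ => ?_
    have hi := i.2
    have hri := rotation_apply hr i
    by_cases h1 : (i : ℕ) + 1 < n
    · have hri' := rotation_apply hr ⟨i + 1, h1⟩
      rw [dif_pos h1, permGL_conj_apply]
      simp only at hri'
      by_cases h2 : (i : ℕ) + 1 + r = n
      · rw [dif_neg (by split_ifs at hri <;> omega), hv, if_neg]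
        · rw [EmbeddingLike.apply_eq_iff_eq]
          intro h
          have := congrArg Fin.val h
          simp at this
        · simp only
          split_ifs at hri hri' <;> omega
      · have h3 : (rotation n r hr i : ℕ) + 1 < n := by split_ifs at hri <;> omega
        rw [dif_pos h3]
        have e : rotation n r hr ⟨i + 1, h1⟩ = ⟨rotation n r hr i + 1, h3⟩ := by
          ext
          simp only
          split_ifs at hri hri' <;> omega
        rw [e]
    · rw [dif_neg h1]
      split_ifs with h2
      · rw [hvr]
        · split_ifs at hri <;> omega
        · simp only
          split_ifs at hri <;> omega
      · rfl

end Rotation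

section ShortRadical

/-- The group of matrices `[1, (0 | x); 0, 1]` with diagonal blocks of sizes `m` and `n - m`. -/
def shortRadical (F : Type*) [Field F] (n m : ℕ) : Subgroup (GL (Fin n) F) :=
  patternGroup (fun i j => (i : ℕ) < m ∧ m < (j : ℕ)) (fun i j k h h' => by omega)
    fun i h => by omega

theorem mem_shortRadical {F : Type*} [Field F] {n m : ℕ} {z : GL (Fin n) F} :
    z ∈ shortRadical F n m ↔
    ∀ i j : Fin n, ¬ ((i : ℕ) < m ∧ m < (j : ℕ)) → z i j = if i = j then 1 else 0 := Iff.rfl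

end ShortRadical

section Embedding

variable {F : Type*} [Field F] {n m : ℕ} (hmn : m < n)

theorem splitFirst_inl (a : Fin m) : (splitFirst hmn (Sum.inl a) : ℕ) = a := by simp [splitFirst]

theorem splitFirst_inr (a : Fin (n - m - 1 + 1)) : (splitFirst hmn (Sum.inr a) : ℕ) = m + a := by
  simp [splitFirst]

theorem splitLast_inl (a : Fin (n - m - 1 + 1)) : (splitLast hmn (Sum.inl a) : ℕ) = a := by
  simp [splitLast]

theorem splitLast_inr (a : Fin m) : (splitLast hmn (Sum.inr a) : ℕ) = n - m + a := by
  simp [splitLast]; omega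

theorem diagEmbed_apply (h : GL (Fin m) F) (s t : Fin m ⊕ Fin (n - m - 1 + 1)) :
    diagEmbed hmn h (splitFirst hmn s) (splitFirst hmn t) =
      Matrix.fromBlocks (h : Matrix (Fin m) (Fin m) F) 0 0 1 s t := by
  change Matrix.reindex _ _ _ _ _ = _
  simp

theorem antiEmbed_apply (h : GL (Fin m) F) (x : Matrix (Fin m) (Fin (n - m - 1)) F)
    (s : Fin (n - m - 1 + 1) ⊕ Fin m) (t : Fin m ⊕ Fin (n - m - 1 + 1)) :
    antiEmbed hmn h x (splitLast hmn s) (splitFirst hmn t) =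
      Matrix.fromBlocks 0 1 (h : Matrix (Fin m) (Fin m) F) (padZero x) s t := by
  change Matrix.reindex _ _ _ _ _ = _
  simp

theorem diagEmbed_apply_castLE (h : GL (Fin m) F) (i j : Fin m) :
    diagEmbed hmn h (i.castLE hmn.le) (j.castLE hmn.le) = h i j := by
  have e : ∀ i : Fin m, i.castLE hmn.le = splitFirst hmn (Sum.inl i) := fun i => by
    ext; rw [splitFirst_inl]; rfl
  rw [e, e, diagEmbed_apply]; rfl

theorem diagEmbed_mem (h : GL (Fin m) F) : diagEmbed hmn h ∈ blockGroup m := by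
  rw [mem_blockGroup]
  intro i j hij
  obtain ⟨s, rfl⟩ := (splitFirst hmn).surjective i
  obtain ⟨t, rfl⟩ := (splitFirst hmn).surjective j
  rw [diagEmbed_apply]
  simp only [EmbeddingLike.apply_eq_iff_eq]
  rcases s with s | s <;> rcases t with t | t
  · rw [splitFirst_inl, splitFirst_inl] at hij
    have := s.2
    have := t.2
    omega
  · simp
  · simp
  · simp [Matrix.one_apply]

theorem diagEmbed_mul (h h' : GL (Fin m) F) :
    diagEmbed hmn (h * h') = diagEmbed hmn h * diagEmbed hmn h' := by
  refine Units.ext ?_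
  simp [diagEmbed, Matrix.reindex_apply, Matrix.submatrix_mul_equiv, Matrix.fromBlocks_multiply]

theorem diagEmbed_one : diagEmbed hmn (1 : GL (Fin m) F) = 1 := by
  refine Units.ext ?_
  simp [diagEmbed, Matrix.reindex_apply]

theorem diagEmbed_inv (h : GL (Fin m) F) : diagEmbed hmn h⁻¹ = (diagEmbed hmn h)⁻¹ := by
  rw [eq_inv_iff_mul_eq_one, ← diagEmbed_mul, inv_mul_cancel, diagEmbed_one]

theorem exists_diagEmbed_eq {g : GL (Fin n) F} (hg : g ∈ blockGroup m) :
    ∃ h, diagEmbed hmn h = g := by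
  let A : Matrix (Fin m) (Fin m) F := fun i j => g (splitFirst hmn (Sum.inl i))
      (splitFirst hmn (Sum.inl j))
  have hA : (g : Matrix (Fin n) (Fin n) F) = Matrix.reindex (splitFirst hmn) (splitFirst hmn)
      (Matrix.fromBlocks A 0 0 1) := by
    ext i j
    obtain ⟨s, rfl⟩ := (splitFirst hmn).surjective i
    obtain ⟨t, rfl⟩ := (splitFirst hmn).surjective j
    rw [Matrix.reindex_apply, Matrix.submatrix_apply, Equiv.symm_apply_apply,
        Equiv.symm_apply_apply]
    rcases s with s | s <;> rcases t with t | t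
    · rfl
    all_goals
      rw [mem_blockGroup.1 hg _ _ (by simp [splitFirst_inl, splitFirst_inr])]
      simp [Matrix.one_apply]
  have hdet : A.det ≠ 0 := by
    have h1 : (g : Matrix (Fin n) (Fin n) F).det ≠ 0 := by
      rw [← isUnit_iff_ne_zero, ← Matrix.isUnit_iff_isUnit_det]; exact g.isUnit
    rw [hA, Matrix.det_reindex_self, Matrix.det_fromBlocks_zero₂₁, Matrix.det_one, mul_one] at h1
    exact h1
  exact ⟨Matrix.GeneralLinearGroup.mkOfDetNeZero A hdet, Units.ext hA.symm⟩

theorem diagEmbed_mem_upperUnipotent {h : GL (Fin m) F} :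
    diagEmbed hmn h ∈ upperUnipotent F n ↔ h ∈ upperUnipotent F m := by
  constructor
  · intro H i j hij
    rw [← diagEmbed_apply_castLE hmn, H _ _ (by simpa using hij)]
    simp
  · intro H i j hij
    have hij' : ¬ (i : ℕ) < j := hij
    by_cases hm : m ≤ (i : ℕ) ∨ m ≤ (j : ℕ)
    · exact mem_blockGroup.1 (diagEmbed_mem hmn h) i j hm
    · push Not at hm
      have := diagEmbed_apply_castLE hmn h ⟨i, hm.1⟩ ⟨j, hm.2⟩
      rw [H ⟨i, hm.1⟩ ⟨j, hm.2⟩ hij'] at this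
      simpa [Fin.ext_iff] using this

theorem unipotentChar_diagEmbed (ψ : AddChar F ℂ) (h : GL (Fin m) F) :
    unipotentChar ψ (diagEmbed hmn h) = unipotentChar ψ h := by
  rw [unipotentChar_eq, unipotentChar_eq]
  congr 1
  rw [superdiagSum, superdiagSum, ← Finset.sum_subset (Finset.subset_univ
    (Finset.univ.map ⟨Fin.castLE hmn.le, Fin.castLE_injective hmn.le⟩)), Finset.sum_map]
  · refine Finset.sum_congr rfl fun i _ => ?_
    simp only [Function.Embedding.coeFn_mk, Fin.val_castLE]
    rw [dif_pos (show (i : ℕ) + 1 < n by have := i.2; omega)]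
    split_ifs with hi
    · exact diagEmbed_apply_castLE hmn h i ⟨i + 1, hi⟩
    · rw [mem_blockGroup.1 (diagEmbed_mem hmn h), if_neg]
      · intro h
        have := congrArg Fin.val h
        simp at this
      · right
        simp only
        omega
  · intro i _ hi
    split_ifs with h1
    · rw [mem_blockGroup.1 (diagEmbed_mem hmn h), if_neg]
      · intro h
        have := congrArg Fin.val h
        simp at this
      · left
        by_contra h2
        apply hi
        rw [Finset.mem_map]
        exact ⟨⟨i, by omega⟩, Finset.mem_univ _, Fin.ext rfl⟩
    · rfl

/-- The matrices on the dual side of the functional equation factor through `diag(h, 1)`. -/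
theorem antiEmbed_eq_mul_diagEmbed (h : GL (Fin m) F) (x : Matrix (Fin m) (Fin (n - m - 1)) F) :
    antiEmbed hmn h x = antiEmbed hmn 1 x * diagEmbed hmn h := by
  refine Units.ext ?_
  simp [antiEmbed, diagEmbed, Matrix.reindex_apply, Matrix.submatrix_mul_equiv,
    Matrix.fromBlocks_multiply]

theorem rotation_splitLast_inl (a : Fin (n - m - 1 + 1)) :
    rotation n m hmn.le (splitLast hmn (Sum.inl a)) = splitFirst hmn (Sum.inr a) := by
  ext
  have := a.2
  rw [rotation_apply, splitLast_inl, splitFirst_inr, if_pos (by omega), add_comm]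

theorem rotation_splitLast_inr (a : Fin m) :
    rotation n m hmn.le (splitLast hmn (Sum.inr a)) = splitFirst hmn (Sum.inl a) := by
  ext
  have := a.2
  rw [rotation_apply, splitLast_inr, splitFirst_inl, if_neg (by omega)]
  omega

theorem rotation_inv_mul_antiEmbed_mem (x : Matrix (Fin m) (Fin (n - m - 1)) F) :
    (permGL (rotation n m hmn.le))⁻¹ * antiEmbed hmn 1 x ∈ shortRadical F n m := by
  set z : GL (Fin n) F := (permGL (rotation n m hmn.le))⁻¹ * antiEmbed hmn 1 x with hz
  have h1 : antiEmbed hmn 1 x = permGL (rotation n m hmn.le) * z := by rw [hz]; group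
  have h2 : ∀ s t, z (rotation n m hmn.le (splitLast hmn s)) (splitFirst hmn t) =
      Matrix.fromBlocks 0 1 (1 : Matrix (Fin m) (Fin m) F) (padZero x) s t := by
    intro s t
    have := antiEmbed_apply hmn 1 x s t
    rw [h1, permGL_mul_row] at this
    exact this
  rw [mem_shortRadical]
  intro i j hij
  obtain ⟨s, rfl⟩ := (splitFirst hmn).surjective i
  obtain ⟨t, rfl⟩ := (splitFirst hmn).surjective j
  rcases s with s | s
  · rw [← rotation_splitLast_inr, h2, rotation_splitLast_inr]
    rcases t with t | t
    · simp [Matrix.one_apply]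
    · rw [splitFirst_inl, splitFirst_inr] at hij
      have := s.2
      obtain rfl : t = 0 := Fin.ext (by rw [Fin.val_zero]; omega)
      simp [padZero]
  · rw [← rotation_splitLast_inl, h2, rotation_splitLast_inl]
    rcases t with t | t
    · simp
    · simp [Matrix.one_apply]

/-- The sum over `x` on the dual side is a sum over the short radical. -/
theorem finsum_antiEmbed [Finite F] (f : GL (Fin n) F → ℂ) (h : GL (Fin m) F) :
    ∑ᶠ x : Matrix (Fin m) (Fin (n - m - 1)) F, f (antiEmbed hmn h x) =
      ∑ z : shortRadical F n m, f (permGL (rotation n m hmn.le) * (z :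
          GL (Fin n) F) * diagEmbed hmn h) := by
  rw [← finsum_eq_sum_of_fintype]
  refine finsum_eq_of_bijective (fun x => (⟨_, rotation_inv_mul_antiEmbed_mem hmn x⟩ :
    shortRadical F n m)) ⟨fun x y hxy => ?_, fun z => ?_⟩ fun x => ?_
  · have h1 : antiEmbed hmn 1 x = antiEmbed hmn 1 y := mul_left_cancel (congrArg Subtype.val hxy)
    ext i j
    have h2 : ∀ y : Matrix (Fin m) (Fin (n - m - 1)) F,
        antiEmbed hmn 1 y (splitLast hmn (Sum.inr i)) (splitFirst hmn (Sum.inr j.succ)) =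
        y i j := fun y => by rw [antiEmbed_apply]; rfl
    exact (h2 x).symm.trans (h1 ▸ h2 y)
  · refine ⟨Matrix.of fun i j => (z : GL (Fin n) F) (splitFirst hmn (Sum.inl i))
      (splitFirst hmn (Sum.inr j.succ)), Subtype.ext ?_⟩
    simp only
    rw [inv_mul_eq_iff_eq_mul]
    ext i j
    obtain ⟨s, rfl⟩ := (splitLast hmn).surjective i
    obtain ⟨t, rfl⟩ := (splitFirst hmn).surjective j
    rw [antiEmbed_apply, permGL_mul_row]
    have hz := mem_shortRadical.1 z.2
    rcases s with s | s
    · rw [rotation_splitLast_inl, hz _ _ (by rw [splitFirst_inr]; omega)]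
      rcases t with t | t <;> simp [Matrix.one_apply]
    · rw [rotation_splitLast_inr]
      rcases t with t | t
      · rw [hz _ _ (by rw [splitFirst_inl, splitFirst_inl]; have := t.2; omega)]
        simp [Matrix.one_apply]
      · induction t using Fin.cases with
        | zero =>
          rw [hz _ _ (by rw [splitFirst_inr]; simp)]
          simp [padZero]
        | succ t => simp [padZero]
  · rw [antiEmbed_eq_mul_diagEmbed]
    congr 1
    group

/-- The sum over cosets as an average over the group. -/
theorem cosetSum_eq [Finite F] {f : GL (Fin m) F → ℂ}
    (hf : ∀ u ∈ upperUnipotent F m, ∀ h, f (u * h) = f h) :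
    cosetSum f = (Fintype.card (upperUnipotent F m) : ℂ)⁻¹ * ∑ h, f h := by
  have : Fintype (Quotient (QuotientGroup.rightRel (upperUnipotent F m))) := Fintype.ofFinite _
  rw [cosetSum, finsum_eq_sum_of_fintype, eq_inv_mul_iff_mul_eq₀ (card_subgroup_ne_zero _)]
  have hcls : ∀ (u : upperUnipotent F m) (q :
      Quotient (QuotientGroup.rightRel (upperUnipotent F m))),
      (Quotient.mk _ ((u : GL (Fin m) F) * q.out) : Quotient (QuotientGroup.rightRel _)) = q := by
    intro u q
    conv_rhs => rw [← q.out_eq]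
    refine Quotient.sound (s := QuotientGroup.rightRel (upperUnipotent F m)) ?_
    change QuotientGroup.rightRel (upperUnipotent F m) _ _
    rw [QuotientGroup.rightRel_apply]
    simp
  have h1 : ∑ h, f h = ∑ x : upperUnipotent F m × Quotient (QuotientGroup.rightRel
      (upperUnipotent F m)), f (x.1 * x.2.out) := by
    refine (Function.Bijective.sum_comp ⟨fun x y hxy => ?_, fun h => ?_⟩ f).symm
    · have h2 : x.2 = y.2 := by
        rw [← hcls x.1 x.2, ← hcls y.1 y.2]
        exact congrArg _ hxy
      have h3 : (x.1 : GL (Fin m) F) * x.2.out = y.1 * y.2.out := hxy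
      rw [h2] at h3
      exact Prod.ext (Subtype.ext (mul_right_cancel h3)) h2
    · let q : Quotient (QuotientGroup.rightRel (upperUnipotent F m)) := Quotient.mk _ h
      have h2 : QuotientGroup.rightRel (upperUnipotent F m) q.out h := Quotient.exact q.out_eq
      rw [QuotientGroup.rightRel_apply] at h2
      exact ⟨(⟨_, h2⟩, q), by simp⟩
  rw [h1, Fintype.sum_prod_type]
  simp only [hf _ (Subtype.mem _)]
  simp

end Embedding

/-! ### Gamma factors through Bessel functions -/

section ShortSum

variable {F : Type*} [Field F] {n m : ℕ}

theorem vecMul_eq_self {g : GL (Fin n) F} {b : Fin n → F}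
    (h : ∀ i, b i ≠ 0 → g i = Pi.single i 1) :
    Matrix.vecMul b (g : Matrix (Fin n) (Fin n) F) = b := by
  ext j
  rw [Matrix.vecMul, dotProduct, Finset.sum_eq_single j]
  · by_cases hj : b j = 0
    · rw [hj, zero_mul]
    · rw [h j hj, Pi.single_eq_same, mul_one]
  · intro i _ hij
    by_cases hi : b i = 0
    · rw [hi, zero_mul]
    · rw [h i hi, Pi.single_eq_of_ne (Ne.symm hij), mul_zero]
  · simp

theorem shortRadical_row {z : GL (Fin n) F} (hz : z ∈ shortRadical F n m) (i : Fin n)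
    (hi : m ≤ (i : ℕ)) : z i = Pi.single i 1 :=
  row_eq_single_of fun j => mem_shortRadical.1 hz i j (by omega)

theorem shortRadical_fixesColumns {z : GL (Fin n) F} (hz : z ∈ shortRadical F n m) :
    FixesColumns (m + 1) z := by
  intro j hj
  rw [mulVec_single_eq_iff]
  exact fun i => mem_shortRadical.1 hz i j (by omega)

theorem shortRadical_le : shortRadical F n m ≤ upperUnipotent F n := by
  intro z hz i j hij
  have hij' : ¬ (i : ℕ) < j := hij
  exact mem_shortRadical.1 hz i j (by omega)

theorem unipotentChar_shortRadical (ψ : AddChar F ℂ) {z : GL (Fin n) F}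
    (hz : z ∈ shortRadical F n m) : unipotentChar ψ z = 1 := by
  refine unipotentChar_eq_one_of fun i j hij => ?_
  rw [mem_shortRadical.1 hz i j (by omega), if_neg]
  rintro rfl; omega

theorem conj_mem_shortRadical {g : GL (Fin n) F}
    (hg : ∀ i j : Fin n, (j : ℕ) ≤ m → m < (i : ℕ) → g i j = 0)
    (hg' : ∀ i j : Fin n, m ≤ (i : ℕ) → (j : ℕ) < m → (g⁻¹ : GL (Fin n) F) i j = 0)
    {z : GL (Fin n) F} (hz : z ∈ shortRadical F n m) : g⁻¹ * z * g ∈ shortRadical F n m := by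
  rw [mem_shortRadical]
  intro i j hij
  by_cases hj : (j : ℕ) ≤ m
  · refine mulVec_single_eq_iff.1 ?_ i
    rw [mul_assoc, mulVec_mul, mulVec_mul, (shortRadical_fixesColumns hz).mulVec]
    · exact glInv_mulVec rfl
    · intro i hi
      rw [Matrix.mulVec_single_one]
      exact hg i j hj hi
  · have h1 : (g⁻¹ * z * g) i = Pi.single i 1 := by
      rw [glMul_row, glMul_row, vecMul_eq_self (g := z), ← glMul_row, inv_mul_cancel, glOne_row]
      refine fun j hj => shortRadical_row hz j ?_
      by_contra hjm
      exact hj (hg' i j (by omega) (by omega))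
    rw [h1, Pi.single_apply]; simp [eq_comm]

theorem diagEmbed_conj_mem_shortRadical (hmn : m < n) (h : GL (Fin m) F) {z : GL (Fin n) F}
    (hz : z ∈ shortRadical F n m) :
    (diagEmbed hmn h)⁻¹ * z * diagEmbed hmn h ∈ shortRadical F n m := by
  refine conj_mem_shortRadical (fun i j hj hi => ?_) (fun i j hi hj => ?_) hz
  · rw [mem_blockGroup.1 (diagEmbed_mem hmn h) i j (Or.inl hi.le), if_neg]
    rintro rfl; omega
  · rw [← diagEmbed_inv, mem_blockGroup.1 (diagEmbed_mem hmn h⁻¹) i j (Or.inl hi), if_neg]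
    rintro rfl; omega

variable [Finite F]

theorem sum_subgroup_conj {M : Type*} [AddCommMonoid M] (H : Subgroup (GL (Fin n) F))
    {g : GL (Fin n) F} (hg : ∀ z ∈ H, g⁻¹ * z * g ∈ H) (f : GL (Fin n) F → M) :
    ∑ z : H, f (g⁻¹ * z * g) = ∑ z : H, f z := by
  let e : H → H := fun z => ⟨g⁻¹ * z * g, hg z z.2⟩
  have he : Function.Injective e := fun x y hxy => by
    have h : g⁻¹ * (x : GL (Fin n) F) * g = g⁻¹ * y * g := congrArg Subtype.val hxy
    exact Subtype.ext (mul_left_cancel (mul_right_cancel h))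
  exact Function.Bijective.sum_comp (Finite.injective_iff_bijective.1 he) fun z : H => f z

/-- The inner sum of the dual side of the functional equation, as a function on `GL_n(F)`. -/
noncomputable def shortSum (hmn : m < n) (Φ : GL (Fin n) F → ℂ) (g : GL (Fin n) F) : ℂ :=
  ∑ z : shortRadical F n m, Φ (permGL (rotation n m hmn.le) * (z : GL (Fin n) F) * g)

variable {hmn : m < n} {Φ : GL (Fin n) F → ℂ} {ψ : AddChar F ℂ}

theorem shortSum_mul {g : GL (Fin n) F} (hg : ∀ z ∈ shortRadical F n m,
    g⁻¹ * z * g ∈ shortRadical F n m)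
    (x : GL (Fin n) F) : shortSum hmn Φ (g * x) =
      ∑ z : shortRadical F n m, Φ (permGL (rotation n m hmn.le) * g * (z : GL (Fin n) F) * x) := by
  rw [← sum_subgroup_conj _ hg (fun z => Φ (permGL (rotation n m hmn.le) * g * z * x)), shortSum]
  refine Finset.sum_congr rfl fun z _ => congrArg Φ ?_
  group

theorem shortSum_shortRadical_mul {z : GL (Fin n) F} (hz : z ∈ shortRadical F n m)
    (x : GL (Fin n) F) : shortSum hmn Φ (z * x) = shortSum hmn Φ x := by
  rw [shortSum, shortSum, ← sum_subgroup_mul_right _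
    (fun z => Φ (permGL (rotation n m hmn.le) * z * x)) hz]
  simp only [mul_assoc]

/-- Block diagonal elements of `U` act on `shortSum Φ` from the left through `ψ`. -/
theorem shortSum_unipotent_mul
    (hΦ : ∀ u ∈ upperUnipotent F n, ∀ g, Φ (u * g) = unipotentChar ψ u * Φ g)
    {v : GL (Fin n) F} (hv : v ∈ upperUnipotent F n)
    (hvm : ∀ i j : Fin n, (i : ℕ) < m → m ≤ (j : ℕ) → v i j = 0) (x : GL (Fin n) F) :
    shortSum hmn Φ (v * x) = unipotentChar ψ v * shortSum hmn Φ x := by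
  have hlow : ∀ u ∈ upperUnipotent F n, ∀ i j : Fin n, (j : ℕ) < i → u i j = 0 := by
    intro u hu i j hij
    rw [hu i j (by simp only; omega), if_neg]
    rintro rfl; omega
  rw [shortSum_mul (fun z hz => conj_mem_shortRadical (fun i j hj hi => hlow v hv i j (by omega))
    (fun i j hi hj => hlow _ (inv_mem hv) i j (by omega)) hz), shortSum, Finset.mul_sum]
  refine Finset.sum_congr rfl fun z _ => ?_
  obtain ⟨h1, h2⟩ := rotation_conj_mem hmn.le hv hvm
  rw [← h2 ψ, ← hΦ _ h1]
  congr 1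
  group

/-- For a right `ψ`-equivariant function, the sum over the short radical is constant. -/
theorem shortSum_diagEmbed
    (hΦ : ∀ u ∈ upperUnipotent F n, ∀ g, Φ (g * u) = unipotentChar ψ u * Φ g) (h : GL (Fin m) F) :
    shortSum hmn Φ (diagEmbed hmn h) = (Fintype.card (shortRadical F n m) : ℂ) *
      Φ (permGL (rotation n m hmn.le) * diagEmbed hmn h) := by
  rw [shortSum, Finset.sum_congr rfl (g :=
      fun _ => Φ (permGL (rotation n m hmn.le) * diagEmbed hmn h))]
  · simp
  · intro z _
    have h1 := diagEmbed_conj_mem_shortRadical hmn h z.2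
    rw [← one_mul (Φ (permGL (rotation n m hmn.le) * _)), ← unipotentChar_shortRadical ψ h1,
      ← hΦ _ (shortRadical_le h1)]
    congr 1
    group

/-- Moving a column transvection through `diag(h, 1)` and the sum over the short radical. -/
theorem shortSum_diagEmbed_mul_colTransv
    (hΦ : ∀ u ∈ upperUnipotent F n, ∀ g, Φ (u * g) = unipotentChar ψ u * Φ g) (h : GL (Fin m) F)
    {K I : Fin n} (hIK : (I : ℕ) + 1 = K) (hK : m < (K : ℕ)) {y : Fin n → F}
    (hy : ∀ i, K ≤ i → y i = 0) (x : GL (Fin n) F) :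
    shortSum hmn Φ (diagEmbed hmn h * colTransv y K (hy K le_rfl) * x) =
      ψ (y I) * shortSum hmn Φ (diagEmbed hmn h * x) := by
  have hB := diagEmbed_mem hmn h
  rw [mul_colTransv (hB.1 K hK.le)]
  set y' := Matrix.mulVec (diagEmbed hmn h : Matrix (Fin n) (Fin n) F) y with hy'
  have hy'm : ∀ i : Fin n, m ≤ (i : ℕ) → y' i = y i := fun i hi => blockGroup_mulVec hB y hi
  let a : Fin n → F := fun i => if (i : ℕ) < m then y' i else 0
  let b : Fin n → F := fun i => if (i : ℕ) < m then 0 else y' i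
  have ha : a K = 0 := if_neg (by omega)
  have hb : ∀ i, K ≤ i → b i = 0 := by
    intro i hi
    have : (K : ℕ) ≤ i := hi
    simp only [b]
    rw [if_neg (by omega), hy'm i (by omega), hy i hi]
  have hab : a + b = y' := by
    ext i
    simp only [a, b, Pi.add_apply]
    split_ifs <;> simp
  have h1 : colTransv y' K (by rw [hy'm K hK.le, hy K le_rfl]) =
      colTransv a K ha * colTransv b K (hb K le_rfl) := by
    rw [colTransv_mul]; simp only [hab]
  rw [h1, mul_assoc, mul_assoc, shortSum_shortRadical_mul,
      shortSum_unipotent_mul hΦ (colTransv_mem hb),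
    unipotentChar_colTransv hIK]
  · simp only [b]
    rw [if_neg (by omega), hy'm I (by omega)]
  · intro i j hi hj
    rw [colTransv, transv_apply, if_neg (by rintro rfl; omega)]
    simp [b, hi]
  · refine transv_mem_patternGroup fun i j hij => ?_
    by_cases hi : (i : ℕ) < m
    · right
      rw [Pi.single_eq_of_ne]
      rintro rfl
      omega
    · left; simp [a, hi]

end ShortSum

section Gamma

variable {F : Type*} [Field F] [Finite F] {n m : ℕ} (hmn : m < n) {ψ : AddChar F ℂ}
  {V : Type*} [AddCommGroup V] [Module ℂ V] {T : Type*} [AddCommGroup T] [Module ℂ T]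
  {σ : Representation ℂ (GL (Fin n) F) V} {τ : Representation ℂ (GL (Fin m) F) T}
  {l : V →ₗ[ℂ] ℂ} {w : V}

theorem cosetSum_diagEmbed
    {W : GL (Fin n) F → ℂ} (hW : ∀ u ∈ upperUnipotent F n, ∀ g, W (u * g) = unipotentChar ψ u * W g)
    {W' : GL (Fin m) F → ℂ}
    (hW' : ∀ u ∈ upperUnipotent F m, ∀ g, W' (u * g) = unipotentChar ψ⁻¹ u * W' g) :
    cosetSum (fun h => W (diagEmbed hmn h) * W' h) =
      (Fintype.card (upperUnipotent F m) : ℂ)⁻¹ * ∑ h, W (diagEmbed hmn h) * W' h := by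
  refine cosetSum_eq fun u hu h => ?_
  rw [diagEmbed_mul, hW _ ((diagEmbed_mem_upperUnipotent hmn).2 hu), hW' u hu,
    unipotentChar_diagEmbed, unipotentChar_inv_char]
  field_simp [unipotentChar_ne_zero (ψ := ψ) hu]

theorem cosetSum_antiEmbed
    {W : GL (Fin n) F → ℂ} (hW : ∀ u ∈ upperUnipotent F n, ∀ g, W (u * g) = unipotentChar ψ u * W g)
    {W' : GL (Fin m) F → ℂ}
    (hW' : ∀ u ∈ upperUnipotent F m, ∀ g, W' (u * g) = unipotentChar ψ⁻¹ u * W' g) :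
    cosetSum (fun h => ∑ᶠ x : Matrix (Fin m) (Fin (n - m - 1)) F, W (antiEmbed hmn h x) * W' h) =
      (Fintype.card (upperUnipotent F m) : ℂ)⁻¹ * ∑ h, shortSum hmn W (diagEmbed hmn h) * W' h := by
  have h1 : ∀ h, ∑ᶠ x : Matrix (Fin m) (Fin (n - m - 1)) F, W (antiEmbed hmn h x) * W' h =
      shortSum hmn W (diagEmbed hmn h) * W' h := by
    intro h
    rw [finsum_antiEmbed hmn (fun g => W g * W' h), shortSum, Finset.sum_mul]
  simp only [h1]
  refine cosetSum_eq fun u hu h => ?_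
  rw [diagEmbed_mul, shortSum_unipotent_mul hW ((diagEmbed_mem_upperUnipotent hmn).2 hu), hW' u hu,
    unipotentChar_diagEmbed, unipotentChar_inv_char]
  · field_simp [unipotentChar_ne_zero (ψ := ψ) hu]
  · intro i j hi hj
    rw [mem_blockGroup.1 (diagEmbed_mem hmn u) i j (Or.inr hj), if_neg]
    rintro rfl; omega

/-- A left `U`-invariant function on the mirabolic subgroup that is supported on
`U · diag(GL_m, 1)` is summed by unfolding. -/
theorem sum_mirabolic_eq {φ : GL (Fin n) F → ℂ}
    (hφ : ∀ u ∈ upperUnipotent F n, ∀ g, φ (u * g) = φ g)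
    (hsupp : ∀ p ∈ mirabolic F n, φ p ≠ 0 → ∃ u ∈ upperUnipotent F n, ∃ h : GL (Fin m) F,
      p = u * diagEmbed hmn h) :
    (Fintype.card (upperUnipotent F m) : ℂ) * ∑ p : mirabolic F n, φ p =
      (Fintype.card (upperUnipotent F n) : ℂ) * ∑ h : GL (Fin m) F, φ (diagEmbed hmn h) := by
  classical
  have hP : ∀ h : GL (Fin m) F, diagEmbed hmn h ∈ mirabolic F n := fun h =>
    blockGroup_le_mirabolic hmn (diagEmbed_mem hmn h)
  have h1 : ∀ p : mirabolic F n, (Fintype.card (upperUnipotent F m) : ℂ) * φ p =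
      ∑ h : GL (Fin m) F, if (p : GL (Fin n) F) * (diagEmbed hmn h)⁻¹ ∈ upperUnipotent F n
        then φ p else 0 := by
    intro p
    by_cases hp : φ p = 0
    · simp [hp]
    obtain ⟨u, hu, h₀, h2⟩ := hsupp p p.2 hp
    have h3 : ∀ h : GL (Fin m) F, (p : GL (Fin n) F) * (diagEmbed hmn (h * h₀))⁻¹ ∈
        upperUnipotent F n ↔ h ∈ upperUnipotent F m := by
      intro h
      rw [h2, ← diagEmbed_inv, mul_assoc, ← diagEmbed_mul, Subgroup.mul_mem_cancel_left _ hu,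
        diagEmbed_mem_upperUnipotent, mul_inv_rev, mul_inv_cancel_left, inv_mem_iff]
    rw [← Equiv.sum_comp (Equiv.mulRight h₀)]
    simp only [Equiv.coe_mulRight, h3]
    have h4 := sum_subgroup_eq_sum_ite (upperUnipotent F m) (fun _ => φ p)
    refine Eq.trans ?_ (h4.trans (Finset.sum_congr rfl fun h _ => ?_))
    · simp
    · congr
  rw [Finset.mul_sum, Finset.sum_congr rfl fun p _ => h1 p, Finset.sum_comm, Finset.mul_sum]
  refine Finset.sum_congr rfl fun h _ => ?_
  have h2 := sum_subgroup_mul_right (mirabolic F n) (fun p => if p * (diagEmbed hmn h)⁻¹ ∈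
    upperUnipotent F n then φ p else 0) (hP h)
  rw [← h2]
  simp only [mul_inv_cancel_right]
  rw [sum_subgroup_eq_of_le (f := fun p => if p ∈ upperUnipotent F n then φ (p * diagEmbed hmn h)
    else 0) upperUnipotent_le_mirabolic (fun x _ hx => if_neg hx)]
  rw [Finset.sum_congr rfl (g := fun _ => φ (diagEmbed hmn h))]
  · simp
  · intro u _
    rw [if_pos u.2, hφ u u.2]

/-- The pairing of the Bessel function of `σ` at `permGL (rotation n m) · diag(h, 1)` with the
Whittaker functions of `τ` is multiplication by the gamma factor. The pairing defines a Whittaker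
functional of `τ`, hence is a multiple of `l'`; the reproducing kernel property of the Bessel
function turns this into the functional equation for all Whittaker functions of `σ`, so that the
gamma factor exists, is unique, and equals the multiple. -/
theorem gammaFactor_eq (hψ : ψ ≠ 1) (hσ : IsWhittakerPair σ ψ l w) {l' : T →ₗ[ℂ] ℂ} {w' : T}
    (hτ : IsWhittakerPair τ ψ⁻¹ l' w') (v : T) :
    (Fintype.card (upperUnipotent F m) : ℂ)⁻¹ *
      ∑ h, shortSum hmn (bessel σ l w) (diagEmbed hmn h) * l' (τ h v) =
        gammaFactor ψ hmn σ τ * l' v := by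
  have hn : 0 < n := by omega
  have hcn := card_subgroup_ne_zero (upperUnipotent F n)
  have hcm := card_subgroup_ne_zero (upperUnipotent F m)
  have hψ' : ψ⁻¹ ≠ 1 := inv_ne_one.2 hψ
  set J := bessel σ l w with hJ
  have hJl : ∀ u ∈ upperUnipotent F n, ∀ g, J (u * g) = unipotentChar ψ u * J g :=
    fun u hu g => hσ.bessel_mul_left hu g
  have hJr : ∀ u ∈ upperUnipotent F n, ∀ g, J (g * u) = unipotentChar ψ u * J g :=
    fun u hu g => hσ.bessel_mul_right hu g
  have hτl : ∀ v : T, ∀ u ∈ upperUnipotent F m, ∀ g,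
      l' (τ (u * g) v) = unipotentChar ψ⁻¹ u * l' (τ g v) := fun v u hu g => by
    rw [← rep_mul_apply, hτ.functional u hu]
  -- the dual side, with `W` the Bessel function, is a Whittaker functional of `τ`
  let L : T →ₗ[ℂ] ℂ := (Fintype.card (upperUnipotent F m) : ℂ)⁻¹ •
    ∑ h, shortSum hmn J (diagEmbed hmn h) • l' ∘ₗ τ h
  have hL : ∀ v, L v = (Fintype.card (upperUnipotent F m) : ℂ)⁻¹ *
      ∑ h, shortSum hmn J (diagEmbed hmn h) * l' (τ h v) := by
    intro v
    simp [L, LinearMap.sum_apply]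
  have hLW : IsWhittakerFunctional τ ψ⁻¹ L := by
    intro u hu v
    rw [hL, hL, mul_left_comm, Finset.mul_sum (a := unipotentChar ψ⁻¹ u)]
    congr 1
    refine Eq.trans ?_ (Equiv.sum_comp (Equiv.mulRight u) _)
    refine Finset.sum_congr rfl fun h _ => ?_
    have h1 : shortSum hmn J (diagEmbed hmn (h * u)) =
        unipotentChar ψ u * shortSum hmn J (diagEmbed hmn h) := by
      rw [diagEmbed_mul, shortSum, shortSum, Finset.mul_sum]
      refine Finset.sum_congr rfl fun z _ => ?_
      rw [← mul_assoc, hJr _ ((diagEmbed_mem_upperUnipotent hmn).2 hu), unipotentChar_diagEmbed]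
    rw [Equiv.coe_mulRight, h1, rep_mul_apply, unipotentChar_inv_char]
    field_simp [unipotentChar_ne_zero (ψ := ψ) hu]
  have hL' : ∀ v, L v = L w' * l' v := hτ.unique L hLW
  -- the functional equation, with the constant `L w'`
  have hfe : ∀ v : V, ∀ v' : T,
      L w' * cosetSum (fun h => l (σ (diagEmbed hmn h) v) * l' (τ h v')) =
        cosetSum (fun h => ∑ᶠ x : Matrix (Fin m) (Fin (n - m - 1)) F,
          l (σ (antiEmbed hmn h x) v) * l' (τ h v')) := by
    intro v v'
    have hWl : ∀ u ∈ upperUnipotent F n, ∀ g, l (σ (u * g) v) = unipotentChar ψ u * l (σ g v) :=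
      fun u hu g => by rw [← rep_mul_apply, hσ.functional u hu]
    rw [cosetSum_diagEmbed hmn (W := fun g => l (σ g v)) hWl (hτl v'),
      cosetSum_antiEmbed hmn (W := fun g => l (σ g v)) hWl (hτl v')]
    -- expand `W` by the reproducing kernel; `b` is the coefficient of `W p`
    let b : GL (Fin n) F → ℂ := fun p =>
      ∑ h, shortSum hmn (fun g => J (g * p⁻¹)) (diagEmbed hmn h) * l' (τ h v')
    have hexp : ∑ h, shortSum hmn (fun g => l (σ g v)) (diagEmbed hmn h) * l' (τ h v') =
        (Fintype.card (upperUnipotent F n) : ℂ)⁻¹ * ∑ p : mirabolic F n, l (σ p v) * b p := by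
      have e : ∀ h, shortSum hmn (fun g => l (σ g v)) (diagEmbed hmn h) =
          (Fintype.card (upperUnipotent F n) : ℂ)⁻¹ * ∑ p : mirabolic F n, l (σ p v) *
            shortSum hmn (fun g => J (g * (p : GL (Fin n) F)⁻¹)) (diagEmbed hmn h) := by
        intro h
        rw [shortSum, Finset.sum_congr rfl fun z _ => hσ.apply_eq_sum hψ hn _ v, ← Finset.mul_sum,
          Finset.sum_comm]
        simp only [shortSum, Finset.mul_sum, hJ]
      simp only [b, e, Finset.mul_sum, Finset.sum_mul]
      rw [Finset.sum_comm]
      refine Finset.sum_congr rfl fun p _ => Finset.sum_congr rfl fun h _ => ?_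
      ring
    have hbl : ∀ u ∈ upperUnipotent F n, ∀ g, b (u * g) = unipotentChar ψ⁻¹ u * b g := by
      intro u hu g
      simp only [b, shortSum, Finset.mul_sum, Finset.sum_mul]
      refine Finset.sum_congr rfl fun h _ => Finset.sum_congr rfl fun z _ => ?_
      rw [mul_inv_rev, ← mul_assoc, hJr _ (inv_mem hu), unipotentChar_inv hu,
        unipotentChar_inv_char, mul_assoc]
    have hbr : ∀ (K I : Fin n), (I : ℕ) + 1 = K → m < (K : ℕ) → ∀ (y : Fin n → F)
        (hy : ∀ i, K ≤ i → y i = 0), ∀ p ∈ mirabolic F n,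
          b (p * colTransv y K (hy K le_rfl)) = ψ⁻¹ (y I) * b p := by
      intro K I hIK hK y hy p _
      simp only [b, Finset.mul_sum]
      refine Finset.sum_congr rfl fun h _ => ?_
      have hy' : ∀ i, K ≤ i → (-y) i = 0 := fun i hi => by rw [Pi.neg_apply, hy i hi, neg_zero]
      have h1 := shortSum_diagEmbed_mul_colTransv (hmn := hmn) hJl h hIK hK hy' p⁻¹
      have h2 : ∀ (g : GL (Fin n) F) x, shortSum hmn (fun g => J (g * x)) g =
          shortSum hmn J (g * x) := fun g x => by
        simp only [shortSum, mul_assoc]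
      rw [h2, h2, mul_inv_rev, colTransv_inv, ← mul_assoc, h1, AddChar.inv_apply, mul_assoc]
      rfl
    have hbd : ∀ h, b (diagEmbed hmn h) =
        Fintype.card (upperUnipotent F m) * (L w' * l' (τ h v')) := by
      intro h₀
      rw [← hL', hL, mul_inv_cancel_left₀ hcm]
      simp only [b]
      refine Eq.trans (Equiv.sum_comp (Equiv.mulRight h₀) _).symm ?_
      refine Finset.sum_congr rfl fun h _ => ?_
      rw [Equiv.coe_mulRight, rep_mul_apply]
      congr 1
      simp only [shortSum]
      refine Finset.sum_congr rfl fun z _ => congrArg J ?_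
      rw [diagEmbed_mul]
      group
    have hsum := sum_mirabolic_eq hmn (φ := fun p => l (σ p v) * b p)
      (fun u hu g => by
        rw [hWl u hu, hbl u hu, unipotentChar_inv_char]
        field_simp [unipotentChar_ne_zero (ψ := ψ) hu])
      (fun p hp hp0 => by
        obtain ⟨u, hu, g, hg, rfl⟩ := exists_eq_mul_blockGroup hψ' hmn hbl hbr hp
          (right_ne_zero_of_mul hp0)
        obtain ⟨h, rfl⟩ := exists_diagEmbed_eq hmn hg
        exact ⟨u, hu, h, rfl⟩)
    have hd : ∑ h, l (σ (diagEmbed hmn h) v) * b (diagEmbed hmn h) =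
        Fintype.card (upperUnipotent F m) *
          (L w' * ∑ h, l (σ (diagEmbed hmn h) v) * l' (τ h v')) := by
      simp only [hbd, Finset.mul_sum]
      exact Finset.sum_congr rfl fun h _ => by ring
    rw [hd, mul_left_comm] at hsum
    rw [hexp, mul_left_cancel₀ hcm hsum, inv_mul_cancel_left₀ hcn, mul_left_comm]
  -- `W = J` makes the left side equal to `1`, which gives uniqueness
  have h1 : cosetSum (fun h => J (diagEmbed hmn h) * l' (τ h w')) = 1 := by
    rw [cosetSum_diagEmbed hmn hJl (hτl w')]
    have h2 : ∀ h, J (diagEmbed hmn h) * l' (τ h w') =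
        open Classical in if h ∈ upperUnipotent F m then 1 else 0 := by
      intro h
      split_ifs with hh
      · rw [hJ, hσ.bessel_of_mem ((diagEmbed_mem_upperUnipotent hmn).2 hh), unipotentChar_diagEmbed,
          hτ.functional h hh, unipotentChar_inv_char, hτ.apply_eq_one, mul_one,
          mul_inv_cancel₀ (unipotentChar_ne_zero hh)]
      · rw [hJ, hσ.bessel_mirabolic hψ hn (blockGroup_le_mirabolic hmn (diagEmbed_mem hmn h))
          (fun h' => hh ((diagEmbed_mem_upperUnipotent hmn).1 h')), zero_mul]
    simp only [h2]
    rw [← sum_subgroup_eq_sum_ite (upperUnipotent F m) (fun _ => 1)]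
    simp [hcm]
  have hpair : ∀ c, IsGammaFactor ψ hmn σ τ c ↔ c = L w' := by
    intro c
    constructor
    · intro hc
      have h2 := hc J ⟨l, hσ.functional, w, rfl⟩ (fun h => l' (τ h w')) ⟨l', hτ.functional, w', rfl⟩
      rw [h1, mul_one] at h2
      have h3 : L w' * cosetSum (fun h => J (diagEmbed hmn h) * l' (τ h w')) = cosetSum (fun h =>
        ∑ᶠ x : Matrix (Fin m) (Fin (n - m - 1)) F, J (antiEmbed hmn h x) * l' (τ h w')) := hfe w w'
      rw [h1, mul_one] at h3
      exact h2.trans h3.symm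
    · rintro rfl _ ⟨l₁, hl₁, x, rfl⟩ _ ⟨l₂, hl₂, x', rfl⟩
      have e1 := hσ.unique l₁ hl₁
      have e2 := hτ.unique l₂ hl₂
      have h3 := hfe (l₁ w • x) (l₂ w' • x')
      simp only [map_smul, smul_eq_mul] at h3
      simp only [e1 (σ _ _), e2 (τ _ _)]
      exact h3
  have hex : ∃! c : ℂ, IsGammaFactor ψ hmn σ τ c :=
      ⟨L w', (hpair _).2 rfl, fun c hc => (hpair c).1 hc⟩
  have hγ : gammaFactor ψ hmn σ τ = L w' := by
    rw [gammaFactor, dif_pos hex]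
    exact (hpair _).1 hex.choose_spec.1
  rw [hγ, ← hL', hL]

end Gamma

/-! ### Vanishing on rows and radicals of maximal parabolic subgroups -/

section RowVanishing

variable {F : Type*} [Field F] {n : ℕ} {ψ : AddChar F ℂ}

/-- `D` vanishes at all `g` whose row `n - 1 - r` is the last unit vector. -/
def VanishesOnRow (r : ℕ) (D : GL (Fin n) F → ℂ) : Prop :=
  ∀ g : GL (Fin n) F, ∀ i j : Fin n, (i : ℕ) + r + 1 = n → (j : ℕ) + 1 = n →
    g i = Pi.single j 1 → D g = 0

theorem rotation_apply_of_lt {r : ℕ} (hr : r ≤ n) {i : Fin n} (hi : (i : ℕ) + r < n) :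
    (rotation n r hr i : ℕ) = i + r := by rw [rotation_apply, if_pos hi]

/-- Left equivariance, moved through a rotation. -/
theorem rotation_mul_of_left {r : ℕ} (hr : r ≤ n) {D : GL (Fin n) F → ℂ}
    (hD : ∀ u ∈ upperUnipotent F n, ∀ g, D (u * g) = unipotentChar ψ u * D g)
    {v : GL (Fin n) F} (hv : v ∈ upperUnipotent F n)
    (hvr : ∀ i j : Fin n, (i : ℕ) < r → r ≤ (j : ℕ) → v i j = 0) (g : GL (Fin n) F) :
    D (permGL (rotation n r hr) * (v * g)) =
      unipotentChar ψ v * D (permGL (rotation n r hr) * g) := by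
  obtain ⟨h1, h2⟩ := rotation_conj_mem hr hv hvr
  rw [← h2 ψ, ← hD _ h1]
  congr 1
  group

/-- A bi-equivariant function that vanishes on `permGL (rotation n r) · diag(GL_r, 1)` vanishes on
the elements whose row `n - 1 - r` is the last unit vector. -/
theorem VanishesOnRow.of_diagEmbed (hψ : ψ ≠ 1) {r : ℕ} (hr : r < n) {D : GL (Fin n) F → ℂ}
    (hD : IsBiWhittaker ψ D)
    (h : ∀ h : GL (Fin r) F, D (permGL (rotation n r hr.le) * diagEmbed hr h) = 0) :
    VanishesOnRow r D := by
  intro g i j hi hj hg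
  have hp : (permGL (rotation n r hr.le))⁻¹ * g ∈ mirabolic F n := by
    intro k hk
    obtain rfl : k = j := Fin.ext (by omega)
    have h1 : rotation n r hr.le i = k :=
      Fin.ext (by rw [rotation_apply_of_lt hr.le (by omega)]; omega)
    rw [← hg, ← h1, ← permGL_mul_row, mul_inv_cancel_left]
  have h1 := eq_zero_of_blockGroup hψ hr (b := fun p => D (permGL (rotation n r hr.le) * p))
    (fun u hu g => by rw [← mul_assoc]; exact hD.right u hu _)
    (fun K I hIK hK y hy hy' g => by
      rw [rotation_mul_of_left hr.le hD.left (colTransv_mem hy), unipotentChar_colTransv hIK]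
      intro i j hi hj
      rw [colTransv, transv_apply, if_neg (by rintro rfl; omega), hy' i hi]
      simp)
    (fun k hrk hk ρ h hρ g => by
      have hidx : ∀ i j : Fin n, rotation n r hr.le i = k → ρ (rotation n r hr.le j) ≠ 0 →
          (i : ℕ) + 1 < j := by
        intro i j hi hj
        have h1 : (rotation n r hr.le j : ℕ) < r := by
          by_contra h; exact hj (hρ _ (by omega))
        rw [← hi] at hrk hk
        have := i.2
        have := j.2
        rw [rotation_apply] at h1 hrk hk
        split_ifs at h1 hrk hk <;> omega
      rw [← mul_assoc, permGL_mul_transv, mul_assoc, hD.left, unipotentChar_transv_eq_one, one_smul]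
      · intro i j hij
        by_contra hne
        push Not at hne
        have := hidx i j (by
          by_contra h; exact hne.1 (Pi.single_eq_of_ne h _)) hne.2
        omega
      · refine transv_mem_upperUnipotent fun i j hij => ?_
        by_contra hne
        push Not at hne
        have := hidx i j (by
          by_contra h; exact hne.1 (Pi.single_eq_of_ne h _)) hne.2
        omega)
    (fun g hg => by
      obtain ⟨x, rfl⟩ := exists_diagEmbed_eq hr hg
      exact h x) hp
  simpa using h1

end RowVanishing

theorem single_vecMul' {F : Type*} [Field F] {n : ℕ} (i : Fin n) (t : F) (h : GL (Fin n) F) :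
    Matrix.vecMul (Pi.single i t) (h : Matrix (Fin n) (Fin n) F) = t • h i := by
  rw [show (Pi.single i t : Fin n → F) = t • Pi.single i 1 by rw [← Pi.single_smul]; simp,
    Matrix.smul_vecMul, single_vecMul]

section BlockRadical

/-- The unipotent radical of the maximal standard parabolic subgroup of type `(c, n - c)`. -/
def blockRadical (F : Type*) [Field F] (n c : ℕ) : Subgroup (GL (Fin n) F) :=
  patternGroup (fun i j => (i : ℕ) < c ∧ c ≤ (j : ℕ)) (fun i j k h h' => by omega)
    fun i h => by omega

variable {F : Type*} [Field F] {n c : ℕ} {ψ : AddChar F ℂ}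

theorem mem_blockRadical {z : GL (Fin n) F} : z ∈ blockRadical F n c ↔
    ∀ i j : Fin n, ¬ ((i : ℕ) < c ∧ c ≤ (j : ℕ)) → z i j = if i = j then 1 else 0 := Iff.rfl

/-- The maximal standard parabolic subgroup of type `(c, n - c)`. -/
def blockParabolic (F : Type*) [Field F] (n c : ℕ) : Subgroup (GL (Fin n) F) where
  carrier := {g | (∀ i j : Fin n, c ≤ (i : ℕ) → (j : ℕ) < c → g i j = 0) ∧
    ∀ i j : Fin n, c ≤ (i : ℕ) → (j : ℕ) < c → (g⁻¹ : GL (Fin n) F) i j = 0}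
  one_mem' := by
    have h : ∀ i j : Fin n, c ≤ (i : ℕ) → (j : ℕ) < c → (1 : GL (Fin n) F) i j = 0 := by
      intro i j hi hj
      rw [Units.val_one, Matrix.one_apply_ne]
      rintro rfl; omega
    exact ⟨h, by simpa using h⟩
  mul_mem' := by
    have H : ∀ g h : GL (Fin n) F, (∀ i j : Fin n, c ≤ (i : ℕ) → (j : ℕ) < c → g i j = 0) →
        (∀ i j : Fin n, c ≤ (i : ℕ) → (j : ℕ) < c → h i j = 0) →
        ∀ i j : Fin n, c ≤ (i : ℕ) → (j : ℕ) < c → (g * h) i j = 0 := by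
      intro g h hg hh i j hi hj
      rw [Matrix.GeneralLinearGroup.coe_mul, Matrix.mul_apply]
      refine Finset.sum_eq_zero fun k _ => ?_
      by_cases hk : (k : ℕ) < c
      · rw [hg i k hi hk, zero_mul]
      · rw [hh k j (by omega) hj, mul_zero]
    intro g h hg hh
    exact ⟨H g h hg.1 hh.1, by rw [mul_inv_rev]; exact H _ _ hh.2 hg.2⟩
  inv_mem' := fun hg => ⟨hg.2, by rw [inv_inv]; exact hg.1⟩

theorem upperUnipotent_le_blockParabolic : upperUnipotent F n ≤ blockParabolic F n c := by
  have H : ∀ u ∈ upperUnipotent F n, ∀ i j : Fin n, c ≤ (i : ℕ) → (j : ℕ) < c → u i j = 0 := by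
    intro u hu i j hi hj
    rw [hu i j (by simp only; omega), if_neg]
    rintro rfl; omega
  exact fun u hu => ⟨H u hu, H _ (inv_mem hu)⟩

theorem conj_mem_blockRadical {g : GL (Fin n) F} (hg : g ∈ blockParabolic F n c)
    {z : GL (Fin n) F} (hz : z ∈ blockRadical F n c) : g * z * g⁻¹ ∈ blockRadical F n c := by
  have hzr : ∀ i : Fin n, c ≤ (i : ℕ) → z i = Pi.single i 1 := fun i hi =>
    row_eq_single_of fun j => mem_blockRadical.1 hz i j (by omega)
  have hzc : FixesColumns c z := fun j hj => mulVec_single_eq_iff.2 fun i =>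
    mem_blockRadical.1 hz i j (by omega)
  rw [mem_blockRadical]
  intro i j hij
  by_cases hj : (j : ℕ) < c
  · refine mulVec_single_eq_iff.1 ?_ i
    rw [mul_assoc, mulVec_mul, mulVec_mul, hzc.mulVec]
    · rw [← mulVec_mul, mul_inv_cancel, Units.val_one, Matrix.one_mulVec]
    · intro k hk
      rw [Matrix.mulVec_single_one]
      exact hg.2 k j hk hj
  · have h1 : (g * z * g⁻¹) i = Pi.single i 1 := by
      rw [glMul_row, glMul_row, vecMul_eq_self (g := z), ← glMul_row, mul_inv_cancel, glOne_row]
      refine fun k hk => hzr k ?_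
      by_contra hkc
      exact hk (hg.1 i k (by omega) (by omega))
    rw [h1, Pi.single_apply]; simp [eq_comm]

theorem IsMonomial.inv_row {m : GL (Fin n) F} {π : Equiv.Perm (Fin n)} {a : Fin n → F}
    (hm : IsMonomial m π a) (i : Fin n) :
    (m⁻¹ : GL (Fin n) F) (π i) = Pi.single i (a i)⁻¹ := by
  rw [← single_vecMul]
  exact vecMul_glInv (by rw [hm.vecMul, inv_mul_cancel₀ (hm.ne_zero i)])

/-- A left `ψ`-equivariant function that is right invariant under the radical of a maximal parabolic
subgroup is determined by its values on the closed Bruhat cell that contains the rotation. -/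
theorem eq_zero_of_blockRadical_invariant (hψ : ψ ≠ 1) (hcn : c < n) {φ : GL (Fin n) F → ℂ}
    (hl : ∀ u ∈ upperUnipotent F n, ∀ g, φ (u * g) = unipotentChar ψ u * φ g)
    (hr : ∀ z ∈ blockRadical F n c, ∀ g, φ (g * z) = φ g)
    (h : ∀ q ∈ blockParabolic F n c, φ (permGL (rotation n c hcn.le) * q) = 0)
    (g : GL (Fin n) F) : φ g = 0 := by
  obtain ⟨u, hu, v, hv, m, π, a, hm, rfl⟩ := bruhat g
  rw [mul_assoc, hl u hu]
  refine mul_eq_zero_of_right _ ?_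
  by_contra hne
  -- otherwise a root subgroup of the radical is conjugate to a simple one, where `ψ ≠ 1`
  have hstep : ∀ i j : Fin n, (i : ℕ) + 1 = j → (π i : ℕ) < c → (π j : ℕ) < c := by
    intro i j hij hi
    by_contra hj
    have hne' : i ≠ j := by rintro rfl; omega
    have hπ : π i ≠ π j := fun h => hne' (π.injective h)
    refine mul_ne_zero (hm.ne_zero i) (inv_ne_zero (hm.ne_zero j))
      (eq_zero_of_addChar_mul_eq hψ fun t => ?_)
    have h0 : (Pi.single (π j) 1 : Fin n → F) ⬝ᵥ Pi.single (π i) t = 0 := by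
      rw [single_one_dotProduct, Pi.single_eq_of_ne hπ.symm]
    have hz : transv (Pi.single (π i) t) (Pi.single (π j) 1) h0 ∈ blockRadical F n c := by
      refine transv_mem_patternGroup fun x y hxy => ?_
      by_contra hcon
      push Not at hcon
      have hx : x = π i := by by_contra h; exact hcon.1 (Pi.single_eq_of_ne h _)
      have hy : y = π j := by by_contra h; exact hcon.2 (Pi.single_eq_of_ne h _)
      subst hx hy
      omega
    set z := transv (Pi.single (π i) t) (Pi.single (π j) 1) h0 with hzdef
    have h1 : φ (m * z * v) = φ (m * v) := by
      have h2 := conj_mem_blockRadical (inv_mem (upperUnipotent_le_blockParabolic hv)) hz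
      rw [← hr _ h2 (m * v)]
      congr 1
      group
    have ha : Matrix.mulVec (m : Matrix (Fin n) (Fin n) F) (Pi.single (π i) t) =
        Pi.single i (a i * t) := by
      rw [hm.mulVec]
      ext k
      by_cases hk : k = i
      · subst hk; simp
      · rw [Pi.single_eq_of_ne hk, Pi.single_eq_of_ne (fun h => hk (π.injective h)), mul_zero]
    have hb : Matrix.vecMul (Pi.single j (a j)⁻¹) (m : Matrix (Fin n) (Fin n) F) =
        Pi.single (π j) 1 := by rw [hm.vecMul, inv_mul_cancel₀ (hm.ne_zero j)]
    rw [hzdef, mul_transv h0 ha hb, mul_assoc, hl, unipotentChar_transv i j hij, Pi.single_eq_same,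
      Pi.single_eq_same] at h1
    · have h2 := mul_eq_right₀ hne |>.1 h1
      rw [← h2]
      congr 1
      ring
    · intro x y _ hx
      left
      exact Pi.single_eq_of_ne hx _
    · refine transv_mem_upperUnipotent fun x y hxy => ?_
      by_contra hcon
      push Not at hcon
      have hx : x = i := by by_contra h; exact hcon.1 (Pi.single_eq_of_ne h _)
      have hy : y = j := by by_contra h; exact hcon.2 (Pi.single_eq_of_ne h _)
      subst hx hy
      omega
  have hup : ∀ i j : Fin n, i ≤ j → (π i : ℕ) < c → (π j : ℕ) < c := by
    intro i j hij hi
    obtain ⟨k, hk⟩ := Nat.exists_eq_add_of_le (Fin.le_def.1 hij)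
    induction k generalizing j with
    | zero => rwa [show j = i from Fin.ext (by omega)]
    | succ k ih =>
      exact hstep ⟨i + k, by omega⟩ j (by simp only; omega)
        (ih ⟨i + k, by omega⟩ (Fin.le_def.2 (by simp)) rfl)
  -- so `π` sends exactly the last `c` indices to the first `c`, as the rotation does
  have hiff : ∀ i : Fin n, n ≤ (i : ℕ) + c ↔ (π i : ℕ) < c := by
    intro i
    have := i.2
    constructor
    · intro hi
      by_contra hlt
      have h1 : (Finset.Iic i).card ≤ (Finset.Ici (⟨c, hcn⟩ : Fin n)).card := by
        refine Finset.card_le_card_of_injOn π (fun j hj => ?_) π.injective.injOn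
        simp only [Finset.coe_Iic, Set.mem_Iic] at hj
        simp only [Finset.coe_Ici, Set.mem_Ici, Fin.le_def]
        by_contra hlt'
        exact hlt (hup j i hj (by omega))
      rw [Fin.card_Iic, Fin.card_Ici] at h1
      simp only at h1
      omega
    · intro hi
      have h1 : (Finset.Ici i).card ≤ (Finset.Iio (⟨c, hcn⟩ : Fin n)).card := by
        refine Finset.card_le_card_of_injOn π (fun j hj => ?_) π.injective.injOn
        simp only [Finset.coe_Ici, Set.mem_Ici] at hj
        simp only [Finset.coe_Iio, Set.mem_Iio, Fin.lt_def]
        exact hup i j hj hi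
      rw [Fin.card_Ici, Fin.card_Iio] at h1
      simp only at h1
      omega
  apply hne
  have hκ : ∀ i, c ≤ (rotation n c hcn.le i : ℕ) ↔ c ≤ (π i : ℕ) := by
    intro i
    have := i.2
    have h1 := hiff i
    rw [rotation_apply]
    split_ifs <;> omega
  rw [show m * v = permGL (rotation n c hcn.le) * ((permGL (rotation n c hcn.le))⁻¹ * m * v) by group]
  refine h _ (mul_mem ⟨fun k j hk hj => ?_,
      fun k j hk hj => ?_⟩ (upperUnipotent_le_blockParabolic hv))
  · obtain ⟨i, rfl⟩ := (rotation n c hcn.le).surjective k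
    rw [← permGL_mul_row, mul_inv_cancel_left, hm i, Pi.single_eq_of_ne]
    rintro rfl
    rw [hκ] at hk
    omega
  · obtain ⟨i, rfl⟩ := π.surjective k
    rw [mul_inv_rev, inv_inv, glMul_row, hm.inv_row, single_vecMul', Pi.smul_apply, permGL_row,
      Pi.single_eq_of_ne, smul_zero]
    rintro rfl
    rw [← hκ] at hk
    omega

end BlockRadical

/-! ### Averages over the radical of a maximal parabolic subgroup -/

section TailUnipotent

/-- The subgroup `diag(1, U_{n-c})` of `U_n`. -/
def tailUnipotent (F : Type*) [Field F] (n c : ℕ) : Subgroup (GL (Fin n) F) :=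
  patternGroup (fun i j => c ≤ (i : ℕ) ∧ (i : ℕ) < (j : ℕ)) (fun i j k h h' => by omega)
    fun i h => by omega

variable {F : Type*} [Field F] {n c : ℕ}

theorem mem_tailUnipotent {z : GL (Fin n) F} : z ∈ tailUnipotent F n c ↔
    ∀ i j : Fin n, ¬ (c ≤ (i : ℕ) ∧ (i : ℕ) < (j : ℕ)) → z i j = if i = j then 1 else 0 := Iff.rfl

theorem tailUnipotent_le : tailUnipotent F n c ≤ upperUnipotent F n := by
  intro z hz i j hij
  have hij' : ¬ (i : ℕ) < j := hij
  exact mem_tailUnipotent.1 hz i j (by omega)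

theorem tailUnipotent_apply_eq_zero {z : GL (Fin n) F} (hz : z ∈ tailUnipotent F n c) {i j : Fin n}
    (hi : (i : ℕ) < c) (hj : c ≤ (j : ℕ)) : z i j = 0 := by
  rw [mem_tailUnipotent.1 hz i j (by omega), if_neg]
  rintro rfl; omega

theorem tailUnipotent_row {z : GL (Fin n) F} (hz : z ∈ tailUnipotent F n c) {i : Fin n}
    (hi : (i : ℕ) < c) : z i = Pi.single i 1 :=
  row_eq_single_of fun j => mem_tailUnipotent.1 hz i j (by omega)

theorem tailUnipotent_fixesColumns {z : GL (Fin n) F} (hz : z ∈ tailUnipotent F n c) :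
    FixesColumns c z := fun j hj => mulVec_single_eq_iff.2 fun i =>
  mem_tailUnipotent.1 hz i j (by omega)

theorem tailUnipotent_commute {z g : GL (Fin n) F} (hz : z ∈ tailUnipotent F n c)
    (hg : g ∈ blockGroup c) : g * z = z * g := by
  refine Units.ext (funext fun i => ?_)
  by_cases hi : (i : ℕ) < c
  · rw [glMul_row_of_single (tailUnipotent_row hz hi), glMul_row, vecMul_eq_self]
    intro j hj
    refine tailUnipotent_row hz ?_
    by_contra hjc
    rw [mem_blockGroup.1 hg i j (Or.inr (by omega))] at hj
    apply hj
    rw [if_neg]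
    rintro rfl; omega
  · rw [glMul_row_of_single (hg.1 i (by omega)), glMul_row, vecMul_blockGroup hg]
    intro j hj
    rw [mem_tailUnipotent.1 hz i j (by omega), if_neg]
    rintro rfl; omega

end TailUnipotent

section TailRotation

/-- The permutation that fixes `i < c` and rotates the other indices by `d`. -/
def tailRotation (n c d : ℕ) (h : c + d ≤ n) : Equiv.Perm (Fin n) where
  toFun i := ⟨if (i : ℕ) < c then i else if (i : ℕ) + d < n then i + d else i + d + c - n,
    by have := i.2; split_ifs <;> omega⟩
  invFun i := ⟨if (i : ℕ) < c then i else if (i : ℕ) < c + d then i + n - c - d else i - d,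
    by have := i.2; split_ifs <;> omega⟩
  left_inv i := by
    have := i.2
    ext
    dsimp only
    split_ifs <;> omega
  right_inv i := by
    have := i.2
    ext
    dsimp only
    split_ifs <;> omega

theorem tailRotation_apply {n c d : ℕ} (h : c + d ≤ n) (i : Fin n) :
    (tailRotation n c d h i : ℕ) =
      if (i : ℕ) < c then (i : ℕ) else if (i : ℕ) + d < n then i + d else i + d + c - n := rfl

theorem tailRotation_symm_apply {n c d : ℕ} (h : c + d ≤ n) (i : Fin n) :
    ((tailRotation n c d h).symm i : ℕ) =
      if (i : ℕ) < c then (i : ℕ) else if (i : ℕ) < c + d then i + n - c - d else i - d := rfl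

variable {F : Type*} [Field F] {n m : ℕ}

theorem diagEmbed_permGL_row (hmn : m < n) (π : Equiv.Perm (Fin m)) (k : Fin m) :
    diagEmbed hmn (permGL π : GL (Fin m) F) (k.castLE hmn.le) =
      Pi.single ((π k).castLE hmn.le) 1 := by
  ext j
  by_cases hj : (j : ℕ) < m
  · obtain ⟨j, rfl⟩ : ∃ j' : Fin m, j'.castLE hmn.le = j := ⟨⟨j, hj⟩, rfl⟩
    rw [diagEmbed_apply_castLE, permGL_row, Pi.single_apply, Pi.single_apply]
    simp
  · have hk := k.2
    have hk' := (π k).2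
    rw [mem_blockGroup.1 (diagEmbed_mem hmn _) _ _ (Or.inr (not_lt.1 hj)), if_neg,
      Pi.single_eq_of_ne]
    · rintro rfl; exact hj hk'
    · rintro rfl; exact hj hk

/-- The rotation by `c + d` of `n` indices, followed by the rotation by `c` inside the first `c + d`
of them, is the rotation by `c` of `n` indices followed by a rotation of the last `n - c`. -/
theorem rotation_mul_diagEmbed_rotation {c d : ℕ} (h : c + d < n) :
    permGL (rotation n (c + d) h.le) * diagEmbed h (permGL (rotation (c + d) c (by omega))) =
      (permGL (rotation n c (by omega)) * permGL (tailRotation n c d h.le) : GL (Fin n) F) := by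
  refine Units.ext (funext fun i => ?_)
  rw [permGL_mul_row, permGL_mul_row, permGL_row]
  have hi := i.2
  have h1 := rotation_apply h.le i
  have h2 := rotation_apply (show c ≤ n by omega) i
  have h3 := tailRotation_apply h.le (rotation n c (by omega) i)
  by_cases hlt : (rotation n (c + d) h.le i : ℕ) < c + d
  · have h4 : rotation n (c + d) h.le i = Fin.castLE h.le ⟨_, hlt⟩ := rfl
    rw [h4, diagEmbed_permGL_row]
    congr 1
    ext
    have h5 := rotation_apply (show c ≤ c + d by omega) ⟨_, hlt⟩
    simp only [Fin.val_castLE]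
    rw [h5, h3]
    simp only
    split_ifs at h1 h2 ⊢ <;> omega
  · rw [(diagEmbed_mem h _).1 _ (not_lt.1 hlt)]
    congr 1
    ext
    rw [h3]
    split_ifs at h1 h2 ⊢ <;> omega

end TailRotation

section RadicalSum

variable {F : Type*} [Field F] [Finite F] {n c d : ℕ} {ψ : AddChar F ℂ}

/-- Averaging over the radical of type `(c, d)` makes a bi-equivariant function, as a function of
the left factor `p`, right invariant under the transvections with rows in `[0, c)` and columns in
`(c, n)`. Such a transvection is carried by `tailRotation` to a product of an element of the
radical, which is absorbed by the average, and an element of the short radical, on which `ψ` is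
trivial. -/
theorem radicalSum_mul_transv (h : c + d < n) {D : GL (Fin n) F → ℂ} (hD : IsBiWhittaker ψ D)
    (h' : GL (Fin (c + d)) F) {a b : Fin n → F} (ha : ∀ i : Fin n, c ≤ (i : ℕ) → a i = 0)
    (hb : ∀ i : Fin n, (i : ℕ) ≤ c → b i = 0) (hba : b ⬝ᵥ a = 0) (p : GL (Fin n) F) :
    ∑ x : blockRadical F (c + d) c, D (p * transv a b hba *
        (permGL (tailRotation n c d h.le) * diagEmbed h ((x : GL (Fin (c + d)) F) * h'))) =
      ∑ x : blockRadical F (c + d) c, D (p *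
        (permGL (tailRotation n c d h.le) * diagEmbed h ((x : GL (Fin (c + d)) F) * h'))) := by
  set ρ := tailRotation n c d h.le with hρ
  let b' : Fin n → F := fun j => b (ρ.symm j)
  have hb' : ∀ j : Fin n, (j : ℕ) < c ∨ (j : ℕ) = c + d → b' j = 0 := by
    intro j hj
    have := j.2
    refine hb _ ?_
    rw [hρ, tailRotation_symm_apply]
    split_ifs <;> omega
  -- `b₁` gives the part inside `diag(GL_{c+d}, 1)`, `b₂` the part in the short radical
  let b₁ : Fin n → F := fun j => if (j : ℕ) < c + d then b' j else 0
  let b₂ : Fin n → F := fun j => if (j : ℕ) < c + d then 0 else b' j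
  have hb₁₂ : b₁ + b₂ = b' := by
    ext j
    simp only [b₁, b₂, Pi.add_apply]
    split_ifs <;> simp
  have horth : ∀ β : Fin n → F, (∀ j : Fin n, (j : ℕ) < c → β j = 0) → β ⬝ᵥ a = 0 := by
    intro β hβ
    rw [dotProduct]
    refine Finset.sum_eq_zero fun j _ => ?_
    by_cases hj : (j : ℕ) < c
    · rw [hβ j hj, zero_mul]
    · rw [ha j (by omega), mul_zero]
  have h₁ : b₁ ⬝ᵥ a = 0 := horth _ fun j hj => by
    simp only [b₁]; rw [hb' j (Or.inl hj)]; simp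
  have h₂ : b₂ ⬝ᵥ a = 0 := horth _ fun j hj => by
    simp only [b₂]; rw [hb' j (Or.inl hj)]; simp
  have hconj : transv a b hba * permGL ρ = permGL ρ * (transv a b₁ h₁ * transv a b₂ h₂) := by
    rw [transv_mul_transv_right, permGL_mul_transv]
    congr 2
    · ext i
      by_cases hi : (i : ℕ) < c
      · have : ρ i = i := Fin.ext (by rw [hρ, tailRotation_apply, if_pos hi])
        rw [this]
      · rw [ha i (by omega), ha]
        rw [hρ, tailRotation_apply]
        have := i.2
        split_ifs <;> omega
    · ext i
      rw [hb₁₂]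
      simp [b']
  obtain ⟨x₀, hx₀⟩ := exists_diagEmbed_eq h (g := transv a b₁ h₁)
      (mem_blockGroup.2 fun i j hij => by
    rw [transv_apply, add_eq_left]
    rcases hij with hi | hj
    · rw [ha i (by omega), zero_mul]
    · simp only [b₁]
      rw [if_neg (by omega), mul_zero])
  have hx₀mem : x₀ ∈ blockRadical F (c + d) c := by
    rw [mem_blockRadical]
    intro i j hij
    rw [← diagEmbed_apply_castLE h, hx₀, transv_apply]
    simp only [Fin.castLE_inj, add_eq_left]
    by_cases hi : (i : ℕ) < c
    · have : b₁ (j.castLE h.le) = 0 := by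
        simp only [b₁]
        rw [hb' _ (Or.inl (by simp only [Fin.val_castLE]; omega))]
        simp
      rw [this, mul_zero]
    · rw [ha _ (by simp only [Fin.val_castLE]; omega), zero_mul]
  have hz₂ : transv a b₂ h₂ ∈ shortRadical F n (c + d) := by
    refine transv_mem_patternGroup fun i j hij => ?_
    by_cases hi : (i : ℕ) < c
    · right
      simp only [b₂]
      by_cases hj : (j : ℕ) < c + d
      · rw [if_pos hj]
      · rw [if_neg hj, hb' j (by omega)]
    · left; exact ha i (by omega)
  rw [← sum_subgroup_mul_left _ (fun x => D (p * (permGL ρ * diagEmbed h (x * h')))) hx₀mem]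
  refine Finset.sum_congr rfl fun x _ => ?_
  have hy := diagEmbed_conj_mem_shortRadical h ((x : GL (Fin (c + d)) F) * h') hz₂
  rw [← one_smul ℂ (D (p * (permGL ρ * diagEmbed h (x₀ * (x : GL (Fin (c + d)) F) * h')))),
    ← unipotentChar_shortRadical ψ hy, ← hD.right _ (shortRadical_le hy)]
  congr 1
  rw [mul_assoc x₀, diagEmbed_mul h x₀, hx₀]
  calc _ = p * (transv a b hba * permGL ρ) * diagEmbed h ((x : GL (Fin (c + d)) F) * h') := by group
    _ = _ := by rw [hconj]; group

/-- The vanishing statement behind the cuspidality argument: `D` is summed against a function `ϕ`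
that transforms under `diag(1, U_{n-c})` like a translate of a Bessel function. -/
theorem sum_mul_radicalSum_eq_zero (hψ : ψ ≠ 1) (h : c + d < n) {D : GL (Fin n) F → ℂ}
    (hD : IsBiWhittaker ψ D) (hDd : VanishesOnRow d D) {ϕ : GL (Fin n) F → ℂ}
    (hϕ : ∀ z ∈ tailUnipotent F n c, ∀ p, ϕ (p * z) = (unipotentChar ψ z)⁻¹ * ϕ p)
    (h' : GL (Fin (c + d)) F) :
    ∑ p : mirabolic F n, ϕ p * ∑ x : blockRadical F (c + d) c,
      D ((p : GL (Fin n) F) * (permGL (tailRotation n c d h.le) * diagEmbed h ((x :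
          GL (Fin (c + d)) F) * h'))) = 0 := by
  set B : GL (Fin n) F → ℂ := fun p => ∑ x : blockRadical F (c + d) c,
      D (p * (permGL (tailRotation n c d h.le) * diagEmbed h ((x :
          GL (Fin (c + d)) F) * h'))) with hB
  have htail : tailUnipotent F n c ≤ mirabolic F n :=
    tailUnipotent_le.trans upperUnipotent_le_mirabolic
  -- `ϕ` only sees the right `ψ`-equivariant part of `B` under `diag(1, U_{n-c})`
  let B' : GL (Fin n) F → ℂ := fun p => ∑ z : tailUnipotent F n c,
    (unipotentChar ψ (z : GL (Fin n) F))⁻¹ * B (p * z)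
  have hB'l : ∀ u ∈ upperUnipotent F n, ∀ p, B' (u * p) = unipotentChar ψ u * B' p := by
    intro u hu p
    simp only [B', B, Finset.mul_sum]
    refine Finset.sum_congr rfl fun z _ => Finset.sum_congr rfl fun x _ => ?_
    rw [mul_assoc u, mul_assoc u, hD.left u hu, smul_eq_mul, mul_left_comm]
  have hB'z : ∀ z ∈ tailUnipotent F n c, ∀ p, B' (p * z) = unipotentChar ψ z * B' p := by
    intro z hz p
    simp only [B']
    rw [Finset.mul_sum, ← sum_subgroup_mul_left _
      (fun x => unipotentChar ψ z * ((unipotentChar ψ x)⁻¹ * B (p * x))) hz]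
    refine Finset.sum_congr rfl fun x _ => ?_
    rw [unipotentChar_mul (tailUnipotent_le hz) (tailUnipotent_le x.2), mul_inv, ← mul_assoc,
      mul_inv_cancel_left₀ (unipotentChar_ne_zero (tailUnipotent_le hz)), mul_assoc]
  have hB't : ∀ (a b : Fin n → F) (hba : b ⬝ᵥ a = 0), (∀ i : Fin n, c ≤ (i : ℕ) → a i = 0) →
      (∀ i : Fin n, (i : ℕ) ≤ c → b i = 0) → ∀ p, B' (p * transv a b hba) = B' p := by
    intro a b hba ha hb p
    simp only [B']
    refine Finset.sum_congr rfl fun z _ => ?_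
    have h1 : Matrix.mulVec ((z : GL (Fin n) F) : Matrix (Fin n) (Fin n) F) a = a :=
      (tailUnipotent_fixesColumns z.2).mulVec ha
    have h2 : ∀ i : Fin n, (i : ℕ) ≤ c →
        Matrix.vecMul b ((z : GL (Fin n) F) : Matrix (Fin n) (Fin n) F) i = 0 := by
      intro i hi
      rw [Matrix.vecMul, dotProduct]
      refine Finset.sum_eq_zero fun j _ => ?_
      by_cases hj : (j : ℕ) ≤ c
      · rw [hb j hj, zero_mul]
      · rw [tailUnipotent_le z.2 j i (by simp only; omega), if_neg, mul_zero]
        rintro rfl; omega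
    have h3 := mul_transv (g := (z : GL (Fin n) F)) (b' := b)
      (b := Matrix.vecMul b ((z : GL (Fin n) F) : Matrix (Fin n) (Fin n) F)) (a := a)
      (by rw [← Matrix.dotProduct_mulVec, h1, hba]) h1 rfl
    rw [mul_assoc, ← h3, ← mul_assoc]
    congr 1
    exact radicalSum_mul_transv h hD h' ha h2 _ _
  have hB'zero : ∀ p ∈ mirabolic F n, B' p = 0 := by
    intro p hp
    by_contra hne
    obtain ⟨u, hu, g, hg, rfl⟩ := exists_eq_mul_blockGroup hψ (r := c) (by omega) hB'l
      (fun K I hIK hK y hy p _ => by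
        let a : Fin n → F := fun i => if (i : ℕ) < c then y i else 0
        let b : Fin n → F := fun i => if (i : ℕ) < c then 0 else y i
        have ha : ∀ i : Fin n, c ≤ (i : ℕ) → a i = 0 := fun i hi => if_neg (by omega)
        have hb : ∀ i, K ≤ i → b i = 0 := by
          intro i hi
          simp only [b]
          rw [hy i hi]
          simp
        have hab : a + b = y := by
          ext i
          simp only [a, b, Pi.add_apply]
          split_ifs <;> simp
        have h1 : colTransv y K (hy K le_rfl) =
            colTransv a K (ha K hK.le) * colTransv b K (hb K le_rfl) := by
          rw [colTransv_mul]; simp only [hab]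
        have h2 : colTransv b K (hb K le_rfl) ∈ tailUnipotent F n c := by
          refine transv_mem_patternGroup fun i j hij => ?_
          by_cases hj : j = K
          · subst hj
            left
            by_cases hi : (i : ℕ) < c
            · simp [b, hi]
            · exact hb i (Fin.le_def.2 (by omega))
          · right; exact Pi.single_eq_of_ne hj _
        have h3 : B' (p * colTransv a K (ha K hK.le)) = B' p :=
          hB't a _ _ ha (fun i hi => Pi.single_eq_of_ne (by rintro rfl; omega) _) p
        rw [h1, ← mul_assoc, hB'z _ h2, h3, unipotentChar_colTransv hIK]
        simp only [b]
        rw [if_neg (by omega)])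
      hp hne
    apply hne
    rw [hB'l u hu]
    refine mul_eq_zero_of_right _ (Finset.sum_eq_zero fun z _ => mul_eq_zero_of_right _ ?_)
    refine Finset.sum_eq_zero fun x _ => ?_
    rw [tailUnipotent_commute z.2 hg, mul_assoc, hD.left _ (tailUnipotent_le z.2)]
    refine smul_eq_zero_of_right _ ?_
    let i : Fin n := ⟨n - 1 - d, by omega⟩
    let j : Fin n := ⟨n - 1, by omega⟩
    refine hDd _ i j (by simp only [i]; omega) (by simp only [j]; omega) ?_
    have hij : tailRotation n c d h.le i = j := by
      ext
      rw [tailRotation_apply]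
      simp only [i, j]
      split_ifs <;> omega
    rw [glMul_row_of_single (hg.1 i (by simp only [i]; omega)), permGL_mul_row, hij]
    exact (diagEmbed_mem h _).1 j (by simp only [j]; omega)
  refine mul_left_cancel₀ (card_subgroup_ne_zero (tailUnipotent F n c)) ?_
  rw [mul_zero]
  calc _ = ∑ z : tailUnipotent F n c, ∑ p : mirabolic F n, ϕ p * B p := by
          rw [Finset.sum_const, Finset.card_univ, nsmul_eq_mul]
    _ = ∑ z : tailUnipotent F n c, ∑ p : mirabolic F n,
        ϕ p * ((unipotentChar ψ (z : GL (Fin n) F))⁻¹ * B (p * z)) := by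
      refine Finset.sum_congr rfl fun z _ => ?_
      rw [← sum_subgroup_mul_right _ (fun p => ϕ p * B p) (htail z.2)]
      refine Finset.sum_congr rfl fun p _ => ?_
      rw [hϕ z z.2]
      ring
    _ = ∑ p : mirabolic F n, ϕ p * B' p := by
      rw [Finset.sum_comm]
      simp only [B', Finset.mul_sum]
    _ = 0 := Finset.sum_eq_zero fun p _ => by rw [hB'zero p p.2, mul_zero]

end RadicalSum

/-! ### Cuspidal functions and Whittaker models -/

section Regular

/-- A nonzero invariant subspace of a finite-dimensional representation contains an irreducible
representation, here realized on some `ℂ ^ d`. -/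
theorem exists_irreducible_of_invariant {G X : Type*} [Group G] [AddCommGroup X] [Module ℂ X]
    [FiniteDimensional ℂ X] (R : Representation ℂ G X) (M : Submodule ℂ X)
    (hM : ∀ g, ∀ x ∈ M, R g x ∈ M) (hM0 : M ≠ ⊥) :
    ∃ (d : ℕ) (τ : Representation ℂ G (Fin d → ℂ)) (ι : (Fin d → ℂ) →ₗ[ℂ] X), τ.IsIrreducible ∧
      Function.Injective ι ∧ (∀ t, ι t ∈ M) ∧ ∀ g t, ι (τ g t) = R g (ι t) := by
  induction hk : Module.finrank ℂ M using Nat.strong_induction_on generalizing M with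
  | _ k ih =>
  by_cases hex : ∃ M' : Submodule ℂ X, (∀ g, ∀ x ∈ M', R g x ∈ M') ∧ M' ≠ ⊥ ∧ M' < M
  · obtain ⟨M', h1, h2, h3⟩ := hex
    obtain ⟨d, τ, ι, h4, h5, h6, h7⟩ :=
      ih _ (hk ▸ Submodule.finrank_lt_finrank_of_lt h3) M' h1 h2 rfl
    exact ⟨d, τ, ι, h4, h5, fun t => h3.le (h6 t), h7⟩
  let e := (Module.finBasis ℂ M).equivFun
  let τ : Representation ℂ G (Fin (Module.finrank ℂ M) → ℂ) :=
    { toFun := fun g => e.conj ((R g).restrict (hM g))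
      map_one' := by
        ext t i
        simp [LinearEquiv.conj_apply, LinearMap.restrict_apply]
      map_mul' := by
        intro g h
        ext t i
        simp [LinearEquiv.conj_apply, LinearMap.restrict_apply] }
  let ι : (Fin (Module.finrank ℂ M) → ℂ) →ₗ[ℂ] X := M.subtype ∘ₗ e.symm.toLinearMap
  have hι : Function.Injective ι := M.injective_subtype.comp e.symm.injective
  have hτ : ∀ g t, ι (τ g t) = R g (ι t) := by
    intro g t
    simp [ι, τ, LinearEquiv.conj_apply, LinearMap.restrict_apply]
  refine ⟨_, τ, ι, ?_, hι, fun t => (e.symm t).2, hτ⟩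
  have : Nontrivial M := (Submodule.nontrivial_iff_ne_bot).2 hM0
  refine { exists_pair_ne := ⟨⊥, ⊤, fun h => ?_⟩, eq_bot_or_eq_top := fun N => ?_ }
  · obtain ⟨x, hx⟩ := exists_ne (0 : M)
    have h1 : e x ∈ (⊥ : Subrepresentation τ).toSubmodule := h ▸ (Submodule.mem_top : e x ∈ ⊤)
    exact hx (e.map_eq_zero_iff.1 ((Submodule.mem_bot ℂ).1 h1))
  · by_contra hN
    push Not at hN
    refine hex ⟨N.toSubmodule.map ι, ?_, ?_, ?_⟩
    · rintro g _ ⟨t, ht, rfl⟩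
      exact ⟨τ g t, N.apply_mem_toSubmodule g ht, hτ g t⟩
    · intro h
      refine hN.1 (Subrepresentation.toSubmodule_injective ?_)
      exact Submodule.map_injective_of_injective hι (h.trans (Submodule.map_bot ι).symm)
    · refine lt_of_le_of_ne ?_ fun h => hN.2 (Subrepresentation.toSubmodule_injective ?_)
      · rintro _ ⟨t, _, rfl⟩
        exact (e.symm t).2
      · refine (eq_top_iff.2 fun t _ => ?_ : N.toSubmodule = ⊤)
        have h1 : ι t ∈ N.toSubmodule.map ι := by rw [h]; exact (e.symm t).2
        obtain ⟨t', ht', h2⟩ := h1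
        rwa [← hι h2]

variable {F : Type*} [Field F] {n : ℕ}

/-- The unipotent radical of a proper standard parabolic subgroup contains that of a maximal one. -/
theorem exists_blockRadical_le_unipotentRadical {b : Fin n → ℕ} (hb : Monotone b)
    (hb' : ∃ i j, b i < b j) :
    ∃ c, 0 < c ∧ c < n ∧ blockRadical F n c ≤ unipotentRadical b := by
  obtain ⟨i, j, hij⟩ := hb'
  have hlt : i < j := by
    by_contra h
    exact absurd (hb (not_lt.1 h)) (not_le.2 hij)
  -- the first index at which `b` exceeds the value `b i`
  have hex : ∃ c : ℕ, ∃ h : c < n, b i < b ⟨c, h⟩ := ⟨j, j.2, hij⟩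
  classical
  obtain ⟨hcn, hc⟩ := Nat.find_spec hex
  have hmin : ∀ k : Fin n, (k : ℕ) < Nat.find hex → b k ≤ b i := by
    intro k hk
    by_contra h
    exact Nat.find_min hex hk ⟨k.2, not_le.1 h⟩
  refine ⟨Nat.find hex, ?_, hcn, fun z hz k l hkl => ?_⟩
  · by_contra h0
    have : (⟨Nat.find hex, hcn⟩ : Fin n) ≤ i := Fin.le_def.2 (by simp only; omega)
    exact absurd (hb this) (not_le.2 hc)
  · refine mem_blockRadical.1 hz k l fun h => hkl ?_
    exact (hmin k h.1).trans_lt (hc.trans_le (hb (Fin.le_def.2 h.2)))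

variable [Finite F] {ψ : AddChar F ℂ}

/-- A cuspidal function that is left `ψ`-equivariant is determined by its pairings with the
Whittaker models of irreducible cuspidal representations: the complex conjugate of such a function
generates a cuspidal representation, inside the induction of `ψ⁻¹`. -/
theorem eq_zero_of_cuspidal_of_orthogonal {f : GL (Fin n) F → ℂ}
    (hl : ∀ u ∈ upperUnipotent F n, ∀ g, f (u * g) = unipotentChar ψ u * f g)
    (hcusp : ∀ c, 0 < c → c < n → ∀ g g', ∑ x : blockRadical F n c, f (g * x * g') = 0)
    (horth : ∀ (T : Type) [AddCommGroup T] [Module ℂ T] (τ : Representation ℂ (GL (Fin n) F) T),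
      IsIrreducibleCuspidal τ → ∀ l' : T →ₗ[ℂ] ℂ, IsWhittakerFunctional τ ψ⁻¹ l' →
        ∀ v, ∑ g, f g * l' (τ g v) = 0) : f = 0 := by
  let R : Representation ℂ (GL (Fin n) F) (GL (Fin n) F → ℂ) :=
    { toFun := fun g => LinearMap.funLeft ℂ ℂ (fun x => x * g)
      map_one' := by ext φ x; simp [LinearMap.funLeft]
      map_mul' := by intro g h; ext φ x; simp [LinearMap.funLeft, mul_assoc] }
  have hR : ∀ g φ x, R g φ x = φ (x * g) := fun _ _ _ => rfl
  let fc : GL (Fin n) F → ℂ := fun x => starRingEnd ℂ (f x)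
  -- the right translates of `conj f`; all of them are `ψ⁻¹`-equivariant and cuspidal
  let M : Submodule ℂ (GL (Fin n) F → ℂ) := Submodule.span ℂ (Set.range fun g => R g fc)
  have hM : ∀ g, ∀ x ∈ M, R g x ∈ M := by
    intro g φ hφ
    induction hφ using Submodule.span_induction with
    | mem w hw =>
      obtain ⟨g', rfl⟩ := hw
      exact Submodule.subset_span ⟨g * g', by simp only [map_mul]; rfl⟩
    | zero => simp
    | add a b _ _ ha hb => rw [map_add]; exact add_mem ha hb
    | smul c a _ ha => rw [map_smul]; exact Submodule.smul_mem _ c ha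
  have hMl : ∀ φ ∈ M, ∀ u ∈ upperUnipotent F n, φ u = unipotentChar ψ⁻¹ u * φ 1 := by
    intro φ hφ u hu
    induction hφ using Submodule.span_induction with
    | mem w hw =>
      obtain ⟨g', rfl⟩ := hw
      simp only [hR, fc]
      rw [hl u hu, map_mul, unipotentChar_inv_conj, unipotentChar_inv_char, one_mul]
    | zero => simp
    | add a b _ _ ha hb => rw [Pi.add_apply, Pi.add_apply, ha, hb, mul_add]
    | smul c a _ ha => rw [Pi.smul_apply, Pi.smul_apply, ha, smul_eq_mul, smul_eq_mul,
        mul_left_comm]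
  have hMc : ∀ φ ∈ M, ∀ c, 0 < c → c < n → ∀ g, ∑ x : blockRadical F n c, φ (g * x) = 0 := by
    intro φ hφ c hc0 hc g
    induction hφ using Submodule.span_induction with
    | mem w hw =>
      obtain ⟨g', rfl⟩ := hw
      simp only [hR, fc]
      rw [← map_sum, hcusp c hc0 hc, map_zero]
    | zero => simp
    | add a b _ _ ha hb => simp only [Pi.add_apply]; rw [Finset.sum_add_distrib, ha, hb, add_zero]
    | smul c a _ ha => simp only [Pi.smul_apply]; rw [← Finset.smul_sum, ha, smul_zero]
  by_contra hf
  have hM0 : M ≠ ⊥ := by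
    intro h
    apply hf
    have h1 : R 1 fc ∈ M := Submodule.subset_span ⟨1, rfl⟩
    rw [h, Submodule.mem_bot] at h1
    ext x
    have h2 := congrFun h1 x
    rw [hR, mul_one] at h2
    exact (map_eq_zero _).1 h2
  obtain ⟨d, τ, ι, hirr, hinj, hιM, hιτ⟩ := exists_irreducible_of_invariant R M hM hM0
  have hcuspτ : IsIrreducibleCuspidal τ := by
    refine ⟨hirr, fun b hb hb' t ht => ?_⟩
    obtain ⟨c, hc0, hcn, hle⟩ := exists_blockRadical_le_unipotentRadical (F := F) hb hb'
    refine hinj ?_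
    rw [map_zero]
    ext g
    have h1 := hMc (ι t) (hιM t) c hc0 hcn g
    rw [Finset.sum_congr rfl (g := fun _ => ι t g)] at h1
    · rw [Finset.sum_const, Finset.card_univ, nsmul_eq_mul] at h1
      exact (mul_eq_zero.1 h1).resolve_left (card_subgroup_ne_zero _)
    · intro x _
      rw [← hR (x : GL (Fin n) F) (ι t) g, ← hιτ, ht _ (hle x.2)]
  let ev : (Fin d → ℂ) →ₗ[ℂ] ℂ := LinearMap.proj (1 : GL (Fin n) F) ∘ₗ ι
  have hev : ∀ g t, ev (τ g t) = ι t g := by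
    intro g t
    simp only [ev, LinearMap.comp_apply, LinearMap.proj_apply]
    rw [hιτ, hR, one_mul]
  have hW : IsWhittakerFunctional τ ψ⁻¹ ev := by
    intro u hu t
    rw [hev, hMl _ (hιM t) u hu]; rfl
  have h0 : ∀ t, ∑ g, f g * ι t g = 0 := by
    intro t
    have := horth _ τ hcuspτ ev hW t
    simpa only [hev] using this
  -- the image of `ι` is orthogonal to `M`, although contained in it
  have h1 : ∀ φ ∈ M, ∀ t, ∑ g, starRingEnd ℂ (φ g) * ι t g = 0 := by
    intro φ hφ
    induction hφ using Submodule.span_induction with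
    | mem w hw =>
      obtain ⟨g', rfl⟩ := hw
      intro t
      rw [← h0 (τ g'⁻¹ t)]
      refine Eq.trans ?_ (Equiv.sum_comp (Equiv.mulRight g') _)
      refine Finset.sum_congr rfl fun g _ => ?_
      change starRingEnd ℂ (starRingEnd ℂ (f (g * g'))) * ι t g = f (g * g') * ι (τ g'⁻¹ t) (g * g')
      rw [Complex.conj_conj, hιτ, hR, mul_inv_cancel_right]
    | zero => simp
    | add a b _ _ ha hb =>
      intro t
      simp only [Pi.add_apply, map_add, add_mul]
      rw [Finset.sum_add_distrib, ha, hb, add_zero]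
    | smul c a _ ha =>
      intro t
      simp only [Pi.smul_apply, smul_eq_mul, map_mul, mul_assoc]
      rw [← Finset.mul_sum, ha, mul_zero]
  obtain ⟨t, ht⟩ := exists_ne_zero_of_irreducible hirr
  apply ht
  refine hinj ?_
  rw [map_zero]
  ext g
  have h2 := h1 (ι t) (hιM t) t
  simp only [← Complex.normSq_eq_conj_mul_self] at h2
  rw [← Complex.ofReal_sum, Complex.ofReal_eq_zero,
    Finset.sum_eq_zero_iff_of_nonneg fun _ _ => Complex.normSq_nonneg _] at h2
  exact Complex.normSq_eq_zero.1 (h2 g (Finset.mem_univ g))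

end Regular

/-! ### Comparison of two cuspidal representations -/

section Comparison

variable {F : Type*} [Field F] {n : ℕ} {ψ : AddChar F ℂ}
  {V₁ : Type*} [AddCommGroup V₁] [Module ℂ V₁] {V₂ : Type*} [AddCommGroup V₂] [Module ℂ V₂]
  {σ₁ : Representation ℂ (GL (Fin n) F) V₁} {σ₂ : Representation ℂ (GL (Fin n) F) V₂}
  {l₁ : V₁ →ₗ[ℂ] ℂ} {w₁ : V₁} {l₂ : V₂ →ₗ[ℂ] ℂ} {w₂ : V₂}

theorem isBiWhittaker_bessel_sub (h₁ : IsWhittakerPair σ₁ ψ l₁ w₁)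
    (h₂ : IsWhittakerPair σ₂ ψ l₂ w₂) :
    IsBiWhittaker ψ fun g => bessel σ₁ l₁ w₁ g - bessel σ₂ l₂ w₂ g := by
  constructor <;> intro u hu g <;> simp only [smul_eq_mul]
  · rw [h₁.bessel_mul_left hu, h₂.bessel_mul_left hu, mul_sub]
  · rw [h₁.bessel_mul_right hu, h₂.bessel_mul_right hu, mul_sub]

/-- Bessel functions agree on the mirabolic subgroup. -/
theorem vanishesOnRow_zero (hψ : ψ ≠ 1) (hn : 0 < n) (h₁ : IsWhittakerPair σ₁ ψ l₁ w₁)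
    (h₂ : IsWhittakerPair σ₂ ψ l₂ w₂) :
    VanishesOnRow 0 fun g => bessel σ₁ l₁ w₁ g - bessel σ₂ l₂ w₂ g := by
  intro g i j hi hj hg
  have hp : g ∈ mirabolic F n := by
    intro k hk
    obtain rfl : k = i := Fin.ext (by omega)
    obtain rfl : k = j := Fin.ext (by omega)
    exact hg
  by_cases hU : g ∈ upperUnipotent F n
  · simp only [h₁.bessel_of_mem hU, h₂.bessel_of_mem hU, sub_self]
  · simp only [h₁.bessel_mirabolic hψ hn hp hU, h₂.bessel_mirabolic hψ hn hp hU, sub_self]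

/-- Cuspidal representations with the same Bessel function are isomorphic: both are isomorphic to
the space of functions spanned by the right translates of the Bessel function. -/
theorem nonempty_equiv_of_bessel_eq (hσ₁ : σ₁.IsIrreducible) (hσ₂ : σ₂.IsIrreducible)
    (h₁ : IsWhittakerPair σ₁ ψ l₁ w₁) (h₂ : IsWhittakerPair σ₂ ψ l₂ w₂)
    (h : ∀ g, bessel σ₁ l₁ w₁ g = bessel σ₂ l₂ w₂ g) : Nonempty (σ₁.Equiv σ₂) := by
  let A₁ : V₁ →ₗ[ℂ] GL (Fin n) F → ℂ := LinearMap.pi fun g => l₁ ∘ₗ σ₁ g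
  let A₂ : V₂ →ₗ[ℂ] GL (Fin n) F → ℂ := LinearMap.pi fun g => l₂ ∘ₗ σ₂ g
  have hA₁ : Function.Injective A₁ := by
    rw [injective_iff_map_eq_zero]
    exact fun v hv => h₁.kirillov v fun p _ => congrFun hv p
  have hA₂ : Function.Injective A₂ := by
    rw [injective_iff_map_eq_zero]
    exact fun v hv => h₂.kirillov v fun p _ => congrFun hv p
  have hw₁ : w₁ ≠ 0 := fun h0 => by
    have := h₁.apply_eq_one
    rw [h0, map_zero] at this
    exact zero_ne_one this
  have hw₂ : w₂ ≠ 0 := fun h0 => by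
    have := h₂.apply_eq_one
    rw [h0, map_zero] at this
    exact zero_ne_one this
  have htr : ∀ g, A₁ (σ₁ g w₁) = A₂ (σ₂ g w₂) := by
    intro g
    ext x
    change l₁ (σ₁ x (σ₁ g w₁)) = l₂ (σ₂ x (σ₂ g w₂))
    rw [rep_mul_apply, rep_mul_apply]
    exact h (x * g)
  have hrange : LinearMap.range A₁ = LinearMap.range A₂ := by
    apply le_antisymm
    · rintro _ ⟨v, rfl⟩
      exact mem_of_forall_mem_orbit hσ₁ hw₁ A₁ _ (fun g => by rw [htr]; exact ⟨_, rfl⟩) v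
    · rintro _ ⟨v, rfl⟩
      exact mem_of_forall_mem_orbit hσ₂ hw₂ A₂ _ (fun g => by rw [← htr]; exact ⟨_, rfl⟩) v
  let e : V₁ ≃ₗ[ℂ] V₂ := (LinearEquiv.ofInjective A₁ hA₁).trans
    ((LinearEquiv.ofEq _ _ hrange).trans (LinearEquiv.ofInjective A₂ hA₂).symm)
  have he : ∀ v, A₂ (e v) = A₁ v := by
    intro v
    have h3 : LinearEquiv.ofInjective A₂ hA₂ (e v) =
        LinearEquiv.ofEq _ _ hrange (LinearEquiv.ofInjective A₁ hA₁ v) := by simp [e]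
    exact congrArg Subtype.val h3
  refine ⟨Representation.Equiv.mk e fun g => LinearMap.ext fun v => hA₂ ?_⟩
  ext x
  change A₂ (e (σ₁ g v)) x = A₂ (σ₂ g (e v)) x
  rw [he]
  have h4 := congrFun (he v) (x * g)
  change l₁ (σ₁ x (σ₁ g v)) = l₂ (σ₂ x (σ₂ g (e v)))
  rw [rep_mul_apply, rep_mul_apply]
  exact h4.symm

variable [Finite F]

/-- Cuspidality of the difference `D` of two Bessel functions along
`permGL (rotation n (c + d)) · diag(GL_{c+d}, 1)`, given that `D` vanishes on the rows belonging to
`c` and `d`. By the Bruhat decomposition only `h` in the coset of the rotation by `c` matters; there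
`J₁` and `J₂` have the same first factor in the convolution formula, by the vanishing on the row of
`c`, so that `D` is a sum over the mirabolic subgroup of `J₁` against a radical average of `D`,
which is zero by the vanishing on the row of `d`. -/
theorem sum_radical_bessel_sub (hψ : ψ ≠ 1) {c d : ℕ} (hcd : c + d < n) (hd : 0 < d)
    (h₁ : IsWhittakerPair σ₁ ψ l₁ w₁) (h₂ : IsWhittakerPair σ₂ ψ l₂ w₂)
    (hSc : VanishesOnRow c fun g => bessel σ₁ l₁ w₁ g - bessel σ₂ l₂ w₂ g)
    (hSd : VanishesOnRow d fun g => bessel σ₁ l₁ w₁ g - bessel σ₂ l₂ w₂ g)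
    (h h' : GL (Fin (c + d)) F) :
    ∑ x : blockRadical F (c + d) c,
      (bessel σ₁ l₁ w₁ (permGL (rotation n (c + d) hcd.le) *
          diagEmbed hcd (h * (x : GL (Fin (c + d)) F) * h')) -
        bessel σ₂ l₂ w₂ (permGL (rotation n (c + d) hcd.le) *
          diagEmbed hcd (h * (x : GL (Fin (c + d)) F) * h'))) = 0 := by
  have hD := isBiWhittaker_bessel_sub h₁ h₂
  set D : GL (Fin n) F → ℂ := fun g => bessel σ₁ l₁ w₁ g - bessel σ₂ l₂ w₂ g with hDdef
  have hn : 0 < n := by omega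
  have hcn : c ≤ n := by omega
  have hdc : c < c + d := by omega
  -- the case of the rotation, by the multiplicativity of the Bessel functions
  have hrot : ∀ h', ∑ x : blockRadical F (c + d) c, D (permGL (rotation n (c + d) hcd.le) *
      diagEmbed hcd (permGL (rotation (c + d) c hdc.le) * ((x : GL (Fin (c + d)) F) * h'))) = 0 :=
          by
    intro h'
    have hconv : ∀ g, D (permGL (rotation n c hcn) * g) =
        (Fintype.card (upperUnipotent F n) : ℂ)⁻¹ * ∑ p : mirabolic F n,
          bessel σ₁ l₁ w₁ (permGL (rotation n c hcn) * (p : GL (Fin n) F)⁻¹) * D (p * g) := by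
      intro g
      simp only [D]
      rw [h₁.bessel_mul hψ hn, h₂.bessel_mul hψ hn, ← mul_sub, ← Finset.sum_sub_distrib]
      refine congrArg _ (Finset.sum_congr rfl fun p _ => ?_)
      have h3 : D (permGL (rotation n c hcn) * (p : GL (Fin n) F)⁻¹) = 0 := by
        let i : Fin n := ⟨n - 1 - c, by omega⟩
        let j : Fin n := ⟨n - 1, by omega⟩
        refine hSc _ i j (by simp only [i]; omega) (by simp only [j]; omega) ?_
        have hij : rotation n c hcn i = j := Fin.ext (by
          rw [rotation_apply_of_lt hcn (by simp only [i]; omega)]; simp only [i, j]; omega)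
        rw [permGL_mul_row, hij]
        exact inv_mem p.2 j (by simp only [j]; omega)
      rw [← sub_eq_zero.1 h3]
      ring
    have h4 := sum_mul_radicalSum_eq_zero hψ hcd hD hSd
      (ϕ := fun p => bessel σ₁ l₁ w₁ (permGL (rotation n c hcn) * p⁻¹)) (fun z hz p => by
        have hz' := inv_mem hz
        rw [mul_inv_rev, rotation_mul_of_left hcn (fun u hu g => h₁.bessel_mul_left hu g)
          (tailUnipotent_le hz') (fun i j hi hj => tailUnipotent_apply_eq_zero hz' hi hj),
          unipotentChar_inv (tailUnipotent_le hz)]) h'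
    have h5 : ∀ x : blockRadical F (c + d) c, permGL (rotation n (c + d) hcd.le) *
        diagEmbed hcd (permGL (rotation (c + d) c hdc.le) * ((x : GL (Fin (c + d)) F) * h')) =
        permGL (rotation n c hcn) * (permGL (tailRotation n c d hcd.le) *
          diagEmbed hcd ((x : GL (Fin (c + d)) F) * h')) := by
      intro x
      rw [diagEmbed_mul, ← mul_assoc, rotation_mul_diagEmbed_rotation hcd, mul_assoc]
    simp only [h5, hconv]
    rw [← Finset.mul_sum, Finset.sum_comm]
    simp only [← Finset.mul_sum]
    rw [h4, mul_zero]
  refine eq_zero_of_blockRadical_invariant hψ hdc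
    (φ := fun h => ∑ x : blockRadical F (c + d) c, D (permGL (rotation n (c + d) hcd.le) *
      diagEmbed hcd (h * (x : GL (Fin (c + d)) F) * h'))) ?_ ?_ ?_ h
  · intro u hu g
    rw [Finset.mul_sum]
    refine Finset.sum_congr rfl fun x _ => ?_
    rw [mul_assoc u, mul_assoc u, diagEmbed_mul, rotation_mul_of_left hcd.le hD.left
      ((diagEmbed_mem_upperUnipotent hcd).2 hu), unipotentChar_diagEmbed]
    intro i j hi hj
    rw [mem_blockGroup.1 (diagEmbed_mem hcd u) i j (Or.inr hj), if_neg]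
    rintro rfl; omega
  · intro z hz g
    rw [← sum_subgroup_mul_left _ (fun x => D (permGL (rotation n (c + d) hcd.le) *
      diagEmbed hcd (g * x * h'))) hz]
    simp only [mul_assoc]
  · intro q hq
    rw [← hrot (q * h')]
    have h6 := sum_subgroup_conj (blockRadical F (c + d) c) (g := q⁻¹)
      (fun z hz => by rw [inv_inv]; exact conj_mem_blockRadical hq hz)
      (fun x => D (permGL (rotation n (c + d) hcd.le) *
        diagEmbed hcd (permGL (rotation (c + d) c hdc.le) * (x * (q * h')))))
    rw [← h6]
    refine Finset.sum_congr rfl fun x _ => ?_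
    congr 3
    group

/-- If the gamma factors of `σ₁` and `σ₂` agree up to rank `t < n`, then so do their Bessel
functions at all `g` one of whose rows `n - 1 - t, …, n - 1` is the last unit vector. -/
theorem vanishesOnRow_of_gammaFactor_eq (hψ : ψ ≠ 1) {t : ℕ} (ht : t < n)
    (h₁ : IsWhittakerPair σ₁ ψ l₁ w₁) (h₂ : IsWhittakerPair σ₂ ψ l₂ w₂)
    (hγ : ∀ (r : ℕ) (_ : 1 ≤ r) (_ : r ≤ t) (T : Type) [AddCommGroup T] [Module ℂ T]
      (τ : Representation ℂ (GL (Fin r) F) T), IsIrreducibleCuspidal τ →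
        gammaFactor ψ (by omega : r < n) σ₁ τ = gammaFactor ψ (by omega : r < n) σ₂ τ)
    (r : ℕ) (hrt : r ≤ t) :
    VanishesOnRow r fun g => bessel σ₁ l₁ w₁ g - bessel σ₂ l₂ w₂ g := by
  induction r using Nat.strong_induction_on with
  | _ r ih =>
  have hD := isBiWhittaker_bessel_sub h₁ h₂
  rcases Nat.eq_zero_or_pos r with rfl | hr0
  · exact vanishesOnRow_zero hψ (by omega) h₁ h₂
  have hrn : r < n := by omega
  refine VanishesOnRow.of_diagEmbed hψ hrn hD fun h => ?_
  refine congrFun (eq_zero_of_cuspidal_of_orthogonal (ψ := ψ) (f := fun h : GL (Fin r) F =>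
    bessel σ₁ l₁ w₁ (permGL (rotation n r hrn.le) * diagEmbed hrn h) -
      bessel σ₂ l₂ w₂ (permGL (rotation n r hrn.le) * diagEmbed hrn h)) ?_ ?_ ?_) h
  · intro u hu g
    rw [diagEmbed_mul, ← unipotentChar_diagEmbed hrn]
    refine rotation_mul_of_left (ψ := ψ) (D := fun g => bessel σ₁ l₁ w₁ g - bessel σ₂ l₂ w₂ g)
      hrn.le hD.left ((diagEmbed_mem_upperUnipotent hrn).2 hu) ?_ _
    intro i j hi hj
    rw [mem_blockGroup.1 (diagEmbed_mem hrn u) i j (Or.inr hj), if_neg]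
    rintro rfl; omega
  · intro c hc0 hc g g'
    obtain ⟨d, rfl⟩ : ∃ d, r = c + d := ⟨r - c, by omega⟩
    exact sum_radical_bessel_sub hψ hrn (by omega) h₁ h₂ (ih c hc (by omega))
      (ih d (by omega) (by omega)) g g'
  · intro T _ _ τ hτ l' hl' v
    obtain ⟨l₀, w₀, hpair⟩ := exists_isWhittakerPair (inv_ne_one.2 hψ) hτ
    have e1 := gammaFactor_eq hrn hψ h₁ hpair (l' w₀ • v)
    have e2 := gammaFactor_eq hrn hψ h₂ hpair (l' w₀ • v)
    rw [← hγ r hr0 hrt T τ hτ, ← e1] at e2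
    have hr₁ : ∀ h, shortSum hrn (bessel σ₁ l₁ w₁) (diagEmbed hrn h) = _ := fun h =>
      shortSum_diagEmbed (fun u hu g => h₁.bessel_mul_right hu g) h
    have hr₂ : ∀ h, shortSum hrn (bessel σ₂ l₂ w₂) (diagEmbed hrn h) = _ := fun h =>
      shortSum_diagEmbed (fun u hu g => h₂.bessel_mul_right hu g) h
    simp only [hr₁, hr₂, map_smul, smul_eq_mul, ← hpair.unique l' hl', mul_assoc] at e2
    rw [← Finset.mul_sum, ← Finset.mul_sum] at e2
    have e3 := mul_left_cancel₀ (card_subgroup_ne_zero _)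
      (mul_left_cancel₀ (inv_ne_zero (card_subgroup_ne_zero _)) e2)
    simp only [sub_mul]
    rw [Finset.sum_sub_distrib, e3, sub_self]

/-- Two rows on which the Bessel functions are known to agree combine, through the multiplicativity
of the Bessel functions and `J(g⁻¹) = conj J(g)`. -/
theorem bessel_eq_of_row (hψ : ψ ≠ 1) (h₁ : IsWhittakerPair σ₁ ψ l₁ w₁)
    (h₂ : IsWhittakerPair σ₂ ψ l₂ w₂) {r r' : ℕ}
    (hr : VanishesOnRow r fun g => bessel σ₁ l₁ w₁ g - bessel σ₂ l₂ w₂ g)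
    (hr' : VanishesOnRow r' fun g => bessel σ₁ l₁ w₁ g - bessel σ₂ l₂ w₂ g)
    {g : GL (Fin n) F} {i j : Fin n} (hi : (i : ℕ) + r + 1 = n) (hj : (j : ℕ) + r' + 1 = n)
    (hg : g i = Pi.single j 1) : bessel σ₁ l₁ w₁ g = bessel σ₂ l₂ w₂ g := by
  have hn : 0 < n := by omega
  let k : Fin n := ⟨n - 1, by omega⟩
  have hk : (k : ℕ) + 1 = n := by simp only [k]; omega
  -- in `J((g s) s⁻¹)`, the two factors of the convolution are controlled by one row each
  let s : GL (Fin n) F := permGL (Equiv.swap j k)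
  have hsj : s j = Pi.single k 1 := by
    simp only [s]; rw [permGL_row, Equiv.swap_apply_left]
  have e : g = g * s * s⁻¹ := by group
  rw [e, h₁.bessel_mul hψ hn, h₂.bessel_mul hψ hn]
  refine congrArg _ (Finset.sum_congr rfl fun p _ => ?_)
  have hp : ((p : GL (Fin n) F)⁻¹ : GL (Fin n) F) k = Pi.single k 1 := inv_mem p.2 k hk
  have a1 := sub_eq_zero.1 (hr (g * s * (p : GL (Fin n) F)⁻¹) i k hi hk (by
    rw [mul_assoc, glMul_row_of_single hg, glMul_row_of_single hsj, hp]))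
  have a2 := sub_eq_zero.1 (hr' (s * (p : GL (Fin n) F)⁻¹) j k hj hk (by
    rw [glMul_row_of_single hsj, hp]))
  have a3 : (p : GL (Fin n) F) * s⁻¹ = (s * (p : GL (Fin n) F)⁻¹)⁻¹ := by group
  rw [a1, a3, h₁.bessel_inv, h₂.bessel_inv, a2]

/-- Bessel functions that agree on the rows of index at least `n - 1 - t`, where `2 (t + 1) > n`,
agree. -/
theorem bessel_eq (hψ : ψ ≠ 1) (h₁ : IsWhittakerPair σ₁ ψ l₁ w₁)
    (h₂ : IsWhittakerPair σ₂ ψ l₂ w₂) {ω : Subgroup.center (GL (Fin n) F) →* ℂˣ}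
    (hω₁ : HasCentralCharacter σ₁ ω) (hω₂ : HasCentralCharacter σ₂ ω) {t : ℕ} (ht : t < n)
    (ht' : n < 2 * (t + 1))
    (hr : ∀ r ≤ t, VanishesOnRow r fun g => bessel σ₁ l₁ w₁ g - bessel σ₂ l₂ w₂ g)
    (g : GL (Fin n) F) : bessel σ₁ l₁ w₁ g = bessel σ₂ l₂ w₂ g := by
  obtain ⟨u, hu, v, hv, m, π, a, hm, rfl⟩ := bruhat g
  rw [h₁.bessel_mul_right hv, h₂.bessel_mul_right hv, h₁.bessel_mul_left hu, h₂.bessel_mul_left hu]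
  congr 2
  let k : Fin n := ⟨n - 1 - t, by omega⟩
  -- more than half of the indices are at least `k`, so one of them has its image among them
  obtain ⟨i, hi, hπi⟩ : ∃ i, k ≤ i ∧ k ≤ π i := by
    by_contra hcon
    push Not at hcon
    have h1 : (Finset.Ici k).card ≤ (Finset.Iio k).card := by
      refine Finset.card_le_card_of_injOn π (fun j hj => ?_) π.injective.injOn
      simp only [Finset.coe_Ici, Set.mem_Ici] at hj
      simp only [Finset.coe_Iio, Set.mem_Iio]
      exact hcon j hj
    rw [Fin.card_Ici, Fin.card_Iio] at h1
    simp only [k] at h1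
    omega
  have hi' : n - 1 - t ≤ (i : ℕ) := hi
  have hπi' : n - 1 - t ≤ (π i : ℕ) := hπi
  have hin := i.2
  have hπin := (π i).2
  -- a central element normalizes the entry `a i` to `1`
  let z : GL (Fin n) F := Matrix.GeneralLinearGroup.scalar (Fin n)
      (Units.mk0 (a i) (hm.ne_zero i))⁻¹
  have hz : z ∈ Subgroup.center (GL (Fin n) F) := by
    rw [Matrix.GeneralLinearGroup.center_eq_range_scalar]
    exact ⟨_, rfl⟩
  have hrow : (z * m) i = Pi.single (π i) 1 := by
    ext j
    have : (z * m) i j = (a i)⁻¹ * m i j := by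
      rw [Matrix.GeneralLinearGroup.coe_mul]
      simp [z, Matrix.GeneralLinearGroup.scalar]
    rw [this, hm i, Pi.single_apply, Pi.single_apply]
    split_ifs
    · exact inv_mul_cancel₀ (hm.ne_zero i)
    · rw [mul_zero]
  have h3 := bessel_eq_of_row hψ h₁ h₂ (hr (n - 1 - i) (by omega)) (hr (n - 1 - π i) (by omega))
    (g := z * m) (i := i) (j := π i) (by omega) (by omega) hrow
  have e1 := IsWhittakerPair.bessel_center (l := l₁) (w := w₁) hω₁ ⟨z, hz⟩ m
  have e2 := IsWhittakerPair.bessel_center (l := l₂) (w := w₂) hω₂ ⟨z, hz⟩ m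
  rw [e1, e2] at h3
  exact mul_left_cancel₀ (Units.ne_zero _) h3

end Comparison

end FiniteGL

theorem theorem5p2 {F : Type*} [Field F] [Finite F] (ψ : AddChar F ℂ) (hψ : ψ ≠ 1)
    (n : ℕ) (hn : 1 ≤ n)
    {V₁ : Type*} [AddCommGroup V₁] [Module ℂ V₁] {V₂ : Type*} [AddCommGroup V₂] [Module ℂ V₂]
    (σ₁ : Representation ℂ (GL (Fin n) F) V₁) (σ₂ : Representation ℂ (GL (Fin n) F) V₂)
    (h₁ : FiniteGL.IsIrreducibleCuspidal σ₁) (h₂ : FiniteGL.IsIrreducibleCuspidal σ₂)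
    (ω : Subgroup.center (GL (Fin n) F) →* ℂˣ)
    (hω₁ : FiniteGL.HasCentralCharacter σ₁ ω) (hω₂ : FiniteGL.HasCentralCharacter σ₂ ω)
    (hγ : ∀ (r : ℕ) (_ : 1 ≤ r) (_ : r ≤ n / 2) (T : Type) [AddCommGroup T] [Module ℂ T]
      (τ : Representation ℂ (GL (Fin r) F) T), FiniteGL.IsIrreducibleCuspidal τ →
        FiniteGL.gammaFactor ψ (by omega : r < n) σ₁ τ =
          FiniteGL.gammaFactor ψ (by omega : r < n) σ₂ τ) :
    Nonempty (σ₁.Equiv σ₂) := by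
  obtain ⟨l₁, w₁, hp₁⟩ := FiniteGL.exists_isWhittakerPair hψ h₁
  obtain ⟨l₂, w₂, hp₂⟩ := FiniteGL.exists_isWhittakerPair hψ h₂
  have hS := FiniteGL.vanishesOnRow_of_gammaFactor_eq hψ (t := n / 2) (by omega) hp₁ hp₂ hγ
  exact FiniteGL.nonempty_equiv_of_bessel_eq h₁.1 h₂.1 hp₁ hp₂
    (FiniteGL.bessel_eq hψ hp₁ hp₂ hω₁ hω₂ (by omega) (by omega) hS)
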